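/- Let $G$ be a simple complex Lie group with Weyl group $W$, generated by the simple reflections $s_i$ attached to the nodes $i$ of its Dynkin diagram (equivalently, let $W$ be the Weyl group of an irreducible reduced crystallographic root system, over any field of characteristic $0$, with a chosen base). Let $\omega_0\in W$ be the longest word, i.e. the element of maximal length with respect to the simple reflections. Let $P\subset G$ be a parabolic subgroup, corresponding to a set $J$ of nodes, and let $W_P=\langle s_i : i\in J\rangle\subset W$; the Dynkin diagram of $W_P$ is the full subdiagram on $J$. Let $$a_P=\#\{\omega W_P\in W/W_P \;:\; \omega^{-1}\omega_0\,\omega\in W_P\}.$$ Then $a_P$ takes the following values, according to the types of the Dynkin diagrams of $W$ and $W_P$. 1. If $W$ has type $A_{n-1}$ (so $W\cong S_n$) and the diagram of $W_P$ is $\coprod_{i=1}^r A_{n_i-1}$ (so $W_P\cong\prod_{i=1}^r S_{n_i}$), where $n_1,\dots,n_r$ are positive integers with $n=\sum_{i=1}^r n_i$, at most one of which is odd (and $A_0$ is the empty diagram), then $$a_P=\Big\lfloor \frac n2\Big\rfloor!\Big/\prod_{i=1}^r\Big\lfloor\frac{n_i}2\Big\rfloor!.$$ 2. If $W$ has type $D_{2n+1}$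 and $W_P$ has type $D_{2n}$, with $n\ge 2$, then $a_P=2$. 3. If $W$ has type $E_6$ and $W_P$ has type $D_5$, then $a_P=3$. 4. If $W$ has type $E_6$ and $W_P$ has type $D_4$, then $a_P=6$. In all other cases with $P\neq G$ (that is, $J$ not the set of all nodes), $a_P=0$. -/

import Mathlib

/-!
Weyl groups of irreducible root systems, their simple reflections, word length, the longest word,
standard parabolic subgroups, and the number `a_P`.

A simple complex Lie group enters only through its root system with a chosen base: the Weyl group
`W`, the set of simple reflections (one for each node of the Dynkin diagram), the longest word, and
the parabolic subgroup `W_P` attached to a set of nodes are all defined from it.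
-/

namespace WeylCover

open RootPairing

variable {ι K V V' : Type*} [Field K] [AddCommGroup V] [Module K V] [AddCommGroup V'] [Module K V']

/-- The simple reflection in the Weyl group attached to a node of the Dynkin diagram, that is, to
an element of the base. -/
def simpleReflection {Φ : RootPairing ι K V V'} (b : Φ.Base) (i : b.support) : Φ.weylGroup :=
  weylGroup.ofIdx Φ i

/-- The length of `w` is the least length of a word in the simple reflections with product `w`. -/
noncomputable def length {Φ : RootPairing ι K V V'} (b : Φ.Base) (w : Φ.weylGroup) : ℕ :=
  sInf {k | ∃ l : List b.support, l.length = k ∧ (l.map (simpleReflection b)).prod = w}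

/-- The Weyl group of a finite root system is finite: an automorphism is determined by the way it
permutes the roots. -/
theorem finite_weylGroup [Finite ι] (Φ : RootPairing ι K V V') [Φ.IsRootSystem] :
    Finite Φ.weylGroup := by
  refine Finite.of_injective (fun w : Φ.weylGroup => Φ.weylGroupToPerm w) ?_
  intro g h hgh
  apply Subtype.ext
  apply RootPairing.Equiv.weightHom_injective Φ
  apply LinearEquiv.toLinearMap_injective
  apply LinearMap.ext_on (IsRootSystem.span_root_eq_top (P := Φ))
  rintro _ ⟨i, rfl⟩
  have h1 := Φ.weylGroup_apply_root g i
  have h2 := Φ.weylGroup_apply_root h i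
  simp only at hgh
  rw [hgh] at h1
  exact h1.trans h2.symm

theorem exists_longest [Finite ι] {Φ : RootPairing ι K V V'} [Φ.IsRootSystem] (b : Φ.Base) :
    ∃ w₀ : Φ.weylGroup, ∀ w, length b w ≤ length b w₀ :=
  haveI := finite_weylGroup Φ
  Finite.exists_max (length b)

/-- The longest word: the element of maximal length in the Weyl group. -/
noncomputable def longestWord [Finite ι] {Φ : RootPairing ι K V V'} [Φ.IsRootSystem] (b : Φ.Base) :
    Φ.weylGroup :=
  (exists_longest b).choose

/-- The parabolic subgroup of the Weyl group generated by the simple reflections in a set `J` of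
nodes of the Dynkin diagram. -/
noncomputable def parabolic {Φ : RootPairing ι K V V'} (b : Φ.Base) (J : Set b.support) :
    Subgroup Φ.weylGroup :=
  Subgroup.closure (simpleReflection b '' J)

/-- The number of cosets `ω W_P` in `W / W_P` for which `ω⁻¹ ω₀ ω ∈ W_P`. -/
noncomputable def aP [Finite ι] {Φ : RootPairing ι K V V'} [Φ.IsRootSystem] (b : Φ.Base)
    (J : Set b.support) : ℕ :=
  Set.ncard {q : Φ.weylGroup ⧸ parabolic b J | ∃ ω : Φ.weylGroup,
    (QuotientGroup.mk ω : Φ.weylGroup ⧸ parabolic b J) = q ∧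
      ω⁻¹ * longestWord b * ω ∈ parabolic b J}

/-- Two Cartan matrices are equal up to a relabelling of the nodes, that is, they have isomorphic
Dynkin diagrams. -/
def SameDynkin {α β : Type*} (A : Matrix α α ℤ) (B : Matrix β β ℤ) : Prop :=
  ∃ e : α ≃ β, ∀ i j, A i j = B (e i) (e j)

section Types

variable [CharZero K] {Φ : RootPairing ι K V V'} [Φ.IsCrystallographic]

/-- The Dynkin diagram of `W` is the one of the Cartan matrix `C`. -/
def IsType (b : Φ.Base) {α : Type*} (C : Matrix α α ℤ) : Prop :=
  SameDynkin b.cartanMatrix C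

/-- The Dynkin diagram of `W_P`, that is, the full subdiagram on the set of nodes `J`, is the one
of the Cartan matrix `C`. -/
def ParabolicIsType (b : Φ.Base) (J : Set b.support) {α : Type*} (C : Matrix α α ℤ) : Prop :=
  SameDynkin (b.cartanMatrix.submatrix ((↑) : J → b.support) ((↑) : J → b.support)) C

/-- `W` is the symmetric group `S_n` (type `A_{n-1}`) and `W_P` is `∏ S_{n_i}` (its Dynkin diagram
is the disjoint union of diagrams of type `A_{n_i - 1}`, which are empty for `n_i = 1`), where the
`n_i` are positive integers with sum `n`, at most one of which is odd. -/
def RowA (b : Φ.Base) (J : Set b.support) (n r : ℕ) (m : Fin r → ℕ) : Prop :=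
  IsType b (CartanMatrix.A (n - 1)) ∧
    ParabolicIsType b J (Matrix.blockDiagonal' fun i : Fin r => CartanMatrix.A (m i - 1)) ∧
    (∀ i, 0 < m i) ∧ n = ∑ i, m i ∧ {i | Odd (m i)}.ncard ≤ 1

/-- `W` is of type `D_{2n+1}` and `W_P` is of type `D_{2n}`, with `n ≥ 2`. -/
def RowD (b : Φ.Base) (J : Set b.support) (n : ℕ) : Prop :=
  2 ≤ n ∧ IsType b (CartanMatrix.D (2 * n + 1)) ∧ ParabolicIsType b J (CartanMatrix.D (2 * n))

/-- `W` is of type `E_6` and `W_P` is of type `D_5`. -/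
def RowE6D5 (b : Φ.Base) (J : Set b.support) : Prop :=
  IsType b CartanMatrix.E₆ ∧ ParabolicIsType b J (CartanMatrix.D 5)

/-- `W` is of type `E_6` and `W_P` is of type `D_4`. -/
def RowE6D4 (b : Φ.Base) (J : Set b.support) : Prop :=
  IsType b CartanMatrix.E₆ ∧ ParabolicIsType b J (CartanMatrix.D 4)

end Types

end WeylCover

/-!
Let `chi` be the sum of the fundamental coweights at the nodes outside `J`. It is dominant, so its
stabilizer is `W_P`, the cosets `ω W_P` correspond to the points `ω chi` of its orbit, and the
condition `ω⁻¹ ω₀ ω ∈ W_P` says that `ω₀` fixes the point `ω chi`. Hence `a_P` is the number of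
fixed points of the longest word on the orbit of `chi` (`aP_eq_ncard`). Since `ω₀ αᵢ = -α_{τ i}` for
an involution `τ` of the Dynkin diagram (`opposition`), there are no fixed points for `τ = 1` and
`J` proper, as then `ω₀ = -1` (`aP_eq_zero_of_opposition_eq`).

A connected diagram of finite type with an automorphism of order two that is not trivial is of type
`A`, `D` or `E₆` (`isType_of_opposition`). Such an automorphism reverses a path, a maximal such path
is either everything or has a tail of fixed nodes at its midpoint, and the form being positive
definite bounds the lengths of the arms and excludes any further node.

* In type `A_{n-1}` the orbit of `chi` consists of the rearrangements of a word with fibres of sizes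
  `n₁, …, n_r`, and `ω₀` reverses words, so `a_P` counts palindromes (`aP_eq_ncard_palindromes`).
  These exist if at most one size is odd, and then they are given by their first half, with fibres of
  sizes `⌊nᵢ / 2⌋` (`ncard_palindromes_mul_prod`). The sizes are determined by the diagram of `W_P`
  (`exists_perm_of_sameDynkin`).
* In type `D_n` the Weyl group consists of the permutations with an even number of sign changes. For
  even `n` it contains `-1`. For odd `n` the longest word changes all signs but the last one, so its
  fixed points are `(0, …, 0, c)`; as dominant forms are a fundamental domain, such a point lies on
  the orbit of `chi` only if `J` omits just the end of the long arm and `c = ± 1`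
  (`eq_single_of_fixed`).
* In type `E₆` the longest word is the sixth power of a Coxeter element. The plane of its fixed points
  can be moved to the one spanned by the fundamental coweights at the two ends of the path of length
  five, on which the Weyl group induces the Weyl group of type `A₂`. So `J` contains the other four
  nodes, and `a_P` is the size of the orbit of a weight of type `A₂` (`aP_eq_card_orbitA`).
-/

set_option linter.unusedSectionVars false

/-! ### The longest word and the opposition involution -/

namespace WeylCover

open RootPairing

variable {ι K V V' : Type*} [Field K] [AddCommGroup V] [Module K V] [AddCommGroup V'] [Module K V']
  {Φ : RootPairing ι K V V'}

theorem weylGroup_ext [Φ.IsRootSystem] {g h : Φ.weylGroup}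
    (H : ∀ i, Φ.weylGroupToPerm g i = Φ.weylGroupToPerm h i) : g = h := by
  apply Subtype.ext
  apply RootPairing.Equiv.weightHom_injective Φ
  apply LinearEquiv.toLinearMap_injective
  apply LinearMap.ext_on (IsRootSystem.span_root_eq_top (P := Φ))
  rintro _ ⟨i, rfl⟩
  have h1 := Φ.weylGroup_apply_root g i
  have h2 := Φ.weylGroup_apply_root h i
  rw [H i] at h1
  exact h1.trans h2.symm

theorem weylGroup_smul_smul (w : Φ.weylGroup) (c : K) (v : V) : w • (c • v) = c • (w • v) :=
  smul_comm _ _ _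

theorem weylGroup_smul_nsmul (w : Φ.weylGroup) (n : ℕ) (v : V) : w • (n • v) = n • (w • v) :=
  map_nsmul (DistribSMul.toAddMonoidHom V w) n v

theorem ofIdx_toPerm (i j : ι) :
    Φ.weylGroupToPerm (weylGroup.ofIdx Φ i) j = Φ.reflectionPerm i j := rfl

theorem root_reflectionPerm_same (i : ι) : Φ.root (Φ.reflectionPerm i i) = -Φ.root i := by
  simp

theorem ofIdx_smul (i : ι) (v : V) : weylGroup.ofIdx Φ i • v = v - Φ.coroot' i v • Φ.root i := by
  rw [← Φ.reflection_apply]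
  rfl

theorem ofIdx_mul_self (i : ι) : weylGroup.ofIdx Φ i * weylGroup.ofIdx Φ i = 1 := by
  rw [mul_eq_one_iff_inv_eq]
  exact Subtype.ext (RootPairing.Equiv.reflection_inv Φ i)

theorem pairing_toPerm (w : Φ.weylGroup) (i j : ι) :
    Φ.pairing (Φ.weylGroupToPerm w i) (Φ.weylGroupToPerm w j) = Φ.pairing i j := by
  obtain ⟨w, hw⟩ := w
  have h := LinearMap.congr_fun (LinearMap.congr_fun w.toHom.weight_coweight_transpose
    (Φ.coroot (w.toHom.indexEquiv j))) (Φ.root i)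
  have h1 := Hom.root_weightMap_apply Φ Φ i w.toHom
  have h2 := Hom.coroot_coweightMap_apply Φ Φ (w.toHom.indexEquiv j) w.toHom
  simp only [LinearMap.comp_apply, LinearMap.dualMap_apply, h1, h2,
    _root_.Equiv.symm_apply_apply] at h
  exact h

/-- Conjugation carries the reflection in a root to the reflection in its image. -/
theorem conj_ofIdx [Φ.IsRootSystem] (w : Φ.weylGroup) (i : ι) :
    w * weylGroup.ofIdx Φ i * w⁻¹ = weylGroup.ofIdx Φ (Φ.weylGroupToPerm w i) := by
  rw [mul_inv_eq_iff_eq_mul]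
  apply weylGroup_ext
  intro k
  rw [map_mul, map_mul, Equiv.Perm.mul_apply, Equiv.Perm.mul_apply]
  apply Φ.root.injective
  rw [← weylGroup_apply_root, ← weylGroup_apply_root, ← weylGroup_apply_root, ofIdx_smul, ofIdx_smul]
  rw [smul_sub, weylGroup_smul_smul, Φ.weylGroup_apply_root w, Φ.weylGroup_apply_root w,
    Φ.root_coroot'_eq_pairing, Φ.root_coroot'_eq_pairing, pairing_toPerm]

section Base

variable (b : Φ.Base)

theorem simpleReflection_mul_self (i : b.support) :
    simpleReflection b i * simpleReflection b i = 1 := ofIdx_mul_self _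

theorem simpleReflection_inv (i : b.support) :
    (simpleReflection b i)⁻¹ = simpleReflection b i :=
  inv_eq_of_mul_eq_one_left (simpleReflection_mul_self b i)

variable [CharZero K]

theorem isPos_iff_of_root_eq_neg {i j : ι} (h : Φ.root i = -Φ.root j) :
    b.IsPos i ↔ ¬ b.IsPos j := by
  have : i = Φ.reflectionPerm j j := by
    apply Φ.root.injective
    simp [h]
  rw [this]
  exact Base.IsPos.neg_iff_not b j

theorem isPos_toPerm_mul_simpleReflection (w : Φ.weylGroup) (i : b.support) :
    b.IsPos (Φ.weylGroupToPerm (w * simpleReflection b i) i) ↔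
      ¬ b.IsPos (Φ.weylGroupToPerm w i) := by
  apply isPos_iff_of_root_eq_neg
  rw [← weylGroup_apply_root, ← weylGroup_apply_root, mul_smul, simpleReflection,
    weylGroup_apply_root, ofIdx_toPerm]
  simp

variable [Finite ι] [Φ.IsRootSystem] [Φ.IsCrystallographic] [Φ.IsReduced]

/-- The Weyl group is generated by the simple reflections: every root is carried to a simple one
by simple reflections, and reflections in roots of one orbit are conjugate. -/
theorem closure_range_simpleReflection : Subgroup.closure (Set.range (simpleReflection b)) = ⊤ := by
  have key (i : ι) : weylGroup.ofIdx Φ i ∈ Subgroup.closure (Set.range (simpleReflection b)) := by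
    refine b.induction_reflect i (p := fun i => weylGroup.ofIdx Φ i ∈
      Subgroup.closure (Set.range (simpleReflection b))) ?_ ?_ ?_
    · intro i hi
      rw [← ofIdx_toPerm, ← conj_ofIdx]
      exact mul_mem (mul_mem hi hi) (inv_mem hi)
    · exact fun i hi => Subgroup.subset_closure ⟨⟨i, hi⟩, rfl⟩
    · intro i j hi hj
      rw [← ofIdx_toPerm, ← conj_ofIdx]
      have := Subgroup.subset_closure (k := Set.range (simpleReflection b)) ⟨⟨j, hj⟩, rfl⟩
      exact mul_mem (mul_mem this hi) (inv_mem this)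
  rw [eq_top_iff]
  rintro ⟨w, hw⟩ -
  induction hw using weylGroup.induction with
  | mem i => exact key i
  | one => exact one_mem _
  | mul x y hx hy hx' hy' => exact mul_mem hx' hy'

theorem exists_word (w : Φ.weylGroup) :
    ∃ l : List b.support, (l.map (simpleReflection b)).prod = w := by
  have hw : w ∈ Subgroup.closure (Set.range (simpleReflection b)) := by
    simp [closure_range_simpleReflection b]
  induction hw using Subgroup.closure_induction with
  | mem x hx =>
    obtain ⟨i, rfl⟩ := hx
    exact ⟨[i], by simp⟩
  | one => exact ⟨[], rfl⟩
  | mul x y _ _ hx hy =>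
    obtain ⟨l, rfl⟩ := hx
    obtain ⟨l', rfl⟩ := hy
    exact ⟨l ++ l', by simp⟩
  | inv x _ hx =>
    obtain ⟨l, rfl⟩ := hx
    refine ⟨l.reverse, ?_⟩
    rw [List.prod_inv_reverse, List.map_reverse, List.map_map]
    congr 3
    ext i : 1
    exact (simpleReflection_inv b i).symm

theorem exists_word_length (w : Φ.weylGroup) :
    ∃ l : List b.support, l.length = length b w ∧ (l.map (simpleReflection b)).prod = w := by
  obtain ⟨l, hl⟩ := exists_word b w
  exact Nat.sInf_mem (s := {k | ∃ l : List b.support, l.length = k ∧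
    (l.map (simpleReflection b)).prod = w}) ⟨_, l, rfl, hl⟩

omit [Finite ι] [Φ.IsRootSystem] [Φ.IsCrystallographic] [Φ.IsReduced] [CharZero K] in
theorem length_le_of_word {b : Φ.Base} {w : Φ.weylGroup} (l : List b.support)
    (hl : (l.map (simpleReflection b)).prod = w) : length b w ≤ l.length :=
  Nat.sInf_le ⟨l, rfl, hl⟩

/-- The exchange property: if `w` makes the simple root `i` negative, then `w sᵢ` is obtained from
any word for `w` by deleting a letter. -/
theorem exists_word_mul_simpleReflection (l : List b.support) (i : b.support)
    (h : ¬ b.IsPos (Φ.weylGroupToPerm (l.map (simpleReflection b)).prod i)) :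
    ∃ l' : List b.support, l'.length + 1 = l.length ∧
      (l'.map (simpleReflection b)).prod =
        (l.map (simpleReflection b)).prod * simpleReflection b i := by
  induction l with
  | nil => exact absurd (b.isPos_of_mem_support i.2) (by simpa using h)
  | cons j l ih =>
    set P := (l.map (simpleReflection b)).prod with hP
    by_cases hpos : b.IsPos (Φ.weylGroupToPerm P i)
    · have hji : Φ.weylGroupToPerm P i = j := by
        by_contra hne
        refine h ?_
        rw [List.map_cons, List.prod_cons, map_mul]
        exact hpos.reflectionPerm j.2 hne
      -- the letter `j` is deleted, as `s_j` is the conjugate of `sᵢ` by `P`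
      refine ⟨l, rfl, ?_⟩
      have hconj : simpleReflection b j = P * simpleReflection b i * P⁻¹ := by
        rw [simpleReflection, simpleReflection, conj_ofIdx, hji]
      rw [List.map_cons, List.prod_cons, ← hP, hconj]
      rw [inv_mul_cancel_right, mul_assoc, simpleReflection_mul_self, mul_one]
    · obtain ⟨l', hl', hl''⟩ := ih hpos
      exact ⟨j :: l', by simp [hl'], by simp [hl'', mul_assoc, ← hP]⟩

theorem length_mul_simpleReflection_lt {w : Φ.weylGroup} {i : b.support}
    (h : ¬ b.IsPos (Φ.weylGroupToPerm w i)) :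
    length b (w * simpleReflection b i) < length b w := by
  obtain ⟨l, hl, rfl⟩ := exists_word_length b w
  obtain ⟨l', hl', h'⟩ := exists_word_mul_simpleReflection b l i h
  have := length_le_of_word l' h'
  omega

theorem length_lt_mul_simpleReflection {w : Φ.weylGroup} {i : b.support}
    (h : b.IsPos (Φ.weylGroupToPerm w i)) :
    length b w < length b (w * simpleReflection b i) := by
  have := length_mul_simpleReflection_lt b (w := w * simpleReflection b i) (i := i)
    (by rw [isPos_toPerm_mul_simpleReflection]; exact not_not.2 h)
  rwa [mul_assoc, simpleReflection_mul_self, mul_one] at this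

theorem eq_one_of_isPos {w : Φ.weylGroup}
    (h : ∀ i : b.support, b.IsPos (Φ.weylGroupToPerm w i)) : w = 1 := by
  obtain ⟨l, hl, hw⟩ := exists_word_length b w
  obtain rfl | ⟨l', i, rfl⟩ := l.eq_nil_or_concat
  · simpa using hw.symm
  · have h1 := length_lt_mul_simpleReflection b (h i)
    have h2 : (l'.map (simpleReflection b)).prod = w * simpleReflection b i := by
      rw [← hw]
      simp [mul_assoc, simpleReflection_mul_self]
    have h3 := length_le_of_word l' h2
    simp at hl
    omega

omit [Finite ι] [Φ.IsRootSystem] [Φ.IsCrystallographic] [Φ.IsReduced] in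
/-- A positive root is a combination of simple roots with natural coefficients. -/
theorem exists_root_eq_sum_nat {k : ι} (hk : b.IsPos k) :
    ∃ c : b.support → ℕ, Φ.root k = ∑ j, c j • Φ.root j := by
  obtain ⟨f, -, h | h⟩ := b.exists_root_eq_sum_nat_or_neg k
  · exact ⟨fun j => f j, by rw [h, ← Finset.sum_coe_sort]⟩
  · exfalso
    have h' : Φ.root k = ∑ j ∈ b.support, (fun j => -(f j : ℤ)) j • Φ.root j := by
      rw [h, ← Finset.sum_neg_distrib]
      simp
    have := b.height_eq_sum h'
    rw [Base.isPos_iff, this, Finset.sum_neg_distrib] at hk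
    have : 0 ≤ ∑ x ∈ b.support, (f x : ℤ) := Finset.sum_nonneg fun _ _ => by positivity
    omega

omit [Finite ι] [Φ.IsRootSystem] [Φ.IsCrystallographic] [Φ.IsReduced] in
theorem height_eq_sum_height {k : ι} {c : b.support → ℤ} {g : b.support → ι}
    (h : Φ.root k = ∑ j, c j • Φ.root (g j)) : b.height k = ∑ j, c j * b.height (g j) := by
  choose f _ _ hf using fun j => b.exists_root_eq_sum_int (g j)
  have : Φ.root k = ∑ i ∈ b.support, (fun i => ∑ j, c j * f j i) i • Φ.root i := by
    rw [h]
    simp_rw [Finset.sum_smul]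
    rw [Finset.sum_comm]
    refine Finset.sum_congr rfl fun j _ => ?_
    rw [hf j, Finset.smul_sum]
    simp [mul_smul]
  rw [b.height_eq_sum this, Finset.sum_comm]
  refine Finset.sum_congr rfl fun j _ => ?_
  rw [b.height_eq_sum (hf j), Finset.mul_sum]

omit [Finite ι] [Φ.IsRootSystem] [Φ.IsCrystallographic] [Φ.IsReduced] in
theorem height_toPerm_eq_sum (w : Φ.weylGroup) {k : ι} {c : b.support → ℕ}
    (h : Φ.root k = ∑ j, c j • Φ.root j) :
    b.height (Φ.weylGroupToPerm w k) = ∑ j, (c j : ℤ) * b.height (Φ.weylGroupToPerm w j) := by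
  apply height_eq_sum_height
  rw [← weylGroup_apply_root, h, Finset.smul_sum]
  refine Finset.sum_congr rfl fun j _ => ?_
  rw [weylGroup_smul_nsmul, weylGroup_apply_root, natCast_zsmul]

omit [Finite ι] [Φ.IsRootSystem] [Φ.IsCrystallographic] [Φ.IsReduced] in
/-- An element that makes every simple root negative makes every positive root negative. -/
theorem not_isPos_toPerm {w : Φ.weylGroup}
    (h : ∀ i : b.support, ¬ b.IsPos (Φ.weylGroupToPerm w i)) {k : ι} (hk : b.IsPos k) :
    ¬ b.IsPos (Φ.weylGroupToPerm w k) := by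
  obtain ⟨c, hc⟩ := exists_root_eq_sum_nat b hk
  rw [Base.isPos_iff, height_toPerm_eq_sum b w hc, not_lt]
  refine Finset.sum_nonpos fun j _ => mul_nonpos_of_nonneg_of_nonpos (by positivity) ?_
  have := h j
  rw [Base.isPos_iff] at this
  omega

theorem longestWord_not_isPos (i : b.support) :
    ¬ b.IsPos (Φ.weylGroupToPerm (longestWord b) i) := fun h =>
  ((exists_longest b).choose_spec _).not_gt (length_lt_mul_simpleReflection b h)

/-- The product of `w₀` with an element that makes every simple root negative makes every simple
root positive, and so is trivial. -/
theorem mul_longestWord {u : Φ.weylGroup}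
    (h : ∀ i : b.support, ¬ b.IsPos (Φ.weylGroupToPerm u i)) : longestWord b * u = 1 := by
  refine eq_one_of_isPos b fun i => ?_
  rw [map_mul, Equiv.Perm.mul_apply]
  set k := Φ.weylGroupToPerm u i with hk
  have hneg : Φ.root k = -Φ.root (Φ.reflectionPerm k k) := by simp
  have hk' : b.IsPos (Φ.reflectionPerm k k) := by
    rw [isPos_iff_of_root_eq_neg b (j := k) (by simp)]
    exact h i
  rw [isPos_iff_of_root_eq_neg b (j := Φ.weylGroupToPerm (longestWord b) (Φ.reflectionPerm k k))]
  · exact not_isPos_toPerm b (longestWord_not_isPos b) hk'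
  · rw [← weylGroup_apply_root, ← weylGroup_apply_root Φ _ (Φ.reflectionPerm k k), ← smul_neg,
      ← hneg]

theorem longestWord_mul_self : longestWord b * longestWord b = 1 :=
  mul_longestWord b (longestWord_not_isPos b)

/-- The longest word is the only element that makes every simple root negative. -/
theorem eq_longestWord {u : Φ.weylGroup}
    (h : ∀ i : b.support, ¬ b.IsPos (Φ.weylGroupToPerm u i)) : u = longestWord b := by
  have h1 := mul_longestWord b h
  rw [← longestWord_mul_self b] at h1
  exact mul_left_cancel h1

/-- The involution `-w₀` permutes the simple roots: it makes them positive, and if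
`-w₀ αᵢ = ∑ cⱼ αⱼ` with natural `cⱼ`, then `αᵢ = ∑ cⱼ (-w₀ αⱼ)`, whose height is at least `∑ cⱼ`. -/
theorem exists_longestWord_smul_root (i : b.support) :
    ∃ j : b.support, longestWord b • Φ.root i = -Φ.root j := by
  set w := longestWord b with hw
  set k := Φ.weylGroupToPerm w i with hk
  have hwi : w • Φ.root i = Φ.root k := weylGroup_apply_root _ _ _
  have hpos : b.IsPos (Φ.reflectionPerm k k) := by
    rw [isPos_iff_of_root_eq_neg b (j := k) (by simp)]
    exact longestWord_not_isPos b i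
  obtain ⟨c, hc⟩ := exists_root_eq_sum_nat b hpos
  have hrk : Φ.root k = -∑ j, c j • Φ.root j := by rw [← hc]; simp
  have hi : Φ.root i = ∑ j, (-(c j : ℤ)) • Φ.root (Φ.weylGroupToPerm w j) := by
    have : Φ.root i = w • w • Φ.root i := by
      rw [← mul_smul, hw, longestWord_mul_self, one_smul]
    rw [this, hwi, hrk, smul_neg, Finset.smul_sum, ← Finset.sum_neg_distrib]
    refine Finset.sum_congr rfl fun j _ => ?_
    rw [weylGroup_smul_nsmul, weylGroup_apply_root, neg_smul, natCast_zsmul]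
  have hh := height_eq_sum_height b hi
  rw [b.height_one_of_mem_support i.2] at hh
  have hle (j : b.support) : (c j : ℤ) ≤ -(c j : ℤ) * b.height (Φ.weylGroupToPerm w j) := by
    have h1 : ¬ b.IsPos (Φ.weylGroupToPerm w j) := longestWord_not_isPos b j
    have h2 := b.height_ne_zero (Φ.weylGroupToPerm w j)
    rw [Base.isPos_iff] at h1
    have : b.height (Φ.weylGroupToPerm w j) ≤ -1 := by omega
    nlinarith [Int.natCast_nonneg (c j)]
  have hsum : ∑ j, (c j : ℤ) ≤ 1 := hh ▸ Finset.sum_le_sum fun j _ => hle j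
  have hsum' : ∑ j, c j ≤ 1 := by exact_mod_cast hsum
  obtain ⟨j, hj⟩ : ∃ j, c j ≠ 0 := by
    by_contra! hcon
    simp only [hcon, zero_smul, Finset.sum_const_zero, neg_zero] at hrk
    exact Φ.ne_zero k hrk
  refine ⟨j, ?_⟩
  have hcj : c j = 1 := by
    have := Finset.single_le_sum (f := c) (fun _ _ => Nat.zero_le _) (Finset.mem_univ j)
    omega
  have hother (l : b.support) (hl : l ≠ j) : c l = 0 := by
    have := Finset.add_le_sum (f := c) (fun _ _ => Nat.zero_le _) (Finset.mem_univ l)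
      (Finset.mem_univ j) hl
    omega
  rw [hwi, hrk, Finset.sum_eq_single j (fun l _ hl => by rw [hother l hl, zero_smul]) (by simp),
    hcj, one_smul]

/-- The permutation `τ` of the nodes with `w₀ αᵢ = -α_{τ i}`. -/
noncomputable def opposition (i : b.support) : b.support :=
  (exists_longestWord_smul_root b i).choose

theorem longestWord_smul_root (i : b.support) :
    longestWord b • Φ.root i = -Φ.root (opposition b i) :=
  (exists_longestWord_smul_root b i).choose_spec

theorem opposition_opposition (i : b.support) : opposition b (opposition b i) = i := by
  apply Subtype.ext
  apply Φ.root.injective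
  have h := longestWord_smul_root b (opposition b i)
  rw [← neg_eq_iff_eq_neg] at h
  rw [← h, ← smul_neg, ← longestWord_smul_root, ← mul_smul, longestWord_mul_self, one_smul]

theorem cartanMatrix_opposition (i j : b.support) :
    b.cartanMatrix (opposition b i) (opposition b j) = b.cartanMatrix i j := by
  have key (i : b.support) : Φ.weylGroupToPerm (longestWord b) i =
      Φ.reflectionPerm (opposition b i) (opposition b i) := by
    apply Φ.root.injective
    rw [← weylGroup_apply_root, longestWord_smul_root]
    simp
  have h := pairing_toPerm (longestWord b) i j
  rw [key, key, pairing_reflectionPerm_self_left, pairing_reflectionPerm_self_right, neg_neg,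
    ← Φ.algebraMap_pairingIn ℤ, ← Φ.algebraMap_pairingIn ℤ] at h
  exact FaithfulSMul.algebraMap_injective ℤ K h

end Base

end WeylCover

/-! ### The orbit of the coweight `chi` -/

namespace WeylCover

open RootPairing

section Action

variable {ι K V V' : Type*} [Field K] [AddCommGroup V] [Module K V] [AddCommGroup V'] [Module K V']
  {Φ : RootPairing ι K V V'} [Φ.IsRootSystem] (b : Φ.Base)

/-- The linear form on the root space with prescribed values on the simple roots. -/
noncomputable def eval (x : b.support → K) : V →ₗ[K] K := b.toWeightBasis.constr K x

theorem eval_root (x : b.support → K) (i : b.support) : eval b x (Φ.root i) = x i := by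
  rw [← b.toWeightBasis_apply, eval, Module.Basis.constr_basis]

/-- The contragredient action of the Weyl group on linear forms on the root space, in the
coordinates given by the values on the simple roots. -/
noncomputable def act (w : Φ.weylGroup) (x : b.support → K) : b.support → K :=
  fun i => eval b x (w⁻¹ • Φ.root i)

theorem eval_act (w : Φ.weylGroup) (x : b.support → K) (v : V) :
    eval b (act b w x) v = eval b x (w⁻¹ • v) := by
  have : eval b (act b w x) = eval b x ∘ₗ DistribSMul.toLinearMap K V (w⁻¹) := by
    refine b.toWeightBasis.ext fun i => ?_
    rw [b.toWeightBasis_apply, eval_root]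
    rfl
  rw [this]
  rfl

theorem act_one (x : b.support → K) : act b 1 x = x := by
  ext i
  rw [act, inv_one, one_smul, eval_root]

theorem act_mul (w u : Φ.weylGroup) (x : b.support → K) : act b (w * u) x = act b w (act b u x) := by
  ext i
  rw [act, act, eval_act, mul_inv_rev, mul_smul]

theorem act_inv_act (w : Φ.weylGroup) (x : b.support → K) : act b w⁻¹ (act b w x) = x := by
  rw [← act_mul, inv_mul_cancel, act_one]

theorem act_injective (w : Φ.weylGroup) : Function.Injective (act b w) :=
  Function.LeftInverse.injective (act_inv_act b w)

variable [CharZero K] [Φ.IsCrystallographic]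

theorem act_simpleReflection (x : b.support → K) (i j : b.support) :
    act b (simpleReflection b j) x i = x i - (b.cartanMatrix i j : K) * x j := by
  rw [act, simpleReflection_inv, simpleReflection, ofIdx_smul, map_sub, map_smul, eval_root,
    eval_root, Φ.root_coroot'_eq_pairing, ← Φ.algebraMap_pairingIn ℤ]
  rfl

variable [Finite ι] [Φ.IsReduced]

theorem act_longestWord (x : b.support → K) (i : b.support) :
    act b (longestWord b) x i = -x (opposition b i) := by
  rw [act, inv_eq_of_mul_eq_one_left (longestWord_mul_self b), longestWord_smul_root, map_neg,
    eval_root]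

/-- Two dominant integral forms in one orbit are equal, and the stabilizer of a dominant form is
parabolic. The proof is by induction on the length: if `w` makes the simple root `αᵢ` negative, then
`x i` is the value of the dominant form `x'` on a negative root, so it vanishes and `w` may be
replaced by `w sᵢ`. -/
theorem eq_and_mem_parabolic_of_act_eq (w : Φ.weylGroup) (x x' : b.support → ℕ)
    (h : act b w (fun i => (x i : K)) = fun i => (x' i : K)) :
    x = x' ∧ w ∈ parabolic b {i | x i = 0} := by
  induction hn : length b w using Nat.strong_induction_on generalizing w with
  | _ n ih =>
    by_cases hpos : ∀ i : b.support, b.IsPos (Φ.weylGroupToPerm w i)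
    · obtain rfl := eq_one_of_isPos b hpos
      rw [act_one] at h
      refine ⟨funext fun i => ?_, one_mem _⟩
      exact_mod_cast congr_fun h i
    · push Not at hpos
      obtain ⟨i, hi⟩ := hpos
      have hneg : b.IsPos (Φ.reflectionPerm (Φ.weylGroupToPerm w i) (Φ.weylGroupToPerm w i)) := by
        rw [isPos_iff_of_root_eq_neg b (root_reflectionPerm_same _)]
        exact hi
      obtain ⟨c, hc⟩ := exists_root_eq_sum_nat b hneg
      have hxi : (x i : K) = -∑ j, (c j : K) * (x' j : K) := by
        have h1 := eval_act b w (fun i => (x i : K)) (w • Φ.root i)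
        rw [← mul_smul, inv_mul_cancel, one_smul, eval_root, h, weylGroup_apply_root] at h1
        rw [← h1, ← neg_inj, neg_neg, ← map_neg]
        have h2 : -Φ.root (Φ.weylGroupToPerm w i) = ∑ j, c j • Φ.root j := by
          rw [← hc, root_reflectionPerm_same]
        rw [h2, map_sum]
        refine Finset.sum_congr rfl fun j _ => ?_
        rw [map_nsmul, eval_root, nsmul_eq_mul]
      have hxi' : x i = 0 := by
        have h1 : ((x i + ∑ j, c j * x' j : ℕ) : K) = 0 := by
          push_cast
          rw [hxi, neg_add_cancel]
        have h2 : x i + ∑ j, c j * x' j = 0 := by exact_mod_cast h1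
        omega
      have hact : act b (simpleReflection b i) (fun i => (x i : K)) = fun i => (x i : K) := by
        ext j
        rw [act_simpleReflection, hxi']
        simp
      obtain ⟨h1, h2⟩ := ih _ (hn ▸ length_mul_simpleReflection_lt b hi) (w * simpleReflection b i)
        (by rw [act_mul, hact, h]) rfl
      refine ⟨h1, ?_⟩
      have h3 : simpleReflection b i ∈ parabolic b {i | x i = 0} :=
        Subgroup.subset_closure ⟨i, hxi', rfl⟩
      simpa [mul_assoc, simpleReflection_mul_self] using mul_mem h2 h3

open Classical in
/-- The sum of the fundamental coweights at the nodes outside `J`; its stabilizer is `W_P`. -/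
noncomputable def chi (J : Set b.support) : b.support → ℕ := fun i => if i ∈ J then 0 else 1

/-- The values of `chi`, as elements of the field. -/
noncomputable def chiK (J : Set b.support) : b.support → K := fun i => (chi b J i : K)

theorem act_chiK_iff (J : Set b.support) (w : Φ.weylGroup) :
    act b w (chiK b J) = chiK b J ↔ w ∈ parabolic b J := by
  constructor
  · intro h
    have := (eq_and_mem_parabolic_of_act_eq b w (chi b J) (chi b J) h).2
    convert this using 2
    ext i
    simp [chi]
  · intro h
    induction h using Subgroup.closure_induction with
    | mem u hu =>
      obtain ⟨j, hj, rfl⟩ := hu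
      ext i
      rw [act_simpleReflection]
      simp [chiK, chi, hj]
    | one => exact act_one b _
    | mul u v _ _ hu hv => rw [act_mul, hv, hu]
    | inv u _ hu => rw [← hu, act_inv_act, hu]

/-- `a_P` counts the fixed points of the longest word on the orbit of `chi`: as `W_P` is the
stabilizer of `chi`, the cosets `ω W_P` correspond to the points `ω chi` of the orbit. -/
theorem aP_eq_ncard (J : Set b.support) :
    aP b J = Set.ncard {x : b.support → K | (∃ w, act b w (chiK b J) = x) ∧
      act b (longestWord b) x = x} := by
  let F : Φ.weylGroup ⧸ parabolic b J → (b.support → K) :=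
    Quotient.lift (fun w => act b w (chiK b J)) fun u v huv => by
      have := (act_chiK_iff b J _).2 (QuotientGroup.leftRel_apply.1 huv)
      rw [act_mul] at this
      exact act_injective b u⁻¹ (by rw [this, act_inv_act])
  have hF (w : Φ.weylGroup) : F (QuotientGroup.mk w) = act b w (chiK b J) := rfl
  have hinj : Function.Injective F := by
    intro p q
    induction p using QuotientGroup.induction_on with | _ u
    induction q using QuotientGroup.induction_on with | _ v
    intro h
    rw [hF, hF] at h
    rw [QuotientGroup.eq, ← act_chiK_iff, act_mul, ← h, act_inv_act]
  rw [aP, ← Set.ncard_image_of_injective _ hinj]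
  congr 1
  ext x
  constructor
  · rintro ⟨_, ⟨w, rfl, hw⟩, rfl⟩
    refine ⟨⟨w, rfl⟩, ?_⟩
    rw [← act_chiK_iff, act_mul, act_mul] at hw
    rw [hF]
    exact act_injective b w⁻¹ (by rw [hw, act_inv_act])
  · rintro ⟨⟨w, rfl⟩, hw⟩
    refine ⟨_, ⟨w, rfl, ?_⟩, hF w⟩
    rw [← act_chiK_iff, act_mul, act_mul, hw, act_inv_act]

/-- Only a nontrivial opposition allows conjugates of the longest word in a proper parabolic
subgroup: otherwise the longest word is `-1`. -/
theorem aP_eq_zero_of_opposition_eq (J : Set b.support) (hJ : J ≠ Set.univ)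
    (h : ∀ i, opposition b i = i) : aP b J = 0 := by
  rw [aP_eq_ncard]
  refine (congrArg Set.ncard ?_).trans (Set.ncard_empty (b.support → K))
  rw [Set.eq_empty_iff_forall_notMem]
  rintro x ⟨⟨w, rfl⟩, hw⟩
  have h0 : act b w (chiK b J) = 0 := by
    ext i
    have := congr_fun hw i
    rw [act_longestWord, h] at this
    exact self_eq_neg.1 this.symm
  have h1 : chiK b J = 0 := by
    rw [← act_inv_act b w (chiK b J), h0]
    ext i
    simp [act, eval]
  apply hJ
  ext i
  have := congr_fun h1 i
  simpa [chiK, chi] using this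

end Action

end WeylCover

/-! ### Diagrams of finite type and Bessel's inequality -/

namespace WeylCover

section Diagram

variable {I : Type*} [Fintype I] [DecidableEq I]

/-- `A` is a Cartan matrix of finite type with symmetrizing weights `d`: the form
`∑ xᵢ dᵢ Aᵢⱼ yⱼ` is symmetric and positive definite. -/
structure IsFiniteCartan (A : I → I → ℤ) (d : I → ℤ) : Prop where
  diag : ∀ i, A i i = 2
  nonpos : ∀ i j, i ≠ j → A i j ≤ 0
  weight_pos : ∀ i, 0 < d i
  symm : ∀ i j, d i * A i j = d j * A j i
  form_pos : ∀ x : I → ℤ, x ≠ 0 → 0 < ∑ i, ∑ j, x i * (d i * A i j) * x j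

/-- The symmetrized bilinear form of a Cartan matrix. -/
def form (A : I → I → ℤ) (d : I → ℤ) (x y : I → ℤ) : ℤ :=
  ∑ i, ∑ j, x i * (d i * A i j) * y j

/-- The indicator function of a set of nodes. -/
def ind (P : Finset I) : I → ℤ := fun i => if i ∈ P then 1 else 0

/-- A set of nodes of equal weight whose sum has the norm of a root. -/
structure IsRootSet (A : I → I → ℤ) (d : I → ℤ) (c : ℤ) (P : Finset I) : Prop where
  nonempty : P.Nonempty
  weight : ∀ i ∈ P, d i = c
  norm : ∑ i ∈ P, ∑ j ∈ P, A i j = 2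

/-- The product of the two Cartan integers between the sum of the nodes in `P` and the node `j`.
For a root set `P` it is four times the squared cosine of the angle between the two. -/
def bond (A : I → I → ℤ) (P : Finset I) (j : I) : ℤ := (∑ i ∈ P, A i j) * (∑ i ∈ P, A j i)

variable {A : I → I → ℤ} {d : I → ℤ}

theorem form_add_left (x x' y : I → ℤ) : form A d (x + x') y = form A d x y + form A d x' y := by
  simp only [form, Pi.add_apply, add_mul, Finset.sum_add_distrib]

theorem form_add_right (x y y' : I → ℤ) : form A d x (y + y') = form A d x y + form A d x y' := by
  simp only [form, Pi.add_apply, mul_add, Finset.sum_add_distrib]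

theorem form_smul_left (a : ℤ) (x y : I → ℤ) : form A d (a • x) y = a * form A d x y := by
  simp only [form, Pi.smul_apply, smul_eq_mul, Finset.mul_sum, mul_assoc]

theorem form_smul_right (a : ℤ) (x y : I → ℤ) : form A d x (a • y) = a * form A d x y := by
  simp only [form, Pi.smul_apply, smul_eq_mul, Finset.mul_sum]
  refine Finset.sum_congr rfl fun i _ => Finset.sum_congr rfl fun j _ => by ring

namespace IsFiniteCartan

variable (h : IsFiniteCartan A d)

include h

theorem form_comm (x y : I → ℤ) : form A d x y = form A d y x := by
  rw [form, form, Finset.sum_comm]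
  refine Finset.sum_congr rfl fun i _ => Finset.sum_congr rfl fun j _ => ?_
  rw [h.symm]
  ring

theorem eq_zero_comm {i j : I} (hij : A i j = 0) : A j i = 0 := by
  have := h.symm i j
  rw [hij, mul_zero] at this
  exact (mul_eq_zero.1 this.symm).resolve_left (h.weight_pos j).ne'

theorem weight_eq {i j : I} (hij : A i j = -1) (hji : A j i = -1) : d i = d j := by
  have := h.symm i j
  rw [hij, hji] at this
  linarith

theorem apply_comm_of_weight_eq {i j : I} (hd : d i = d j) : A i j = A j i := by
  have := h.symm i j
  rw [hd] at this
  exact mul_left_cancel₀ (h.weight_pos j).ne' this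

theorem sum_nonpos {P : Finset I} {j : I} (hj : j ∉ P) : ∑ i ∈ P, A i j ≤ 0 :=
  Finset.sum_nonpos fun i hi => h.nonpos i j (by rintro rfl; exact hj hi)

theorem sum_nonpos' {P : Finset I} {j : I} (hj : j ∉ P) : ∑ i ∈ P, A j i ≤ 0 :=
  Finset.sum_nonpos fun i hi => h.nonpos j i (by rintro rfl; exact hj hi)

theorem sum_le_apply {P : Finset I} {i j : I} (hi : i ∈ P) (hj : j ∉ P) :
    ∑ k ∈ P, A k j ≤ A i j := by
  rw [← Finset.add_sum_erase _ _ hi]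
  have := h.sum_nonpos (P := P.erase i) (j := j) (fun hh => hj (Finset.mem_of_mem_erase hh))
  linarith

theorem sum_le_apply' {P : Finset I} {i j : I} (hi : i ∈ P) (hj : j ∉ P) :
    ∑ k ∈ P, A j k ≤ A j i := by
  rw [← Finset.add_sum_erase _ _ hi]
  have := h.sum_nonpos' (P := P.erase i) (j := j) (fun hh => hj (Finset.mem_of_mem_erase hh))
  linarith

theorem apply_le_neg_one {i j : I} (hij : i ≠ j) (hA : A i j ≠ 0) : A i j ≤ -1 := by
  have := h.nonpos i j hij
  omega

theorem apply_comm_ne_zero {i j : I} (hA : A i j ≠ 0) : A j i ≠ 0 :=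
  fun h0 => hA (h.eq_zero_comm h0)

theorem one_le_bond {P : Finset I} {i j : I} (hi : i ∈ P) (hj : j ∉ P) (hA : A i j ≠ 0) :
    1 ≤ bond A P j := by
  have hij : i ≠ j := by rintro rfl; exact hj hi
  have h1 := (h.sum_le_apply hi hj).trans (h.apply_le_neg_one hij hA)
  have h2 := (h.sum_le_apply' hi hj).trans (h.apply_le_neg_one hij.symm (h.apply_comm_ne_zero hA))
  rw [bond]
  nlinarith

/-- A set of nodes joined to `j` by a single bond contains exactly one neighbour of `j`. -/
theorem eq_neg_one_of_bond_le_one {P : Finset I} {i j : I} (hi : i ∈ P) (hj : j ∉ P)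
    (hA : A i j ≠ 0) (hb : bond A P j ≤ 1) :
    A i j = -1 ∧ A j i = -1 ∧ ∀ k ∈ P, k ≠ i → A k j = 0 := by
  have hij : i ≠ j := by rintro rfl; exact hj hi
  have h1 := h.sum_le_apply hi hj
  have h1' := h.apply_le_neg_one hij hA
  have h2 := h.sum_le_apply' hi hj
  have h2' := h.apply_le_neg_one hij.symm (h.apply_comm_ne_zero hA)
  rw [bond] at hb
  have hs1 : ∑ k ∈ P, A k j = -1 := by nlinarith
  have hs2 : ∑ k ∈ P, A j k = -1 := by nlinarith
  refine ⟨by omega, by omega, fun k hk hki => ?_⟩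
  rw [← Finset.add_sum_erase _ _ hi] at hs1
  have hk' : k ∈ P.erase i := Finset.mem_erase.2 ⟨hki, hk⟩
  have h3 := h.sum_le_apply hk' (fun hh => hj (Finset.mem_of_mem_erase hh))
  have h4 := h.nonpos k j (by rintro rfl; exact hj hk)
  omega

theorem form_ind_left {P : Finset I} (y : I → ℤ) :
    form A d (ind P) y = ∑ j, y j * (d j * ∑ i ∈ P, A j i) := by
  rw [form, Finset.sum_comm]
  refine Finset.sum_congr rfl fun j _ => ?_
  rw [Finset.mul_sum, Finset.mul_sum]
  simp only [ind, ite_mul, one_mul, zero_mul, Finset.sum_ite_mem, Finset.univ_inter]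
  refine Finset.sum_congr rfl fun i _ => ?_
  rw [h.symm i j]
  ring

theorem form_ind_ind {c : ℤ} {P : Finset I} (hP : IsRootSet A d c P) :
    form A d (ind P) (ind P) = 2 * c := by
  rw [h.form_ind_left]
  simp only [ind, ite_mul, one_mul, zero_mul, Finset.sum_ite_mem, Finset.univ_inter]
  rw [Finset.sum_congr rfl fun i hi => by rw [hP.weight i hi], ← Finset.mul_sum, hP.norm, mul_comm]

/-- Bessel's inequality: a root is joined to mutually orthogonal nodes by fewer than four bonds,
counted with multiplicity. -/
theorem sum_bond_lt_four {c : ℤ} {P J : Finset I} (hP : IsRootSet A d c P) (hPJ : Disjoint P J)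
    (hJ : ∀ i ∈ J, ∀ j ∈ J, i ≠ j → A i j = 0) : ∑ j ∈ J, bond A P j < 4 := by
  -- `2 P - u` is twice the component of `P` orthogonal to the nodes in `J`
  set u : I → ℤ := fun j => if j ∈ J then ∑ i ∈ P, A j i else 0 with hu
  have hc : 0 < c := by
    obtain ⟨i, hi⟩ := hP.nonempty
    rw [← hP.weight i hi]
    exact h.weight_pos i
  have hbond (j : I) : d j * (∑ i ∈ P, A j i) ^ 2 = c * bond A P j := by
    have : d j * ∑ i ∈ P, A j i = c * ∑ i ∈ P, A i j := by
      rw [Finset.mul_sum, Finset.mul_sum]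
      refine Finset.sum_congr rfl fun i hi => ?_
      rw [h.symm, hP.weight i hi]
    rw [sq, ← mul_assoc, this, bond]
    ring
  have h1 : form A d (ind P) u = c * ∑ j ∈ J, bond A P j := by
    rw [h.form_ind_left, Finset.mul_sum]
    simp only [hu, ite_mul, zero_mul, Finset.sum_ite_mem, Finset.univ_inter]
    refine Finset.sum_congr rfl fun j _ => ?_
    rw [← hbond]
    ring
  have h2 : form A d u u = 2 * (c * ∑ j ∈ J, bond A P j) := by
    rw [form, Finset.mul_sum, Finset.mul_sum,
      ← Finset.sum_subset (Finset.subset_univ J) (fun i _ hi => by simp [hu, hi])]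
    refine Finset.sum_congr rfl fun j hj => ?_
    rw [Finset.sum_eq_single j]
    · simp only [hu, hj, if_true, h.diag, ← hbond]
      ring
    · intro i _ hij
      by_cases hi : i ∈ J
      · rw [hJ j hj i hi hij.symm]
        ring
      · simp [hu, hi]
    · simp
  have hx := h.form_pos ((2 : ℤ) • ind P + (-1 : ℤ) • u) (by
    intro h0
    obtain ⟨i, hi⟩ := hP.nonempty
    have := congr_fun h0 i
    simp [ind, hi, hu, Finset.disjoint_left.1 hPJ hi] at this)
  change 0 < form A d _ _ at hx
  rw [form_add_left, form_add_right, form_add_right] at hx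
  simp only [form_smul_left, form_smul_right] at hx
  rw [h.form_comm u (ind P), h1, h2, h.form_ind_ind hP] at hx
  nlinarith

theorem isRootSet_singleton (i : I) : IsRootSet A d (d i) {i} :=
  ⟨⟨i, by simp⟩, by simp, by simp [h.diag]⟩

theorem isRootSet_insert {c : ℤ} {P : Finset I} (hP : IsRootSet A d c P) {j : I} (hj : j ∉ P)
    (hd : d j = c) (hs : ∑ i ∈ P, A i j = -1) : IsRootSet A d c (insert j P) := by
  refine ⟨⟨j, by simp⟩, fun i hi => ?_, ?_⟩
  · rcases Finset.mem_insert.1 hi with rfl | hi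
    exacts [hd, hP.weight i hi]
  · have hs' : ∑ i ∈ P, A j i = -1 := by
      rw [← hs]
      exact Finset.sum_congr rfl fun i hi =>
        h.apply_comm_of_weight_eq (hd.trans (hP.weight i hi).symm)
    rw [Finset.sum_insert hj, Finset.sum_insert hj]
    simp_rw [Finset.sum_insert hj]
    rw [Finset.sum_add_distrib, hs, hs', hP.norm, h.diag]
    norm_num

/-- The form is positive on the positive combinations `∑ wₖ vₖ` of nodes `vₖ` of equal weight. With
the null vector of an affine diagram as `w` this excludes that diagram as a subdiagram. -/
theorem form_pos_of_subdiagram {m : ℕ} (v : Fin (m + 1) → I) (w : Fin (m + 1) → ℤ) (hw : ∀ k, 0 < w k)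
    (M : Fin (m + 1) → Fin (m + 1) → ℤ) (hM : ∀ k l, A (v k) (v l) = M k l) {c : ℤ}
    (hd : ∀ k, d (v k) = c) : 0 < ∑ k, ∑ l, w k * M k l * w l := by
  set x : I → ℤ := fun i => ∑ k, if v k = i then w k else 0 with hx
  have hform : form A d x x = c * ∑ k, ∑ l, w k * M k l * w l := by
    have e1 (f : I → ℤ) : ∑ i, x i * f i = ∑ k, w k * f (v k) := by
      simp only [hx, Finset.sum_mul]
      rw [Finset.sum_comm]
      refine Finset.sum_congr rfl fun k _ => ?_
      simp
    have e2 : form A d x x = ∑ i, x i * ∑ j, x j * (d i * A i j) := by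
      rw [form]
      refine Finset.sum_congr rfl fun i _ => ?_
      rw [Finset.mul_sum]
      refine Finset.sum_congr rfl fun j _ => by ring
    rw [e2, e1, Finset.mul_sum]
    refine Finset.sum_congr rfl fun k _ => ?_
    rw [e1, Finset.mul_sum, Finset.mul_sum]
    refine Finset.sum_congr rfl fun l _ => ?_
    rw [hM, hd]
    ring
  have hc : 0 < c := by rw [← hd 0]; exact h.weight_pos _
  have hpos : 0 < form A d x x := h.form_pos x (by
    intro h0
    have h1 : x (v 0) = 0 := congr_fun h0 _
    have h2 : w 0 ≤ x (v 0) := by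
      have := Finset.single_le_sum (f := fun k => if v k = v 0 then w k else 0)
        (fun k _ => by
          split_ifs
          exacts [(hw k).le, le_rfl]) (Finset.mem_univ 0)
      simpa using this
    have := hw 0
    omega)
  rw [hform] at hpos
  exact pos_of_mul_pos_right hpos hc.le

end IsFiniteCartan

end Diagram

end WeylCover

/-! ### Diagram involutions and paths -/

namespace WeylCover

section Diagram

variable {I : Type*} [Fintype I] [DecidableEq I] {A : I → I → ℤ} {d : I → ℤ}

namespace IsFiniteCartan

variable (h : IsFiniteCartan A d)

include h

/-- At most three orthogonal nodes are joined to a root. -/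
theorem not_four_orthogonal {c : ℤ} {P : Finset I} (hP : IsRootSet A d c P) {u : Fin 4 → I}
    (huP : ∀ k, u k ∉ P) (hA : ∀ k, ∃ i ∈ P, A i (u k) ≠ 0)
    (ho : ∀ k l, k < l → A (u k) (u l) = 0) : False := by
  have ho' : ∀ k l, k ≠ l → A (u k) (u l) = 0 := fun k l hkl => by
    rcases hkl.lt_or_gt with hkl | hkl
    · exact ho k l hkl
    · exact h.eq_zero_comm (ho l k hkl)
  have hu : Function.Injective u := by
    intro k l hkl
    by_contra hne
    have := ho' k l hne
    rw [hkl, h.diag] at this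
    norm_num at this
  have h1 := h.sum_bond_lt_four hP (J := Finset.univ.image u)
    (by
      rw [Finset.disjoint_left]
      intro i hi hi'
      obtain ⟨k, -, rfl⟩ := Finset.mem_image.1 hi'
      exact huP k hi)
    (by
      intro i hi j hj hij
      obtain ⟨k, -, rfl⟩ := Finset.mem_image.1 hi
      obtain ⟨l, -, rfl⟩ := Finset.mem_image.1 hj
      exact ho' k l fun hkl => hij (congrArg u hkl))
  rw [Finset.sum_image hu.injOn] at h1
  have h2 : ∑ k : Fin 4, (1 : ℤ) ≤ ∑ k, bond A P (u k) := by
    refine Finset.sum_le_sum fun k _ => ?_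
    obtain ⟨i, hi, hA'⟩ := hA k
    exact h.one_le_bond hi (huP k) hA'
  simp only [Finset.sum_const, Finset.card_univ, Fintype.card_fin, nsmul_eq_mul] at h2
  push_cast at h2
  linarith

theorem ne_of_apply_eq_zero {i j : I} (hij : A i j = 0) : i ≠ j := by
  rintro rfl
  rw [h.diag] at hij
  norm_num at hij

/-- A root with two orthogonal neighbours is joined by at most a single bond to any further
orthogonal node. -/
theorem bond_le_one_of_two {c : ℤ} {P : Finset I} (hP : IsRootSet A d c P) {u v j : I}
    (hu : u ∉ P) (hv : v ∉ P) (hj : j ∉ P)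
    (hAu : ∃ i ∈ P, A i u ≠ 0) (hAv : ∃ i ∈ P, A i v ≠ 0)
    (h1 : A u v = 0) (h2 : A u j = 0) (h3 : A v j = 0) : bond A P j ≤ 1 := by
  have h4 := h.sum_bond_lt_four hP (J := {u, v, j})
    (by simp [hu, hv, hj])
    (by
      have h1' := h.eq_zero_comm h1
      have h2' := h.eq_zero_comm h2
      have h3' := h.eq_zero_comm h3
      simp only [Finset.mem_insert, Finset.mem_singleton]
      rintro i (rfl | rfl | rfl) j' (rfl | rfl | rfl) hij <;> first | exact absurd rfl hij | assumption)
  rw [Finset.sum_insert (by simp [h.ne_of_apply_eq_zero h1, h.ne_of_apply_eq_zero h2]),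
    Finset.sum_pair (h.ne_of_apply_eq_zero h3)] at h4
  obtain ⟨i, hi, hA⟩ := hAu
  have h5 := h.one_le_bond hi hu hA
  obtain ⟨i, hi, hA⟩ := hAv
  have h6 := h.one_le_bond hi hv hA
  linarith

theorem bond_le_three {c : ℤ} {P : Finset I} (hP : IsRootSet A d c P) {j : I} (hj : j ∉ P) :
    bond A P j ≤ 3 := by
  have h4 := h.sum_bond_lt_four hP (J := {j}) (by simp [hj])
    (by
      simp only [Finset.mem_singleton]
      rintro i rfl j rfl hij
      exact absurd rfl hij)
  rw [Finset.sum_singleton] at h4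
  omega

end IsFiniteCartan

/-- A diagram automorphism of order at most two. -/
structure IsDiagramInvolution (A : I → I → ℤ) (d : I → ℤ) (τ : I → I) : Prop where
  invol : ∀ i, τ (τ i) = i
  map : ∀ i j, A (τ i) (τ j) = A i j
  weight : ∀ i, d (τ i) = d i

namespace IsDiagramInvolution

variable {τ : I → I} (ht : IsDiagramInvolution A d τ)

include ht

theorem inj {i j : I} (hij : τ i = τ j) : i = j := by
  rw [← ht.invol i, hij, ht.invol]

theorem map_left (i j : I) : A (τ i) j = A i (τ j) := by
  rw [← ht.map, ht.invol]

variable {P : Finset I} (hP : ∀ i ∈ P, τ i ∈ P)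

include hP

theorem sum_comp (f : I → ℤ) : ∑ i ∈ P, f (τ i) = ∑ i ∈ P, f i :=
  Finset.sum_bij' (fun i _ => τ i) (fun i _ => τ i) hP hP (fun i _ => ht.invol i)
    (fun i _ => ht.invol i) (fun _ _ => rfl)

theorem notMem {j : I} (hj : j ∉ P) : τ j ∉ P := fun hh => hj (ht.invol j ▸ hP _ hh)

theorem bond_eq (j : I) : bond A P (τ j) = bond A P j := by
  rw [bond, bond, ← ht.sum_comp hP fun i => A i (τ j), ← ht.sum_comp hP fun i => A (τ j) i]
  simp_rw [ht.map]

variable (h : IsFiniteCartan A d)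

include h

/-- A node moved by the involution and joined to an invariant root is orthogonal to its image:
otherwise the two together form a root joined to the given one by at least four bonds. -/
theorem apply_eq_zero {c : ℤ} (hR : IsRootSet A d c P) {i j : I} (hi : i ∈ P) (hj : j ∉ P)
    (hj' : τ j ≠ j) (hA : A i j ≠ 0) : A j (τ j) = 0 := by
  by_contra hne
  have h1 := h.apply_le_neg_one hj'.symm hne
  set x : I → ℤ := fun k => if k = j ∨ k = τ j then 1 else 0 with hx
  set S := ∑ k ∈ P, A j k with hS
  have hS' : ∑ k ∈ P, A (τ j) k = S := by
    rw [← ht.sum_comp hP fun k => A (τ j) k]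
    simp_rw [ht.map]
    rfl
  have hsum (f : I → ℤ) : ∑ k, x k * f k = f j + f (τ j) := by
    have : ∀ k, x k * f k = (if k = j then f k else 0) + (if k = τ j then f k else 0) := by
      intro k
      simp only [hx]
      by_cases h2 : k = j <;> by_cases h3 : k = τ j <;> simp_all
    simp only [this, Finset.sum_add_distrib, Finset.sum_ite_eq', Finset.mem_univ, if_true]
  have e1 : form A d (ind P) x = 2 * (d j * S) := by
    rw [h.form_ind_left, hsum, hS', ht.weight]
    ring
  have e2 : form A d x x = 2 * (d j * (2 + A j (τ j))) := by
    have : form A d x x = ∑ k, x k * ∑ l, x l * (d k * A k l) := by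
      rw [form]
      refine Finset.sum_congr rfl fun k _ => ?_
      rw [Finset.mul_sum]
      exact Finset.sum_congr rfl fun l _ => by ring
    rw [this, hsum, hsum, hsum, h.diag, h.diag, ht.weight, ht.map_left]
    ring
  -- the norm of `P - S (j + τ j)` is at most `2 c - 2 c`
  have hpos := h.form_pos (ind P + (-S) • x) (by
    intro h0
    have := congr_fun h0 i
    have hij : i ≠ j := by rintro rfl; exact hj hi
    have hij' : i ≠ τ j := by rintro rfl; exact ht.notMem hP hj hi
    simp [ind, hi, hx, hij, hij'] at this)
  change 0 < form A d _ _ at hpos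
  rw [form_add_left, form_add_right, form_add_right] at hpos
  simp only [form_smul_left, form_smul_right] at hpos
  rw [h.form_comm x, e1, e2, h.form_ind_ind hR] at hpos
  have hb := h.one_le_bond hi hj hA
  have hcb : d j * S * S = c * bond A P j := by
    have : d j * S = c * ∑ i ∈ P, A i j := by
      rw [hS, Finset.mul_sum, Finset.mul_sum]
      refine Finset.sum_congr rfl fun i hi => ?_
      rw [h.symm, hR.weight i hi]
    rw [this, bond]
    ring
  have hc : 0 < c := by
    rw [← hR.weight i hi]
    exact h.weight_pos i
  have hdj := h.weight_pos j
  have h3 : c ≤ d j * S * S := by rw [hcb]; nlinarith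
  have h4 : d j * S * S * (1 + A j (τ j)) ≤ 0 :=
    mul_nonpos_of_nonneg_of_nonpos (hc.le.trans h3) (by linarith)
  nlinarith

/-- A node moved by the involution and joined to an invariant root is joined by a single bond. -/
theorem bond_le_one {c : ℤ} (hR : IsRootSet A d c P) {i j : I} (hi : i ∈ P) (hj : j ∉ P)
    (hj' : τ j ≠ j) (hA : A i j ≠ 0) : bond A P j ≤ 1 := by
  have h0 := ht.apply_eq_zero hP h hR hi hj hj' hA
  have h4 := h.sum_bond_lt_four hR (J := {j, τ j}) (by simp [hj, ht.notMem hP hj])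
    (by
      have h0' := h.eq_zero_comm h0
      simp only [Finset.mem_insert, Finset.mem_singleton]
      rintro a (rfl | rfl) b (rfl | rfl) hij <;> first | exact absurd rfl hij | assumption)
  rw [Finset.sum_pair hj'.symm, ht.bond_eq hP] at h4
  omega

end IsDiagramInvolution

/-- The entries of the Cartan matrix of a path. -/
def pathEntry (k l : ℕ) : ℤ := if k = l then 2 else if k + 1 = l ∨ l + 1 = k then -1 else 0

theorem pathEntry_comm (k l : ℕ) : pathEntry k l = pathEntry l k := by
  unfold pathEntry
  split_ifs <;> omega

theorem pathEntry_eq_zero {k l : ℕ} (h : k + 1 < l) : pathEntry k l = 0 := by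
  unfold pathEntry
  split_ifs <;> omega

/-- The entry depends only on the distance of its indices. -/
theorem pathEntry_congr {k l k' l' : ℕ} (h : k + l' = k' + l ∨ k + k' = l + l') :
    pathEntry k l = pathEntry k' l' := by
  unfold pathEntry
  grind

theorem pathEntry_succ (k : ℕ) : pathEntry k (k + 1) = -1 := by simp [pathEntry]

/-- The nodes `p 0, …, p (N - 1)` form a subdiagram of type `A_N`, in this order. -/
def IsPath (A : I → I → ℤ) (N : ℕ) (p : ℕ → I) : Prop :=
  ∀ k < N, ∀ l < N, A (p k) (p l) = pathEntry k l

/-- The nodes `p a, …, p (b - 1)`. -/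
def seg (p : ℕ → I) (a b : ℕ) : Finset I := (Finset.Ico a b).image p

theorem mem_seg {p : ℕ → I} {a b : ℕ} {i : I} : i ∈ seg p a b ↔ ∃ k, a ≤ k ∧ k < b ∧ p k = i := by
  simp [seg, and_assoc]

namespace IsPath

variable {N : ℕ} {p : ℕ → I} (hp : IsPath A N p)

include hp

theorem inj {k l : ℕ} (hk : k < N) (hl : l < N) (hkl : p k = p l) : k = l := by
  have h1 := hp k hk k hk
  have h2 := hp k hk l hl
  rw [← hkl, h1] at h2
  unfold pathEntry at h2
  split_ifs at h2 <;> omega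

theorem notMem_seg {a b m : ℕ} (hb : b ≤ N) (hm : m < N) (h : m < a ∨ b ≤ m) :
    p m ∉ seg p a b := by
  rw [mem_seg]
  rintro ⟨k, hk, hk', hkm⟩
  have := hp.inj (by omega) hm hkm
  omega

theorem weight_eq (h : IsFiniteCartan A d) {k : ℕ} (hk : k < N) : d (p k) = d (p 0) := by
  induction k with
  | zero => rfl
  | succ k ih =>
    rw [← ih (by omega)]
    refine h.weight_eq ?_ ?_
    · rw [hp _ hk _ (by omega), pathEntry_comm, pathEntry_succ]
    · rw [hp _ (by omega) _ hk, pathEntry_succ]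

/-- The sum of the simple roots along a path is a root. -/
theorem isRootSet_seg (h : IsFiniteCartan A d) {a b : ℕ} (hab : a < b) (hb : b ≤ N) :
    IsRootSet A d (d (p 0)) (seg p a b) := by
  induction b, hab using Nat.le_induction with
  | base =>
    rw [← hp.weight_eq h hb]
    simpa [seg] using h.isRootSet_singleton (p a)
  | succ b hab ih =>
    have h1 : seg p a (b + 1) = insert (p b) (seg p a b) := by
      rw [seg, ← Finset.insert_Ico_right_eq_Ico_add_one (by omega), Finset.image_insert, seg]
    rw [h1]
    refine h.isRootSet_insert (ih (by omega)) (hp.notMem_seg (by omega) (by omega) (by omega))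
      (hp.weight_eq h (by omega)) ?_
    rw [seg, Finset.sum_image (fun k hk l hl hkl => hp.inj (by simp at hk; omega)
      (by simp at hl; omega) hkl)]
    rw [Finset.sum_eq_single (b - 1)]
    · rw [hp _ (by omega) _ (by omega), pathEntry]
      split_ifs <;> omega
    · intro k hk hkb
      rw [Finset.mem_Ico] at hk
      rw [hp _ (by omega) _ (by omega), pathEntry_eq_zero (by omega)]
    · intro hh
      rw [Finset.mem_Ico] at hh
      omega

end IsPath

end Diagram

end WeylCover

/-! ### Paths reversed by an involution -/

namespace WeylCover

section Diagram

variable {I : Type*} [Fintype I] [DecidableEq I] {A : I → I → ℤ} {d : I → ℤ}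

/-- A path reversed by the involution. -/
structure IsSymmPath (A : I → I → ℤ) (τ : I → I) (N : ℕ) (p : ℕ → I) : Prop where
  isPath : IsPath A N p
  map : ∀ k < N, τ (p k) = p (N - 1 - k)

namespace IsSymmPath

variable {τ : I → I} {N : ℕ} {p : ℕ → I} (hp : IsSymmPath A τ N p)
  (h : IsFiniteCartan A d) (ht : IsDiagramInvolution A d τ)

include hp

theorem map_mem {i : I} (hi : i ∈ seg p 0 N) : τ i ∈ seg p 0 N := by
  obtain ⟨k, -, hk, rfl⟩ := mem_seg.1 hi
  exact mem_seg.2 ⟨N - 1 - k, by omega, by omega, (hp.map k hk).symm⟩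

include h ht

/-- A symmetric path is prolonged at both ends by a moved node attached to its first node. -/
theorem extend {j : I} (hN : 2 ≤ N) (hj : j ∉ seg p 0 N) (hj' : τ j ≠ j)
    (hA : A (p 0) j ≠ 0) : ∃ p', IsSymmPath A τ (N + 2) p' := by
  have hR := hp.isPath.isRootSet_seg h (a := 0) (b := N) (by omega) le_rfl
  have hmem (k : ℕ) (hk : k < N) : p k ∈ seg p 0 N := mem_seg.2 ⟨k, by omega, hk, rfl⟩
  have horth := ht.apply_eq_zero (fun _ => hp.map_mem) h hR (hmem 0 (by omega)) hj hj' hA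
  obtain ⟨h1, h2, h3⟩ := h.eq_neg_one_of_bond_le_one (hmem 0 (by omega)) hj hA
    (ht.bond_le_one (fun _ => hp.map_mem) h hR (hmem 0 (by omega)) hj hj' hA)
  have hpj (k : ℕ) (hk : k < N) : A (p k) j = pathEntry (k + 1) 0 := by
    rcases Nat.eq_zero_or_pos k with rfl | hk0
    · rw [h1]; rfl
    · rw [h3 _ (hmem k hk) fun hh => hk0.ne' (hp.isPath.inj hk (by omega) hh), pathEntry_comm,
        pathEntry_eq_zero (by omega)]
  have hjp (k : ℕ) (hk : k < N) : A j (p k) = pathEntry 0 (k + 1) := by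
    rw [pathEntry_comm]
    rcases Nat.eq_zero_or_pos k with rfl | hk0
    · rw [h2]; rfl
    · have := hpj k hk
      rw [pathEntry_comm, pathEntry_eq_zero (by omega)] at this
      rw [h.eq_zero_comm this, pathEntry_comm, pathEntry_eq_zero (by omega)]
  have hpt (k : ℕ) (hk : k < N) : A (p k) (τ j) = pathEntry (k + 1) (N + 1) := by
    rw [← ht.map_left, hp.map k hk, hpj _ (by omega)]
    exact pathEntry_congr (by omega)
  have htp (k : ℕ) (hk : k < N) : A (τ j) (p k) = pathEntry (N + 1) (k + 1) := by
    rw [ht.map_left, hp.map k hk, hjp _ (by omega)]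
    exact pathEntry_congr (by omega)
  refine ⟨fun k => if k = 0 then j else if k = N + 1 then τ j else p (k - 1), ?_, ?_⟩
  · intro k hk l hl
    rcases Nat.eq_zero_or_pos k with rfl | hk0 <;> rcases Nat.eq_zero_or_pos l with rfl | hl0
    · simp [h.diag, pathEntry]
    · by_cases hlN : l = N + 1
      · subst hlN
        rw [pathEntry_eq_zero (by omega)]
        simpa using horth
      · simp only [hlN, hl0.ne', if_true, if_false]
        rw [hjp _ (by omega), Nat.sub_add_cancel hl0]
    · by_cases hkN : k = N + 1
      · subst hkN
        rw [pathEntry_comm, pathEntry_eq_zero (by omega)]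
        simpa using h.eq_zero_comm horth
      · simp only [hkN, hk0.ne', if_true, if_false]
        rw [hpj _ (by omega), Nat.sub_add_cancel hk0]
    · by_cases hkN : k = N + 1 <;> by_cases hlN : l = N + 1
      · simp [hkN, hlN, h.diag, pathEntry]
      · simp only [hkN, hlN, hl0.ne', if_true, if_false, Nat.succ_ne_zero]
        rw [htp _ (by omega), Nat.sub_add_cancel hl0]
      · simp only [hkN, hlN, hk0.ne', if_true, if_false, Nat.succ_ne_zero]
        rw [hpt _ (by omega), Nat.sub_add_cancel hk0]
      · simp only [hkN, hlN, hk0.ne', hl0.ne', if_false]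
        rw [hp.isPath _ (by omega) _ (by omega)]
        unfold pathEntry
        split_ifs <;> omega
  · intro k hk
    rcases Nat.eq_zero_or_pos k with rfl | hk0
    · simp
    · by_cases hkN : k = N + 1
      · simp [hkN, ht.invol]
      · have e1 : N + 2 - 1 - k ≠ 0 := by omega
        have e2 : N + 2 - 1 - k ≠ N + 1 := by omega
        simp only [hkN, hk0.ne', e1, e2, if_false]
        rw [hp.map _ (by omega)]
        congr 1
        omega

/-- If a moved node is joined to an inner node `p i` of a symmetric path, then it, its image and the
outer neighbours of `p i` and `τ (p i)` are four orthogonal nodes joined to the part of the path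
from `p i` to `τ (p i)`. -/
theorem apply_eq_zero_aux {j : I} (hN : 2 ≤ N) (hmax : ¬ ∃ p', IsSymmPath A τ (N + 2) p')
    (hj : j ∉ seg p 0 N) (hj' : τ j ≠ j) {i : ℕ} (hi : i ≤ N - 1 - i) : A (p i) j = 0 := by
  by_contra hA
  rcases Nat.eq_zero_or_pos i with rfl | hi0
  · exact hmax (hp.extend h ht hN hj hj' hA)
  have hR := hp.isPath.isRootSet_seg h (a := 0) (b := N) (by omega) le_rfl
  have hmem (k : ℕ) (hk : k < N) : p k ∈ seg p 0 N := mem_seg.2 ⟨k, by omega, hk, rfl⟩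
  have horth := ht.apply_eq_zero (fun _ => hp.map_mem) h hR (hmem i (by omega)) hj hj' hA
  obtain ⟨-, -, h3⟩ := h.eq_neg_one_of_bond_le_one (hmem i (by omega)) hj hA
    (ht.bond_le_one (fun _ => hp.map_mem) h hR (hmem i (by omega)) hj hj' hA)
  have hz (k : ℕ) (hk : k < N) (hki : k ≠ i) : A (p k) j = 0 :=
    h3 _ (hmem k hk) fun hh => hki (hp.isPath.inj hk (by omega) hh)
  have hzt (k : ℕ) (hk : k < N) (hki : N - 1 - k ≠ i) : A (p k) (τ j) = 0 := by
    rw [← ht.map_left, hp.map k hk, hz _ (by omega) hki]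
  have hseg : seg p i (N - i) ⊆ seg p 0 N := by
    intro k
    rw [mem_seg, mem_seg]
    rintro ⟨m, h1, h2, rfl⟩
    exact ⟨m, by omega, by omega, rfl⟩
  have hin : p i ∈ seg p i (N - i) := mem_seg.2 ⟨i, le_rfl, by omega, rfl⟩
  have hin' : p (N - 1 - i) ∈ seg p i (N - i) := mem_seg.2 ⟨N - 1 - i, hi, by omega, rfl⟩
  refine h.not_four_orthogonal (hp.isPath.isRootSet_seg h (a := i) (b := N - i) (by omega)
    (by omega)) (u := ![p (i - 1), p (N - i), j, τ j]) ?_ ?_ ?_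
  · simp only [Fin.forall_fin_succ, Matrix.cons_val_zero, Matrix.cons_val_succ, IsEmpty.forall_iff,
      and_true]
    exact ⟨hp.isPath.notMem_seg (by omega) (by omega) (by omega),
      hp.isPath.notMem_seg (by omega) (by omega) (by omega), fun hh => hj (hseg hh),
      fun hh => ht.notMem (fun _ => hp.map_mem) hj (hseg hh)⟩
  · simp only [Fin.forall_fin_succ, Matrix.cons_val_zero, Matrix.cons_val_succ, IsEmpty.forall_iff,
      and_true]
    refine ⟨⟨p i, hin, ?_⟩, ⟨p (N - 1 - i), hin', ?_⟩, ⟨p i, hin, hA⟩,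
      ⟨p (N - 1 - i), hin', ?_⟩⟩
    · rw [hp.isPath _ (by omega) _ (by omega), pathEntry]
      split_ifs <;> omega
    · rw [hp.isPath _ (by omega) _ (by omega), pathEntry]
      split_ifs <;> omega
    · rwa [← hp.map i (by omega), ht.map]
  · have e1 : A (p (i - 1)) (p (N - i)) = 0 := by
      rw [hp.isPath _ (by omega) _ (by omega), pathEntry_eq_zero (by omega)]
    have e2 := hz (i - 1) (by omega) (by omega)
    have e3 := hz (N - i) (by omega) (by omega)
    have e4 := hzt (i - 1) (by omega) (by omega)
    have e5 := hzt (N - i) (by omega) (by omega)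
    intro k l hkl
    fin_cases k <;> fin_cases l <;> first | assumption | exact absurd hkl (by decide)

/-- Nodes moved by the involution are not joined to a symmetric path of maximal length. -/
theorem apply_eq_zero {j : I} (hN : 2 ≤ N) (hmax : ¬ ∃ p', IsSymmPath A τ (N + 2) p')
    (hj : j ∉ seg p 0 N) (hj' : τ j ≠ j) {i : ℕ} (hi : i < N) : A (p i) j = 0 := by
  rcases le_total i (N - 1 - i) with hi' | hi'
  · exact hp.apply_eq_zero_aux h ht hN hmax hj hj' hi'
  · have := hp.apply_eq_zero_aux h ht hN hmax (j := τ j) (i := N - 1 - i)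
      (ht.notMem (fun _ => hp.map_mem) hj) (by rw [ht.invol]; exact hj'.symm) (by omega)
    rwa [← hp.map i hi, ht.map] at this

/-- A fixed node joined to a symmetric path is joined to its midpoint by a single bond. -/
theorem apply_eq_of_fixed {j : I} (hN : 2 ≤ N) (hj : j ∉ seg p 0 N) (hj' : τ j = j) {i : ℕ}
    (hi : i < N) (hA : A (p i) j ≠ 0) :
    2 * i + 1 = N ∧ A (p i) j = -1 ∧ A j (p i) = -1 := by
  have hmem (k : ℕ) (hk : k < N) : p k ∈ seg p 0 N := mem_seg.2 ⟨k, by omega, hk, rfl⟩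
  have hne (k : ℕ) (hk : k < N) : p k ≠ j := by rintro rfl; exact hj (hmem k hk)
  have hNi : 2 * i + 1 = N := by
    by_contra hcon
    -- otherwise the node is also joined to the mirror image of `p i`, which makes four bonds
    have hR := hp.isPath.isRootSet_seg h (a := 0) (b := N) (by omega) le_rfl
    have hb := h.bond_le_three hR hj
    have hine : p (N - 1 - i) ≠ p i := fun hh => by
      have := hp.isPath.inj (by omega) (by omega) hh
      omega
    have hmem' : p (N - 1 - i) ∈ (seg p 0 N).erase (p i) :=
      Finset.mem_erase.2 ⟨hine, hmem _ (by omega)⟩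
    have hj'' : j ∉ (seg p 0 N).erase (p i) := fun hh => hj (Finset.mem_of_mem_erase hh)
    have hA' : A (p (N - 1 - i)) j = A (p i) j := by
      rw [← hp.map i hi, ht.map_left, hj']
    have hA'' : A j (p (N - 1 - i)) = A j (p i) := by
      rw [← hp.map i hi, ← ht.map_left, hj']
    have h1 := h.sum_le_apply hmem' hj''
    have h2 := h.sum_le_apply' hmem' hj''
    have h3 := h.apply_le_neg_one (hne i hi) hA
    have h4 := h.apply_le_neg_one (hne i hi).symm (h.apply_comm_ne_zero hA)
    rw [bond, ← Finset.add_sum_erase _ _ (hmem i hi),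
      ← Finset.add_sum_erase _ (fun k => A j k) (hmem i hi)] at hb
    nlinarith
  have hb : bond A {p i} j ≤ 1 := by
    have hz (k : ℕ) (hk : k < N) (hki : k ≠ i) : p k ∉ ({p i} : Finset I) := by
      rw [Finset.mem_singleton]
      exact fun hh => hki (hp.isPath.inj hk hi hh)
    have hcross (k : ℕ) (hk : k < N) (hki : k ≠ i) : A (p k) j = 0 := by
      by_contra hne0
      have hR := hp.isPath.isRootSet_seg h (a := 0) (b := N) (by omega) le_rfl
      have hb := h.bond_le_three hR hj
      have hmem' : p k ∈ (seg p 0 N).erase (p i) :=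
        Finset.mem_erase.2 ⟨fun hh => hki (hp.isPath.inj hk hi hh), hmem _ hk⟩
      have hj'' : j ∉ (seg p 0 N).erase (p i) := fun hh => hj (Finset.mem_of_mem_erase hh)
      have h1 := h.sum_le_apply hmem' hj''
      have h2 := h.sum_le_apply' hmem' hj''
      have h3 := h.apply_le_neg_one (hne i hi) hA
      have h4 := h.apply_le_neg_one (hne i hi).symm (h.apply_comm_ne_zero hA)
      have h5 := h.apply_le_neg_one (hne k hk) hne0
      have h6 := h.apply_le_neg_one (hne k hk).symm (h.apply_comm_ne_zero hne0)
      rw [bond, ← Finset.add_sum_erase _ _ (hmem i hi),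
        ← Finset.add_sum_erase _ (fun k => A j k) (hmem i hi)] at hb
      nlinarith
    -- the two neighbours of the midpoint on the path leave room for a single bond only
    refine h.bond_le_one_of_two (h.isRootSet_singleton (p i)) (u := p (i - 1)) (v := p (i + 1))
      (hz _ (by omega) (by omega)) (hz _ (by omega) (by omega))
      (by rw [Finset.mem_singleton]; exact (hne i hi).symm) ⟨p i, by simp, ?_⟩
      ⟨p i, by simp, ?_⟩ ?_ (hcross _ (by omega) (by omega)) (hcross _ (by omega) (by omega))
    · rw [hp.isPath _ (by omega) _ (by omega), pathEntry]
      split_ifs <;> omega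
    · rw [hp.isPath _ (by omega) _ (by omega), pathEntry_succ]
      decide
    · rw [hp.isPath _ (by omega) _ (by omega), pathEntry_eq_zero (by omega)]
  obtain ⟨h1, h2, -⟩ := h.eq_neg_one_of_bond_le_one (P := {p i}) (by simp)
    (by rw [Finset.mem_singleton]; exact (hne i hi).symm) hA hb
  exact ⟨hNi, h1, h2⟩

end IsSymmPath

end Diagram

end WeylCover

/-! ### Existence of a reversed path -/

namespace WeylCover

theorem exists_max_of_bounded {P : ℕ → Prop} (b : ℕ) (hb : ∀ n, P n → n ≤ b) (he : ∃ n, P n) :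
    ∃ n, P n ∧ ∀ m, P m → m ≤ n :=
  ⟨sSup {n | P n}, Nat.sSup_mem he ⟨b, hb⟩, fun _ hm => le_csSup ⟨b, hb⟩ hm⟩

section Diagram

variable {I : Type*} [Fintype I] [DecidableEq I] {A : I → I → ℤ} {d : I → ℤ}

theorem IsPath.length_le {N : ℕ} {p : ℕ → I} (hp : IsPath A N p) : N ≤ Fintype.card I := by
  have := Fintype.card_le_of_injective (fun k : Fin N => p k) fun k l hkl =>
    Fin.ext (hp.inj k.2 l.2 hkl)
  simpa using this

/-- The diagram is connected: a nonempty set of nodes closed under adjacency is everything. -/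
def IsConnected (A : I → I → ℤ) : Prop :=
  ∀ p : I → Prop, (∃ i, p i) → (∀ i j, p i → A j i ≠ 0 → p j) → ∀ j, p j

/-- A walk of length `L` in the diagram. -/
def IsWalk (A : I → I → ℤ) (L : ℕ) (q : ℕ → I) : Prop :=
  ∀ k < L, q k ≠ q (k + 1) ∧ A (q k) (q (k + 1)) ≠ 0

theorem IsConnected.exists_walk (h : IsFiniteCartan A d) (hc : IsConnected A) (i j : I) :
    ∃ L q, IsWalk A L q ∧ q 0 = i ∧ q L = j := by
  refine hc (fun j => ∃ L q, IsWalk A L q ∧ q 0 = i ∧ q L = j)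
    ⟨i, 0, fun _ => i, fun k hk => absurd hk (by omega), rfl, rfl⟩ ?_ j
  rintro j j' ⟨L, q, hq, h0, hL⟩ hA
  by_cases hjj : j' = j
  · exact ⟨L, q, hq, h0, hL.trans hjj.symm⟩
  refine ⟨L + 1, fun k => if k ≤ L then q k else j', fun k hk => ?_, by simpa using h0, by simp⟩
  rcases Nat.lt_succ_iff_lt_or_eq.1 hk with hk' | rfl
  · have e1 : k ≤ L := by omega
    have e2 : k + 1 ≤ L := by omega
    simpa only [e1, e2, if_true] using hq k hk'
  · simp only [le_refl, if_true, Nat.not_succ_le_self, if_false, hL]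
    exact ⟨fun hh => hjj hh.symm, h.apply_comm_ne_zero hA⟩

variable {τ : I → I} (h : IsFiniteCartan A d) (ht : IsDiagramInvolution A d τ)

include h

/-- There is no nonempty set of nodes in which every node has two neighbours, since the sum of
these nodes would have nonpositive norm. -/
theorem IsFiniteCartan.not_two_neighbours {Q : Finset I} (hQ : Q.Nonempty)
    (hn : ∀ v ∈ Q, ∃ u ∈ Q, ∃ w ∈ Q, u ≠ w ∧ u ≠ v ∧ w ≠ v ∧ A v u ≠ 0 ∧ A v w ≠ 0) : False := by
  have h1 := h.form_pos (ind Q) (by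
    obtain ⟨i, hi⟩ := hQ
    intro h0
    simpa [ind, hi] using congr_fun h0 i)
  change 0 < form A d _ _ at h1
  rw [h.form_ind_left] at h1
  refine h1.not_ge (Finset.sum_nonpos fun v _ => ?_)
  by_cases hv : v ∈ Q
  · simp only [ind, hv, if_true, one_mul]
    refine mul_nonpos_of_nonneg_of_nonpos (h.weight_pos v).le ?_
    obtain ⟨u, hu, w, hw, huw, huv, hwv, hAu, hAw⟩ := hn v hv
    rw [← Finset.add_sum_erase _ _ hv, h.diag,
      ← Finset.add_sum_erase _ _ (Finset.mem_erase.2 ⟨huv, hu⟩)]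
    have h2 := h.sum_le_apply' (P := (Q.erase v).erase u) (i := w) (j := v)
      (by simp [hw, huw.symm, hwv]) (by simp)
    have h3 := h.apply_le_neg_one huv.symm hAu
    have h4 := h.apply_le_neg_one hwv.symm hAw
    linarith
  · simp [ind, hv]

include ht

/-- In a tree an involution without fixed nodes reverses an edge: a shortest walk from a node to
its image has length one, as together with its image it would otherwise form a cycle. -/
theorem exists_symmPath_of_forall_ne [Nonempty I] (hc : IsConnected A) (hτ : ∀ i, τ i ≠ i) :
    ∃ p, IsSymmPath A τ 2 p := by
  classical
  have hex : ∃ L, ∃ q, IsWalk A L q ∧ q L = τ (q 0) := by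
    obtain ⟨i⟩ := ‹Nonempty I›
    obtain ⟨L, q, hq, h0, hL⟩ := hc.exists_walk h i (τ i)
    exact ⟨L, q, hq, by rw [hL, h0]⟩
  obtain ⟨q, hq, hqL⟩ := Nat.find_spec hex
  have hmin := fun m => Nat.find_min hex (m := m)
  generalize Nat.find hex = L at hq hqL hmin
  have hL0 : L ≠ 0 := by
    rintro rfl
    exact hτ _ hqL.symm
  by_cases hL1 : L = 1
  · subst hL1
    obtain ⟨h1, h2⟩ := hq 0 (by omega)
    rw [zero_add, hqL] at h1 h2
    have hb := h.bond_le_three (h.isRootSet_singleton (q 0)) (j := τ (q 0)) (by simp [h1.symm])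
    rw [bond, Finset.sum_singleton, Finset.sum_singleton, ht.map_left] at hb
    have h3 := h.apply_le_neg_one h1 h2
    have h4 : A (q 0) (τ (q 0)) = -1 := by nlinarith
    refine ⟨fun k => if k = 0 then q 0 else τ (q 0), ?_, ?_⟩
    · intro k hk l hl
      interval_cases k <;> interval_cases l <;> simp [h.diag, pathEntry, h4, ht.map_left]
    · intro k hk
      interval_cases k <;> simp [ht.invol]
  · exfalso
    -- the closed walk formed by the shortest walk and its image; a node with a single neighbour on
    -- it would allow a shortcut
    set Q : Finset I := (Finset.range L).image q ∪ (Finset.range L).image (τ ∘ q) with hQ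
    have hqQ (k : ℕ) (hk : k < L) : q k ∈ Q :=
      Finset.mem_union_left _ (Finset.mem_image.2 ⟨k, by simpa using hk, rfl⟩)
    have hτqQ (k : ℕ) (hk : k < L) : τ (q k) ∈ Q :=
      Finset.mem_union_right _ (Finset.mem_image.2 ⟨k, by simpa using hk, rfl⟩)
    have hqQ' (k : ℕ) (hk : k ≤ L) : q k ∈ Q := by
      rcases hk.lt_or_eq with hk | rfl
      · exact hqQ k hk
      · rw [hqL]
        exact hτqQ 0 (by omega)
    have hstable (i : I) (hi : i ∈ Q) : τ i ∈ Q := by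
      rcases Finset.mem_union.1 hi with hi | hi
      · obtain ⟨k, hk, rfl⟩ := Finset.mem_image.1 hi
        exact hτqQ k (by simpa using hk)
      · obtain ⟨k, hk, rfl⟩ := Finset.mem_image.1 hi
        rw [Function.comp_apply, ht.invol]
        exact hqQ k (by simpa using hk)
    have hmain (k : ℕ) (hk : k < L) :
        ∃ u ∈ Q, ∃ w ∈ Q, u ≠ w ∧ u ≠ q k ∧ w ≠ q k ∧ A (q k) u ≠ 0 ∧ A (q k) w ≠ 0 := by
      obtain ⟨h1, h2⟩ := hq k hk
      rcases Nat.eq_zero_or_pos k with rfl | hk0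
      · obtain ⟨h3, h4⟩ := hq (L - 1) (by omega)
        rw [show L - 1 + 1 = L by omega, hqL] at h3 h4
        refine ⟨q 1, hqQ 1 (by omega), τ (q (L - 1)), hτqQ _ (by omega), fun hh => ?_, h1.symm,
          fun hh => h3 (by rw [← hh, ht.invol]), h2, ?_⟩
        · refine hmin (L - 2) (by omega) ⟨fun i => q (i + 1), fun i hi => hq (i + 1) (by omega), ?_⟩
          dsimp only
          rw [show L - 2 + 1 = L - 1 by omega, zero_add, hh, ht.invol]
        · rw [← ht.map_left]
          exact h.apply_comm_ne_zero h4
      · obtain ⟨h3, h4⟩ := hq (k - 1) (by omega)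
        rw [Nat.sub_add_cancel hk0] at h3 h4
        refine ⟨q (k - 1), hqQ _ (by omega), q (k + 1), hqQ' _ (by omega), fun hh => ?_, h3,
          h1.symm, h.apply_comm_ne_zero h4, h2⟩
        refine hmin (L - 2) (by omega) ⟨fun i => if i ≤ k - 1 then q i else q (i + 2), ?_, ?_⟩
        · intro i hi
          rcases lt_trichotomy i (k - 1) with hi' | rfl | hi'
          · have e1 : i ≤ k - 1 := by omega
            have e2 : i + 1 ≤ k - 1 := by omega
            simpa only [e1, e2, if_true] using hq i (by omega)
          · have e2 : ¬ k - 1 + 1 ≤ k - 1 := by omega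
            simp only [le_refl, e2, if_true, if_false, hh]
            rw [show k - 1 + 1 + 2 = k + 1 + 1 by omega]
            exact hq (k + 1) (by omega)
          · have e1 : ¬ i ≤ k - 1 := by omega
            have e2 : ¬ i + 1 ≤ k - 1 := by omega
            simpa only [e1, e2, if_false] using hq (i + 2) (by omega)
        · simp only [Nat.zero_le, if_true]
          split_ifs with hcase
          · rw [show L - 2 = k - 1 by omega, hh, show k + 1 = L by omega, hqL]
          · rw [show L - 2 + 2 = L by omega, hqL]
    refine h.not_two_neighbours ⟨q 0, hqQ 0 (by omega)⟩ fun v hv => ?_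
    rcases Finset.mem_union.1 hv with hv | hv
    · obtain ⟨k, hk, rfl⟩ := Finset.mem_image.1 hv
      exact hmain k (by simpa using hk)
    · obtain ⟨k, hk, rfl⟩ := Finset.mem_image.1 hv
      obtain ⟨u, hu, w, hw, h1, h2, h3, h4, h5⟩ := hmain k (by simpa using hk)
      exact ⟨τ u, hstable u hu, τ w, hstable w hw, fun hh => h1 (ht.inj hh),
        fun hh => h2 (ht.inj hh), fun hh => h3 (ht.inj hh), by rwa [Function.comp_apply, ht.map],
        by rwa [Function.comp_apply, ht.map]⟩

/-- A moved node next to a fixed one, together with its image, forms a symmetric path of three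
nodes; without fixed nodes there is a reversed edge. -/
theorem exists_symmPath (hc : IsConnected A) (hτ : ∃ i, τ i ≠ i) :
    ∃ N, 2 ≤ N ∧ ∃ p, IsSymmPath A τ N p := by
  by_cases hfix : ∃ i, τ i = i
  · obtain ⟨c, hcc, a, haa, hac⟩ : ∃ c, τ c = c ∧ ∃ a, τ a ≠ a ∧ A a c ≠ 0 := by
      by_contra! hcon
      obtain ⟨i, hi⟩ := hτ
      refine hi (hc (fun i => τ i = i) hfix (fun c a hcc hac => ?_) i)
      by_contra haa
      exact hac (hcon c hcc a haa)
    have hne : a ≠ c := by rintro rfl; exact haa hcc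
    have hP : ∀ i ∈ ({c} : Finset I), τ i ∈ ({c} : Finset I) := by simp [hcc]
    have hR := h.isRootSet_singleton c
    have hca := h.apply_comm_ne_zero hac
    have h0 := ht.apply_eq_zero hP h hR (i := c) (by simp) (by simpa using hne) haa hca
    obtain ⟨h1, h2, -⟩ := h.eq_neg_one_of_bond_le_one (P := {c}) (i := c) (by simp)
      (by simpa using hne) hca (ht.bond_le_one hP h hR (i := c) (by simp) (by simpa using hne) haa hca)
    have h3 : A c (τ a) = -1 := by rw [← ht.map_left, hcc, h1]
    have h4 : A (τ a) c = -1 := by rw [ht.map_left, hcc, h2]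
    have h5 : A (τ a) a = 0 := by rw [ht.map_left, h0]
    refine ⟨3, by omega, fun k => if k = 0 then a else if k = 1 then c else τ a, ?_, ?_⟩
    · intro k hk l hl
      interval_cases k <;> interval_cases l <;> simp [h.diag, pathEntry, h0, h1, h2, h3, h4, h5]
    · intro k hk
      interval_cases k <;> simp [ht.invol, hcc]
  · push Not at hfix
    obtain ⟨i, -⟩ := hτ
    have : Nonempty I := ⟨i⟩
    obtain ⟨p, hp⟩ := exists_symmPath_of_forall_ne h ht hc hfix
    exact ⟨2, le_rfl, p, hp⟩

end Diagram

end WeylCover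

/-! ### The tail at the midpoint of a reversed path -/

namespace WeylCover

section Diagram

variable {I : Type*} [Fintype I] [DecidableEq I] {A : I → I → ℤ} {d : I → ℤ}

/-- A path of `R` fixed nodes that starts at the midpoint of a symmetric path with `2 m + 1` nodes. -/
structure IsTail (A : I → I → ℤ) (τ : I → I) (p : ℕ → I) (m R : ℕ) (c : ℕ → I) : Prop where
  isPath : IsPath A R c
  zero : c 0 = p m
  fixed : ∀ k < R, τ (c k) = c k

/-- The entries of the Cartan matrix of a path `0, …, 2 m` with a further path `2 m + 1, 2 m + 2, …`
attached to its midpoint `m`. -/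
def branchEntry (m k l : ℕ) : ℤ :=
  if k ≤ 2 * m ↔ l ≤ 2 * m then pathEntry k l
  else if k = m then pathEntry 0 (l - 2 * m)
  else if l = m then pathEntry (k - 2 * m) 0
  else 0

namespace IsTail

variable {τ : I → I} {m R : ℕ} {p c : ℕ → I} (hc : IsTail A τ p m R c)
  (hp : IsSymmPath A τ (2 * m + 1) p)
  (h : IsFiniteCartan A d) (ht : IsDiagramInvolution A d τ)

include hc hp

theorem notMem_seg {k : ℕ} (hk : k < R) (hk0 : 0 < k) : c k ∉ seg p 0 (2 * m + 1) := by
  rw [mem_seg]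
  rintro ⟨l, -, hl, hlk⟩
  have h1 := hp.map l hl
  rw [hlk, hc.fixed k hk, ← hlk] at h1
  have h2 := hp.isPath.inj hl (by omega) h1
  obtain rfl : l = m := by omega
  rw [← hc.zero] at hlk
  have := hc.isPath.inj (by omega) hk hlk
  omega

include h ht

theorem apply_eq {k l : ℕ} (hm : 1 ≤ m) (hk : k < 2 * m + 1) (hl : l < R) (hl0 : 0 < l) :
    A (p k) (c l) = if k = m then pathEntry 0 l else 0 := by
  split_ifs with hkm
  · rw [hkm, ← hc.zero, hc.isPath _ (by omega) _ hl]
  · by_contra hA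
    have := hp.apply_eq_of_fixed h ht (by omega) (hc.notMem_seg hp hl hl0) (hc.fixed l hl) hk hA
    omega

theorem apply_eq' {k l : ℕ} (hm : 1 ≤ m) (hk : k < 2 * m + 1) (hl : l < R) (hl0 : 0 < l) :
    A (c l) (p k) = if k = m then pathEntry l 0 else 0 := by
  split_ifs with hkm
  · rw [hkm, ← hc.zero, hc.isPath _ hl _ (by omega)]
  · apply h.eq_zero_comm
    rw [hc.apply_eq hp h ht hm hk hl hl0, if_neg hkm]

/-- The Cartan matrix of a symmetric path with a tail, numbered with the path first. -/
theorem apply_eq_branchEntry (hm : 1 ≤ m) {k l : ℕ} (hk : k < 2 * m + R) (hl : l < 2 * m + R) :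
    A (if k ≤ 2 * m then p k else c (k - 2 * m)) (if l ≤ 2 * m then p l else c (l - 2 * m)) =
      branchEntry m k l := by
  by_cases hk' : k ≤ 2 * m <;> by_cases hl' : l ≤ 2 * m
  · rw [if_pos hk', if_pos hl', branchEntry, if_pos (by omega)]
    exact hp.isPath _ (by omega) _ (by omega)
  · rw [if_pos hk', if_neg hl', branchEntry, if_neg (by omega),
      hc.apply_eq hp h ht hm (by omega) (by omega) (by omega)]
    split_ifs <;> first | rfl | omega
  · rw [if_neg hk', if_pos hl', branchEntry, if_neg (by omega),
      hc.apply_eq' hp h ht hm (by omega) (by omega) (by omega)]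
    split_ifs <;> first | rfl | omega
  · rw [if_neg hk', if_neg hl', branchEntry, if_pos (by omega), hc.isPath _ (by omega) _ (by omega)]
    exact pathEntry_congr (by omega)

theorem weight_eq (hm : 1 ≤ m) {k : ℕ} (hk : k < 2 * m + R) :
    d (if k ≤ 2 * m then p k else c (k - 2 * m)) = d (p 0) := by
  split_ifs
  · exact hp.isPath.weight_eq h (by omega)
  · rw [hc.isPath.weight_eq h (by omega), hc.zero, hp.isPath.weight_eq h (by omega)]

/-- When neither the symmetric path nor its tail can be prolonged, together they are closed under
adjacency. -/
theorem apply_eq_zero (hm : 1 ≤ m) (hR : 2 ≤ R)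
    (hmax : ¬ ∃ p', IsSymmPath A τ (2 * m + 1 + 2) p')
    (hmax' : ¬ ∃ c', IsTail A τ p m (R + 1) c') {j : I} (hj : j ∉ seg p 0 (2 * m + 1))
    (hjc : j ∉ seg c 0 R) :
    (∀ k < 2 * m + 1, A (p k) j = 0) ∧ ∀ k < R, A (c k) j = 0 := by
  have hRc := hc.isPath.isRootSet_seg h (a := 0) (b := R) (by omega) le_rfl
  have hcmem (k : ℕ) (hk : k < R) : c k ∈ seg c 0 R := mem_seg.2 ⟨k, by omega, hk, rfl⟩
  have hpc (k : ℕ) (hk : k < 2 * m + 1) (hkm : k ≠ m) : p k ∉ seg c 0 R := by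
    rw [mem_seg]
    rintro ⟨l, -, hl, hlk⟩
    rcases Nat.eq_zero_or_pos l with rfl | hl0
    · rw [hc.zero] at hlk
      exact hkm (hp.isPath.inj (by omega) hk hlk).symm
    · exact hc.notMem_seg hp hl hl0 (mem_seg.2 ⟨k, by omega, hk, hlk.symm⟩)
  have hcfix (i : I) (hi : i ∈ seg c 0 R) : τ i ∈ seg c 0 R := by
    obtain ⟨k, -, hk, rfl⟩ := mem_seg.1 hi
    rwa [hc.fixed k hk]
  have hadj1 : A (c 0) (p (m - 1)) ≠ 0 := by
    rw [hc.zero, hp.isPath _ (by omega) _ (by omega), pathEntry]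
    split_ifs <;> omega
  have hadj2 : A (c 0) (p (m + 1)) ≠ 0 := by
    rw [hc.zero, hp.isPath _ (by omega) _ (by omega), pathEntry_succ]
    decide
  have horth : A (p (m - 1)) (p (m + 1)) = 0 := by
    rw [hp.isPath _ (by omega) _ (by omega), pathEntry_eq_zero (by omega)]
  have hsub (k : ℕ) (hk : k ≤ R) : seg c 0 k ⊆ seg c 0 R := by
    intro i
    rw [mem_seg, mem_seg]
    rintro ⟨l, h1, h2, rfl⟩
    exact ⟨l, h1, by omega, rfl⟩
  by_cases hfix : τ j = j
  · have hpj (k : ℕ) (hk : k < 2 * m + 1) (hkm : k ≠ m) : A (p k) j = 0 := by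
      by_contra hA
      have := hp.apply_eq_of_fixed h ht (by omega) hj hfix hk hA
      omega
    suffices hcj : ∀ k < R, A (c k) j = 0 by
      refine ⟨fun k hk => ?_, hcj⟩
      by_cases hkm : k = m
      · rw [hkm, ← hc.zero]
        exact hcj 0 (by omega)
      · exact hpj k hk hkm
    intro k hk
    by_contra hA
    have hb := h.bond_le_one_of_two hRc (u := p (m - 1)) (v := p (m + 1)) (j := j)
      (hpc _ (by omega) (by omega)) (hpc _ (by omega) (by omega)) hjc
      ⟨c 0, hcmem 0 (by omega), hadj1⟩ ⟨c 0, hcmem 0 (by omega), hadj2⟩ horth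
      (hpj _ (by omega) (by omega)) (hpj _ (by omega) (by omega))
    obtain ⟨h1, h2, h3⟩ := h.eq_neg_one_of_bond_le_one (hcmem k hk) hjc hA hb
    have hz (l : ℕ) (hl : l < R) (hlk : l ≠ k) : A (c l) j = 0 :=
      h3 _ (hcmem l hl) fun hh => hlk (hc.isPath.inj hl hk hh)
    by_cases hkR : k = R - 1
    · -- at the end of the tail the node prolongs it
      refine hmax' ⟨fun l => if l < R then c l else j, ?_, ?_, ?_⟩
      · intro a ha b hb
        by_cases ha' : a < R <;> by_cases hb' : b < R
        · simp only [ha', hb', if_true]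
          exact hc.isPath a ha' b hb'
        · obtain rfl : b = R := by omega
          simp only [ha', lt_irrefl, if_true, if_false]
          by_cases hak : a = k
          · rw [hak, h1, pathEntry]
            split_ifs <;> omega
          · rw [hz a ha' hak, pathEntry_eq_zero (by omega)]
        · obtain rfl : a = R := by omega
          simp only [hb', lt_irrefl, if_true, if_false]
          by_cases hbk : b = k
          · rw [hbk, h2, pathEntry]
            split_ifs <;> omega
          · rw [h.eq_zero_comm (hz b hb' hbk), pathEntry_comm, pathEntry_eq_zero (by omega)]
        · obtain rfl : a = R := by omega
          obtain rfl : b = a := by omega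
          simp [h.diag, pathEntry]
      · have e : 0 < R := by omega
        simp only [e, if_true, hc.zero]
      · intro a ha
        by_cases ha' : a < R
        · simp only [ha', if_true]
          exact hc.fixed a ha'
        · simp only [ha', if_false, hfix]
    · -- a second branch point on the tail: the part of the tail between the two branch points has
      -- four orthogonal neighbours
      refine h.not_four_orthogonal
        (hc.isPath.isRootSet_seg h (a := 0) (b := k + 1) (by omega) (by omega))
        (u := ![p (m - 1), p (m + 1), c (k + 1), j]) ?_ ?_ ?_
      · simp only [Fin.forall_fin_succ, Matrix.cons_val_zero, Matrix.cons_val_succ,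
          IsEmpty.forall_iff, and_true]
        exact ⟨fun hh => hpc _ (by omega) (by omega) (hsub (k + 1) (by omega) hh),
          fun hh => hpc _ (by omega) (by omega) (hsub (k + 1) (by omega) hh),
          hc.isPath.notMem_seg (by omega) (by omega) (by omega),
          fun hh => hjc (hsub (k + 1) (by omega) hh)⟩
      · simp only [Fin.forall_fin_succ, Matrix.cons_val_zero, Matrix.cons_val_succ,
          IsEmpty.forall_iff, and_true]
        have hm0 : c 0 ∈ seg c 0 (k + 1) := mem_seg.2 ⟨0, by omega, by omega, rfl⟩
        have hmk : c k ∈ seg c 0 (k + 1) := mem_seg.2 ⟨k, by omega, by omega, rfl⟩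
        refine ⟨⟨c 0, hm0, hadj1⟩, ⟨c 0, hm0, hadj2⟩, ⟨c k, hmk, ?_⟩, ⟨c k, hmk, hA⟩⟩
        rw [hc.isPath _ (by omega) _ (by omega), pathEntry_succ]
        decide
      · have e1 := hpj (m - 1) (by omega) (by omega)
        have e2 := hpj (m + 1) (by omega) (by omega)
        have e3 := hz (k + 1) (by omega) (by omega)
        have e4 := hc.apply_eq hp h ht hm (k := m - 1) (l := k + 1) (by omega) (by omega) (by omega)
        have e5 := hc.apply_eq hp h ht hm (k := m + 1) (l := k + 1) (by omega) (by omega) (by omega)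
        rw [if_neg (by omega)] at e4 e5
        intro a b hab
        fin_cases a <;> fin_cases b <;> first | assumption | exact absurd hab (by decide)
  · have hpj (k : ℕ) (hk : k < 2 * m + 1) : A (p k) j = 0 :=
      hp.apply_eq_zero h ht (by omega) hmax hj hfix hk
    refine ⟨hpj, fun k hk => ?_⟩
    by_contra hA
    have h0 := ht.apply_eq_zero hcfix h hRc (hcmem k hk) hjc hfix hA
    have hpj' (k : ℕ) (hk : k < 2 * m + 1) : A (p k) (τ j) = 0 := by
      rw [← ht.map_left, hp.map k hk]
      exact hpj _ (by omega)
    -- a moved node joined to the tail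
    refine h.not_four_orthogonal hRc (u := ![p (m - 1), p (m + 1), j, τ j]) ?_ ?_ ?_
    · simp only [Fin.forall_fin_succ, Matrix.cons_val_zero, Matrix.cons_val_succ,
        IsEmpty.forall_iff, and_true]
      exact ⟨hpc _ (by omega) (by omega), hpc _ (by omega) (by omega), hjc, ht.notMem hcfix hjc⟩
    · simp only [Fin.forall_fin_succ, Matrix.cons_val_zero, Matrix.cons_val_succ,
        IsEmpty.forall_iff, and_true]
      refine ⟨⟨c 0, hcmem 0 (by omega), hadj1⟩, ⟨c 0, hcmem 0 (by omega), hadj2⟩,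
        ⟨c k, hcmem k hk, hA⟩, ⟨c k, hcmem k hk, ?_⟩⟩
      rwa [← ht.map_left, hc.fixed k hk]
    · have e1 := hpj (m - 1) (by omega)
      have e2 := hpj (m + 1) (by omega)
      have e3 := hpj' (m - 1) (by omega)
      have e4 := hpj' (m + 1) (by omega)
      intro a b hab
      fin_cases a <;> fin_cases b <;> first | assumption | exact absurd hab (by decide)

/-- As the diagrams `Ẽ₆` and `Ẽ₇` are excluded, the diagram has type `D` or `E₆`. -/
theorem arms_le (hm : 1 ≤ m) (hR : 2 ≤ R) : m = 1 ∨ m = 2 ∧ R = 2 := by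
  have key (a b : ℕ) (ha1 : 1 ≤ a) (ha : a ≤ m) (hb : b ≤ R) (hb1 : 1 ≤ b)
      (w : Fin (2 * a + (b - 1) + 1) → ℤ) (hw : ∀ k, 0 < w k) :
      0 < ∑ k : Fin (2 * a + (b - 1) + 1), ∑ l : Fin (2 * a + (b - 1) + 1),
        w k * branchEntry a k l * w l := by
    have hp' : IsSymmPath A τ (2 * a + 1) fun k => p (k + (m - a)) := by
      refine ⟨fun k hk l hl => ?_, fun k hk => ?_⟩
      · rw [hp.isPath _ (by omega) _ (by omega)]
        exact pathEntry_congr (by omega)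
      · rw [hp.map _ (by omega)]
        congr 1
        omega
    have hc' : IsTail A τ (fun k => p (k + (m - a))) a b c := by
      refine ⟨fun k hk l hl => hc.isPath k (by omega) l (by omega), ?_, fun k hk =>
        hc.fixed k (by omega)⟩
      rw [hc.zero]
      congr 1
      omega
    exact h.form_pos_of_subdiagram _ w hw _ (fun k l => hc'.apply_eq_branchEntry hp' h ht ha1
      (by omega) (by omega)) (fun k => hc'.weight_eq hp' h ht ha1 (by omega))
  by_contra hcon
  by_cases h3 : 3 ≤ m
  · -- the null vector of `Ẽ₇`
    refine (key 3 2 (by omega) h3 hR (by omega) ![1, 2, 3, 4, 3, 2, 1, 2] (by decide)).not_ge ?_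
    decide
  · -- the null vector of `Ẽ₆`
    refine (key 2 3 (by omega) (by omega) (by omega) (by omega) ![1, 2, 3, 2, 1, 2, 1]
      (by decide)).not_ge ?_
    decide

end IsTail

end Diagram

end WeylCover

/-! ### Types with nontrivial opposition -/

namespace WeylCover

theorem cartanA_apply {n : ℕ} (i j : Fin n) : CartanMatrix.A n i j = pathEntry i j := by
  simp only [CartanMatrix.A, pathEntry, Matrix.of_apply, Fin.ext_iff]

/-- The numbering of the nodes of `D_{R+2}` that turns it into a path `0, 1, 2` with a tail at `1`. -/
def branchIndexD (R a : ℕ) : ℕ :=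
  if a < R - 1 then R + 1 - a else if a = R - 1 then 1 else if a = R then 0 else 2

/-- The entries of the Cartan matrix of type `D_{r+4}`, on natural numbers. -/
def entryD (r i j : ℕ) : ℤ :=
  if i = j then 2
  else if i ≤ r + 2 ∧ j ≤ r + 2 ∧ (i + 1 = j ∨ j + 1 = i) then -1
  else if (i = r + 1 ∧ j = r + 3) ∨ (i = r + 3 ∧ j = r + 1) then -1
  else 0

theorem cartanD_eq_entryD (r : ℕ) (i j : Fin (r + 4)) :
    CartanMatrix.D (r + 4) i j = entryD r i j := by
  obtain ⟨i, hi⟩ := i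
  obtain ⟨j, hj⟩ := j
  simp only [CartanMatrix.D, Matrix.of_apply, Fin.mk.injEq, entryD]
  split_ifs <;> first | rfl | (exfalso; omega)

theorem entryD_eq_branchEntry (r i j : ℕ) (hi : i < r + 4) (hj : j < r + 4) :
    entryD r i j = branchEntry 1 (branchIndexD (r + 2) i) (branchIndexD (r + 2) j) := by
  have key (a : ℕ) (ha : a < r + 4) : a < r + 1 ∧ branchIndexD (r + 2) a = r + 3 - a ∨
      a = r + 1 ∧ branchIndexD (r + 2) a = 1 ∨ a = r + 2 ∧ branchIndexD (r + 2) a = 0 ∨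
      a = r + 3 ∧ branchIndexD (r + 2) a = 2 := by
    simp only [branchIndexD]
    split_ifs <;> omega
  rcases key i hi with ⟨h1, h1'⟩ | ⟨h1, h1'⟩ | ⟨h1, h1'⟩ | ⟨h1, h1'⟩ <;>
  rcases key j hj with ⟨h2, h2'⟩ | ⟨h2, h2'⟩ | ⟨h2, h2'⟩ | ⟨h2, h2'⟩ <;>
  · rw [h1', h2']
    clear key h1' h2'
    simp only [entryD, branchEntry, pathEntry]
    grind

theorem cartanD_apply {R : ℕ} (hR : 2 ≤ R) (i j : Fin (R + 2)) :
    CartanMatrix.D (R + 2) i j = branchEntry 1 (branchIndexD R i) (branchIndexD R j) := by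
  obtain ⟨r, rfl⟩ := Nat.exists_eq_add_of_le' hR
  rw [cartanD_eq_entryD, entryD_eq_branchEntry _ _ _ i.2 j.2]

/-- The numbering of the nodes of `E₆` that turns it into a path `0, …, 4` with a tail at `2`. -/
def branchIndexE : Fin 6 → ℕ := ![0, 5, 1, 2, 3, 4]

theorem cartanE_apply (i j : Fin 6) :
    CartanMatrix.E₆ i j = branchEntry 2 (branchIndexE i) (branchIndexE j) := by
  fin_cases i <;> fin_cases j <;> decide

section Diagram

variable {I : Type*} [Fintype I] [DecidableEq I] {A : I → I → ℤ} {d : I → ℤ}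

theorem sameDynkin_of_surjective (h : IsFiniteCartan A d) {n : ℕ} {C : Matrix (Fin n) (Fin n) ℤ}
    (hC : ∀ a b, C a b = 2 → a = b) (f : Fin n → I) (hf : Function.Surjective f)
    (hA : ∀ a b, A (f a) (f b) = C a b) : SameDynkin (Matrix.of A) C := by
  have hinj : Function.Injective f := fun a b hab =>
    hC a b (by rw [← hA, ← hab, h.diag])
  set e := Equiv.ofBijective f ⟨hinj, hf⟩
  have he (a) : e.symm (f a) = a := e.symm_apply_apply a
  refine ⟨e.symm, fun i j => ?_⟩
  obtain ⟨a, rfl⟩ := hf i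
  obtain ⟨b, rfl⟩ := hf j
  change A (f a) (f b) = C (e.symm (f a)) (e.symm (f b))
  rw [he, he, hA]

/-- The connected diagrams of finite type with a nontrivial automorphism of order two: a maximal
symmetric path is the whole diagram, or a maximal tail at its midpoint contains the rest. -/
theorem sameDynkin_of_involution {τ : I → I} (h : IsFiniteCartan A d)
    (ht : IsDiagramInvolution A d τ) (hc : IsConnected A) (hτ : ∃ i, τ i ≠ i) :
    (∃ n, SameDynkin (Matrix.of A) (CartanMatrix.A n)) ∨
    (∃ n, 4 ≤ n ∧ SameDynkin (Matrix.of A) (CartanMatrix.D n)) ∨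
    SameDynkin (Matrix.of A) CartanMatrix.E₆ := by
  obtain ⟨N, ⟨hN, p, hp⟩, hmax⟩ := exists_max_of_bounded
    (P := fun N => 2 ≤ N ∧ ∃ p, IsSymmPath A τ N p) (Fintype.card I)
    (fun N hN => hN.2.choose_spec.isPath.length_le) (exists_symmPath h ht hc hτ)
  have hmax1 : ¬ ∃ p', IsSymmPath A τ (N + 2) p' := fun hh => by
    have := hmax (N + 2) ⟨by omega, hh⟩
    omega
  by_cases hall : ∀ i, i ∈ seg p 0 N
  · refine Or.inl ⟨N, sameDynkin_of_surjective h (fun a b hab => ?_) (fun k => p k) (fun i => ?_)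
      fun a b => ?_⟩
    · rw [cartanA_apply, pathEntry] at hab
      split_ifs at hab with h1
      · exact Fin.ext h1
      all_goals omega
    · obtain ⟨k, -, hk, rfl⟩ := mem_seg.1 (hall i)
      exact ⟨⟨k, hk⟩, rfl⟩
    · rw [cartanA_apply, hp.isPath _ a.2 _ b.2]
  right
  obtain ⟨j, hj, k, hk, hA⟩ : ∃ j, j ∉ seg p 0 N ∧ ∃ k < N, A (p k) j ≠ 0 := by
    by_contra! hcon
    refine hall (hc (· ∈ seg p 0 N) ⟨p 0, mem_seg.2 ⟨0, by omega, by omega, rfl⟩⟩ ?_)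
    intro i j hi hA
    by_contra hj
    obtain ⟨k, -, hk, rfl⟩ := mem_seg.1 hi
    exact h.apply_comm_ne_zero hA (hcon j hj k hk)
  have hjfix : τ j = j := by
    by_contra hne
    exact hA (hp.apply_eq_zero h ht hN hmax1 hj hne hk)
  obtain ⟨hNk, h1, h2⟩ := hp.apply_eq_of_fixed h ht hN hj hjfix hk hA
  subst hNk
  have hm : 1 ≤ k := by omega
  have htail : IsTail A τ p k 2 fun l => if l = 0 then p k else j := by
    refine ⟨fun a ha b hb => ?_, rfl, fun a ha => ?_⟩
    · interval_cases a <;> interval_cases b <;> simp [h.diag, pathEntry, h1, h2]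
    · interval_cases a
      · simp only [if_true]
        rw [hp.map _ (by omega)]
        congr 1
        omega
      · simpa using hjfix
  obtain ⟨R, ⟨hR, c, hcT⟩, hmaxR⟩ := exists_max_of_bounded
    (P := fun R => 2 ≤ R ∧ ∃ c, IsTail A τ p k R c) (Fintype.card I)
    (fun R hR => hR.2.choose_spec.isPath.length_le) ⟨2, le_rfl, _, htail⟩
  have hmax2 : ¬ ∃ c', IsTail A τ p k (R + 1) c' := fun hh => by
    have := hmaxR (R + 1) ⟨by omega, hh⟩
    omega
  have hall' : ∀ i, i ∈ seg p 0 (2 * k + 1) ∨ i ∈ seg c 0 R := by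
    refine hc (fun i => i ∈ seg p 0 (2 * k + 1) ∨ i ∈ seg c 0 R)
      ⟨p 0, Or.inl (mem_seg.2 ⟨0, by omega, by omega, rfl⟩)⟩ ?_
    intro i j hi hA
    by_contra! hj
    obtain ⟨h3, h4⟩ := hcT.apply_eq_zero hp h ht hm hR hmax1 hmax2 hj.1 hj.2
    rcases hi with hi | hi
    · obtain ⟨l, -, hl, rfl⟩ := mem_seg.1 hi
      exact h.apply_comm_ne_zero hA (h3 l hl)
    · obtain ⟨l, -, hl, rfl⟩ := mem_seg.1 hi
      exact h.apply_comm_ne_zero hA (h4 l hl)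
  set f : ℕ → I := fun l => if l ≤ 2 * k then p l else c (l - 2 * k) with hf
  have hfA (a b : ℕ) (ha : a < 2 * k + R) (hb : b < 2 * k + R) :
      A (f a) (f b) = branchEntry k a b := hcT.apply_eq_branchEntry hp h ht hm ha hb
  have hfsurj (i : I) : ∃ a < 2 * k + R, f a = i := by
    rcases hall' i with hi | hi
    · obtain ⟨l, -, hl, rfl⟩ := mem_seg.1 hi
      exact ⟨l, by omega, if_pos (by omega)⟩
    · obtain ⟨l, -, hl, rfl⟩ := mem_seg.1 hi
      rcases Nat.eq_zero_or_pos l with rfl | hl0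
      · exact ⟨k, by omega, (if_pos (by omega)).trans hcT.zero.symm⟩
      · refine ⟨2 * k + l, by omega, (if_neg (by omega)).trans ?_⟩
        congr 1
        omega
  rcases hcT.arms_le hp h ht hm hR with rfl | ⟨rfl, rfl⟩
  · left
    refine ⟨R + 2, by omega, sameDynkin_of_surjective h (fun a b hab => ?_)
      (fun a => f (branchIndexD R a)) (fun i => ?_) fun a b => ?_⟩
    · by_contra hne
      have := CartanMatrix.D_off_diag_nonpos (R + 2) a b hne
      omega
    · obtain ⟨a, ha, rfl⟩ := hfsurj i
      refine ⟨⟨if a = 0 then R else if a = 1 then R - 1 else if a = 2 then R + 1 else R + 1 - a,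
        by split_ifs <;> omega⟩, ?_⟩
      simp only [branchIndexD]
      grind
    · rw [cartanD_apply hR]
      have := a.2
      have := b.2
      refine hfA _ _ ?_ ?_ <;>
      · simp only [branchIndexD]
        split_ifs <;> omega
  · right
    refine sameDynkin_of_surjective h (fun a b hab => ?_) (fun a => f (branchIndexE a)) (fun i => ?_)
      fun a b => ?_
    · by_contra hne
      have := CartanMatrix.E₆_off_diag_nonpos a b hne
      omega
    · obtain ⟨a, ha, rfl⟩ := hfsurj i
      have : ∀ a < 6, ∃ b, branchIndexE b = a := by decide
      obtain ⟨b, rfl⟩ := this a ha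
      exact ⟨b, rfl⟩
    · rw [cartanE_apply]
      have : ∀ a, branchIndexE a < 6 := by decide
      exact hfA _ _ (this a) (this b)

end Diagram

section Base

open RootPairing

variable {ι K V V' : Type*} [Field K] [AddCommGroup V] [Module K V] [AddCommGroup V'] [Module K V']
  {Φ : RootPairing ι K V V'} [Φ.IsRootSystem] (b : Φ.Base) [CharZero K] [Φ.IsCrystallographic]
  [Finite ι] [Φ.IsReduced]

/-- The Cartan matrix of a base is of finite type. The weights are made invariant under the
opposition by adding to given weights their images. -/
theorem exists_isFiniteCartan (hτ : ∀ i, opposition b (opposition b i) = i) :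
    ∃ d, IsFiniteCartan (fun i j => b.cartanMatrix i j) d ∧
      IsDiagramInvolution (fun i j => b.cartanMatrix i j) d (opposition b) := by
  classical
  obtain ⟨d, hd, hpos⟩ := b.exists_cartanMatrix_diagaonal_mul_posDef
  have hsymm (i j : b.support) : d i * b.cartanMatrix i j = d j * b.cartanMatrix j i := by
    have := congr_fun (congr_fun hpos.1 i) j
    simpa [Matrix.conjTranspose_apply, Matrix.diagonal_mul] using this.symm
  have hform (x : b.support → ℤ) (hx : x ≠ 0) :
      0 < ∑ i, ∑ j, x i * (d i * b.cartanMatrix i j) * x j := by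
    have := hpos.dotProduct_mulVec_pos hx
    simpa [dotProduct, Matrix.mulVec, Matrix.diagonal_mul, Finset.mul_sum, mul_assoc] using this
  have hA (i j : b.support) := cartanMatrix_opposition b i j
  refine ⟨fun i => d i + d (opposition b i), ⟨b.cartanMatrix_apply_same, ?_, ?_, ?_, ?_⟩,
    ⟨hτ, hA, ?_⟩⟩
  · exact fun i j hij => b.cartanMatrix_le_zero_of_ne i j hij
  · exact fun i => add_pos (hd _) (hd _)
  · intro i j
    have h1 := hsymm i j
    have h2 := hsymm (opposition b i) (opposition b j)
    rw [hA, hA] at h2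
    rw [add_mul, add_mul, h1, h2]
  · intro x hx
    have h1 := hform x hx
    have h2 := hform (fun i => x (opposition b i)) (by
      intro h0
      apply hx
      ext i
      have := congr_fun h0 (opposition b i)
      simpa [hτ] using this)
    have h3 : ∑ i, ∑ j, x (opposition b i) * (d i * b.cartanMatrix i j) * x (opposition b j) =
        ∑ i, ∑ j, x i * (d (opposition b i) * b.cartanMatrix i j) * x j := by
      have e : Function.Involutive (opposition b) := hτ
      rw [← Equiv.sum_comp e.toPerm]
      refine Finset.sum_congr rfl fun i _ => ?_
      rw [← Equiv.sum_comp e.toPerm]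
      refine Finset.sum_congr rfl fun j _ => ?_
      simp [hτ, hA]
    rw [h3] at h2
    refine (add_pos h1 h2).trans_eq ?_
    rw [← Finset.sum_add_distrib]
    refine Finset.sum_congr rfl fun i _ => ?_
    rw [← Finset.sum_add_distrib]
    refine Finset.sum_congr rfl fun j _ => ?_
    ring
  · intro i
    rw [hτ, add_comm]

/-- The types with nontrivial opposition are among `A_n`, `D_n` and `E₆`. -/
theorem isType_of_opposition [Φ.IsIrreducible] (h : ∃ i, opposition b i ≠ i) :
    (∃ n, IsType b (CartanMatrix.A n)) ∨ (∃ n, 4 ≤ n ∧ IsType b (CartanMatrix.D n)) ∨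
      IsType b CartanMatrix.E₆ := by
  classical
  obtain ⟨d, hd, ht⟩ := exists_isFiniteCartan b (opposition_opposition b)
  exact sameDynkin_of_involution hd ht
    (fun p ⟨_, hi⟩ hp _ => b.induction_on_cartanMatrix p hi hp) h

end Base

end WeylCover

/-! ### Palindromes with prescribed fibre sizes -/

namespace WeylCover

open Equiv Finset
open scoped Nat

section Colouring

variable {α β : Type*} [Fintype α] [DecidableEq α] [Fintype β] [DecidableEq β]

theorem exists_perm_comp_eq_iff (c z : α → β) :
    (∃ σ : Perm α, c ∘ σ = z) ↔ ∀ k, #{a | z a = k} = #{a | c a = k} := by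
  constructor
  · rintro ⟨σ, rfl⟩ k
    exact card_bij (fun a _ => σ a) (by simp) (by simp) fun b hb => ⟨σ.symm b, by simpa using hb⟩
  · intro h
    have e (k : β) : {a // z a = k} ≃ {a // c a = k} :=
      Fintype.equivOfCardEq (by rw [Fintype.card_subtype, Fintype.card_subtype, h])
    exact ⟨ofFiberEquiv e, funext fun a => ofFiberEquiv_map e a⟩

/-- The number of colourings with prescribed fibre sizes is a multinomial coefficient. -/
theorem ncard_fibres_mul_prod (p : β → ℕ) (hp : ∑ k, p k = Fintype.card α) :
    Set.ncard {u : α → β | ∀ k, #{a | u a = k} = p k} * ∏ k, (p k)! = (Fintype.card α)! := by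
  obtain ⟨u₀, hu₀⟩ : ∃ u : α → β, ∀ k, #{a | u a = k} = p k := by
    have e : α ≃ Σ k, Fin (p k) := Fintype.equivOfCardEq (by simp [hp])
    refine ⟨fun a => (e a).1, fun k => ?_⟩
    rw [← Fintype.card_subtype, ← Fintype.card_fin (p k)]
    refine Fintype.card_congr ((e.subtypeEquiv fun a => Iff.rfl).trans (sigmaSubtype k))
  have horb : {u : α → β | ∀ k, #{a | u a = k} = p k} = MulAction.orbit (Perm α)ᵈᵐᵃ u₀ := by
    ext u
    simp only [Set.mem_ofPred_eq, ← hu₀]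
    rw [← exists_perm_comp_eq_iff]
    exact ⟨fun ⟨σ, h⟩ => ⟨DomMulAct.mk σ, h⟩, fun ⟨σ, h⟩ => ⟨DomMulAct.mk.symm σ, h⟩⟩
  have hstab : Nat.card (MulAction.stabilizer (Perm α)ᵈᵐᵃ u₀) = ∏ k, (p k)! := by
    rw [Nat.card_congr (DomMulAct.mk.symm.subtypeEquiv (q := fun g : Perm α => u₀ ∘ g = u₀) fun g =>
      DomMulAct.mem_stabilizer_iff (f := u₀) (g := g)), Nat.card_eq_fintype_card,
      DomMulAct.stabilizer_card]
    simp only [Fintype.card_subtype, hu₀]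
  rw [horb, ← Nat.card_coe_set_eq, Nat.card_congr (MulAction.orbitEquivQuotientStabilizer _ u₀),
    ← hstab, ← Subgroup.card_eq_card_quotient_mul_card_subgroup, Nat.card_congr DomMulAct.mk.symm,
    Nat.card_perm, Nat.card_eq_fintype_card]

end Colouring

section Palindrome

variable {r : ℕ}

/-- The fibres of a palindrome, except possibly the one of the middle letter, are even. -/
theorem card_fibre_palindrome {β : Type*} [DecidableEq β] {h d : ℕ} (z : Fin (h + (d + h)) → β)
    (hz : ∀ a, z a.rev = z a) (k : β) :
    #{a | z a = k} = 2 * #{a : Fin h | z (a.castAdd _) = k} +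
      #{a : Fin d | z (Fin.natAdd h (a.castAdd h)) = k} := by
  simp only [card_filter]
  rw [Fin.sum_univ_add, Fin.sum_univ_add]
  have (a : Fin h) : z (Fin.natAdd h (Fin.natAdd d a)) = z (a.rev.castAdd _) := by
    rw [← hz]
    congr 1
    ext
    simp
    omega
  simp only [this]
  have h2 := Equiv.sum_comp Fin.revPerm fun a : Fin h => if z (a.castAdd (d + h)) = k then 1 else 0
  simp only [Fin.revPerm_apply] at h2
  rw [h2]
  ring

theorem subsingleton_odd_of_palindrome {β : Type*} [DecidableEq β] {n : ℕ} (z : Fin n → β)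
    (hz : ∀ a, z a.rev = z a) : Set.Subsingleton {k | Odd #{a | z a = k}} := by
  obtain ⟨h, d, hd, rfl⟩ : ∃ h d, d ≤ 1 ∧ n = h + (d + h) := ⟨n / 2, n % 2, by omega, by omega⟩
  intro k hk l hl
  simp only [Set.mem_ofPred_eq, card_fibre_palindrome z hz] at hk hl
  have key (k : β) (hk : Odd (2 * #{a : Fin h | z (a.castAdd _) = k} +
      #{a : Fin d | z (Fin.natAdd h (a.castAdd h)) = k})) :
      ∃ a : Fin d, z (Fin.natAdd h (a.castAdd h)) = k := by
    have h0 : #{a : Fin d | z (Fin.natAdd h (a.castAdd h)) = k} ≠ 0 := by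
      intro h0
      rw [h0] at hk
      exact absurd hk (by simp)
    obtain ⟨a, ha⟩ := card_ne_zero.1 h0
    exact ⟨a, (mem_filter.1 ha).2⟩
  obtain ⟨a, rfl⟩ := key k hk
  obtain ⟨b, rfl⟩ := key l hl
  have : a = b := by ext; omega
  rw [this]

/-- Palindromes with prescribed fibre sizes, of which at most one is odd, are determined by their
first half, whose fibre sizes are the halves. -/
theorem ncard_palindromes_mul_prod {n : ℕ} (c : Fin n → Fin r)
    (hodd : Set.Subsingleton {k | Odd #{a | c a = k}}) :
    Set.ncard {z : Fin n → Fin r | (∃ σ : Perm (Fin n), c ∘ σ = z) ∧ ∀ a, z a.rev = z a} *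
      ∏ k, (#{a | c a = k} / 2)! = (n / 2)! := by
  obtain ⟨h, d, hd, rfl⟩ : ∃ h d, d ≤ 1 ∧ n = h + (d + h) := ⟨n / 2, n % 2, by omega, by omega⟩
  have hn : (h + (d + h)) / 2 = h := by omega
  have hsum : ∑ k, #{a | c a = k} = h + (d + h) := by
    rw [← card_eq_sum_card_fiberwise (fun a _ => mem_univ (c a)), card_univ, Fintype.card_fin]
  -- the letter in the middle, when there is one, is the one with the odd fibre
  have hmid : ∃ c₀ : Fin d → Fin r, ∀ k, #{a | c a = k} % 2 = #{a | c₀ a = k} := by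
    have hparity : ∑ k, #{a | c a = k} % 2 ≡ d [MOD 2] := by
      have : d ≡ h + (d + h) [MOD 2] := by
        rw [Nat.ModEq]
        omega
      exact (Nat.ModEq.trans (by rw [Nat.ModEq, ← Finset.sum_nat_mod]) (hsum ▸ this.symm) :)
    by_cases hex : ∃ k, Odd #{a | c a = k}
    · obtain ⟨k₀, hk₀⟩ := hex
      have hval (k : Fin r) : #{a | c a = k} % 2 = if k₀ = k then 1 else 0 := by
        split_ifs with hk
        · exact hk ▸ Nat.odd_iff.1 hk₀
        · exact Nat.even_iff.1 (Nat.not_odd_iff_even.1 fun h' => hk (hodd hk₀ h'))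
      have hd1 : d = 1 := by
        simp only [hval, sum_ite_eq, mem_univ, if_true] at hparity
        rw [Nat.ModEq] at hparity
        omega
      subst hd1
      refine ⟨fun _ => k₀, fun k => ?_⟩
      rw [hval]
      split_ifs with hk <;> simp [hk]
    · have hval (k : Fin r) : #{a | c a = k} % 2 = 0 :=
        Nat.even_iff.1 (Nat.not_odd_iff_even.1 fun h' => hex ⟨k, h'⟩)
      have hd0 : d = 0 := by
        simp only [hval, sum_const_zero] at hparity
        rw [Nat.ModEq] at hparity
        omega
      subst hd0
      exact ⟨finZeroElim, fun k => by rw [hval]; simp⟩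
  obtain ⟨c₀, hc₀⟩ := hmid
  have hhalf : ∑ k, #{a | c a = k} / 2 = Fintype.card (Fin h) := by
    have h1 : ∑ k, #{a | c₀ a = k} = d := by
      rw [← card_eq_sum_card_fiberwise (fun a _ => mem_univ (c₀ a)), card_univ, Fintype.card_fin]
    have h2 : ∑ k, #{a | c a = k} = 2 * ∑ k, #{a | c a = k} / 2 + ∑ k, #{a | c₀ a = k} := by
      rw [mul_sum, ← sum_add_distrib]
      exact sum_congr rfl fun k _ => by rw [← hc₀]; omega
    rw [Fintype.card_fin]
    omega
  have hcount := ncard_fibres_mul_prod _ hhalf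
  rw [Fintype.card_fin] at hcount
  rw [hn, ← hcount]
  congr 1
  refine Set.ncard_congr (fun z _ a => z (a.castAdd _)) ?_ ?_ ?_
  · rintro z ⟨hσ, hz⟩ k
    have h1 := card_fibre_palindrome z hz k
    rw [(exists_perm_comp_eq_iff c z).1 hσ] at h1
    have h2 : #{a : Fin d | z (Fin.natAdd h (a.castAdd h)) = k} ≤ d := by
      simpa using card_le_univ {a : Fin d | z (Fin.natAdd h (a.castAdd h)) = k}
    change #{a : Fin h | z (a.castAdd _) = k} = _
    omega
  · rintro z z' ⟨hσ, hz⟩ ⟨hσ', hz'⟩ heq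
    have hfirst (a : Fin h) : z (a.castAdd _) = z' (a.castAdd _) := congr_fun heq a
    have hmid (a : Fin d) : z (Fin.natAdd h (a.castAdd h)) = z' (Fin.natAdd h (a.castAdd h)) := by
      by_contra hne
      set k := z (Fin.natAdd h (a.castAdd h)) with hk
      have h1 := card_fibre_palindrome z hz k
      have h2 := card_fibre_palindrome z' hz' k
      rw [(exists_perm_comp_eq_iff c z).1 hσ] at h1
      rw [(exists_perm_comp_eq_iff c z').1 hσ'] at h2
      simp only [hfirst] at h1
      have h3 : 0 < #{a : Fin d | z (Fin.natAdd h (a.castAdd h)) = k} :=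
        card_pos.2 ⟨a, by simp [hk]⟩
      have h4 : #{a : Fin d | z' (Fin.natAdd h (a.castAdd h)) = k} = 0 := by
        rw [card_eq_zero, filter_eq_empty_iff]
        intro b _ hb
        have : a = b := by ext; omega
        exact hne (this ▸ hb.symm)
      omega
    funext a
    refine Fin.addCases hfirst (fun a => Fin.addCases hmid (fun a => ?_) a) a
    rw [← hz, ← hz']
    have : (Fin.natAdd h (Fin.natAdd d a)).rev = a.rev.castAdd _ := by
      ext
      simp
      omega
    rw [this, hfirst]
  · intro u hu
    let z : Fin (h + (d + h)) → Fin r := Fin.append u (Fin.append c₀ fun a => u a.rev)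
    have hz (a) : z a.rev = z a := by
      have key (a : Fin h) : (Fin.castAdd (d + h) a).rev = Fin.natAdd h (Fin.natAdd d a.rev) := by
        ext
        simp
        omega
      refine Fin.addCases (fun a => ?_) (fun a => Fin.addCases (fun a => ?_) (fun a => ?_) a) a
      · rw [key]
        simp [z]
      · congr 1
        ext
        simp
        omega
      · have h1 := key a.rev
        rw [Fin.rev_rev] at h1
        rw [← h1, Fin.rev_rev, h1]
        simp [z]
    refine ⟨z, ⟨(exists_perm_comp_eq_iff c z).2 fun k => ?_, hz⟩, ?_⟩
    · rw [card_fibre_palindrome z hz]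
      simp only [z, Fin.append_left, Fin.append_right]
      rw [hu, ← hc₀]
      omega
    · funext a
      simp [z]

end Palindrome

end WeylCover

/-! ### Type `A`: the action on words -/

namespace WeylCover

open RootPairing

section LongestWord

variable {ι K V V' : Type*} [Field K] [AddCommGroup V] [Module K V] [AddCommGroup V'] [Module K V']
  {Φ : RootPairing ι K V V'} [Φ.IsRootSystem] (b : Φ.Base) [CharZero K] [Φ.IsCrystallographic]
  [Finite ι] [Φ.IsReduced]

/-- An element that maps every simple root to the negative of a simple root is the longest word. -/
theorem eq_longestWord_of_act (u : Φ.weylGroup) (σ : b.support → b.support)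
    (h : ∀ x i, act b u x i = -x (σ i)) : u = longestWord b := by
  classical
  have key (i : b.support) : u⁻¹ • Φ.root i = -Φ.root (σ i) := by
    apply b.toWeightBasis.ext_elem
    intro j
    have (v : V) : b.toWeightBasis.repr v j = eval b (Pi.single j 1) v := by
      have : b.toWeightBasis.coord j = eval b (Pi.single j 1) := by
        refine b.toWeightBasis.ext fun k => ?_
        rw [b.toWeightBasis_apply, eval_root, ← b.toWeightBasis_apply, Module.Basis.coord_apply,
          Module.Basis.repr_self, Finsupp.single_apply, Pi.single_apply]
      exact LinearMap.congr_fun this v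
    rw [this, this, map_neg, eval_root]
    exact h _ _
  have h1 : u⁻¹ = longestWord b := by
    refine eq_longestWord b fun i => ?_
    have h2 : Φ.weylGroupToPerm u⁻¹ i = Φ.reflectionPerm (σ i) (σ i) := by
      apply Φ.root.injective
      rw [← weylGroup_apply_root, key, root_reflectionPerm_same]
    rw [h2]
    have := (isPos_iff_of_root_eq_neg b (i := Φ.reflectionPerm (σ i) (σ i)) (j := (σ i : ι))
      (root_reflectionPerm_same _))
    have hpos := Base.isPos_of_mem_support (σ i).2
    tauto
  rw [← inv_inv u, h1, inv_eq_of_mul_eq_one_left (longestWord_mul_self b)]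

end LongestWord

section TypeA

open Equiv

variable {ι K V V' : Type*} [Field K] [AddCommGroup V] [Module K V] [AddCommGroup V'] [Module K V']
  {Φ : RootPairing ι K V V'} [Φ.IsRootSystem] {b : Φ.Base} [CharZero K] [Φ.IsCrystallographic]

/-- The values on the simple roots of type `A_N` of the form with coordinates `y`: differences of
consecutive coordinates. -/
def coordA {N : ℕ} (e : b.support ≃ Fin N) (y : Fin (N + 1) → K) : b.support → K :=
  fun i => y (e i).castSucc - y (e i).succ

variable {N : ℕ} {e : b.support ≃ Fin N}

theorem exists_sub_succ_eq (x : Fin N → K) :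
    ∃ y : Fin (N + 1) → K, ∀ a : Fin N, y a.castSucc - y a.succ = x a := by
  refine ⟨fun a => -∑ k ∈ Finset.range a, if h : k < N then x ⟨k, h⟩ else 0, fun a => ?_⟩
  simp [Finset.sum_range_succ]

theorem sub_eq_of_sub_succ_eq {y z : Fin (N + 1) → K}
    (h : ∀ a : Fin N, y a.castSucc - y a.succ = z a.castSucc - z a.succ) (a : Fin (N + 1)) :
    y a - z a = y 0 - z 0 := by
  induction a using Fin.induction with
  | zero => rfl
  | succ i ih =>
    rw [← ih]
    linear_combination -h i

/-- The simple reflections of type `A` swap consecutive coordinates. -/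
theorem sub_succ_comp_swap (y : Fin (N + 1) → K) (a c : Fin N) :
    y (swap c.castSucc c.succ a.castSucc) - y (swap c.castSucc c.succ a.succ) =
      y a.castSucc - y a.succ - (pathEntry a c : K) * (y c.castSucc - y c.succ) := by
  rcases eq_or_ne a c with rfl | hac
  · rw [pathEntry, if_pos rfl, swap_apply_left, swap_apply_right]
    push_cast
    ring
  have hac' : (a : ℕ) ≠ c := Fin.val_ne_of_ne hac
  have h1 : a.castSucc ≠ c.castSucc := by simpa using hac
  have h2 : a.succ ≠ c.succ := by simpa using hac
  by_cases h3 : (a : ℕ) + 1 = c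
  · have h4 : a.succ = c.castSucc := Fin.ext h3
    rw [h4, swap_apply_left, swap_apply_of_ne_of_ne h1
      (by rw [Ne, Fin.ext_iff]; simp; omega), pathEntry, if_neg hac', if_pos (Or.inl h3)]
    push_cast
    ring
  by_cases h4 : (c : ℕ) + 1 = a
  · have h5 : a.castSucc = c.succ := Fin.ext h4.symm
    rw [h5, swap_apply_right, swap_apply_of_ne_of_ne (by rw [Ne, Fin.ext_iff]; simp; omega) h2,
      pathEntry, if_neg hac', if_pos (Or.inr h4)]
    push_cast
    ring
  rw [swap_apply_of_ne_of_ne h1 (by rw [Ne, Fin.ext_iff]; simp; omega),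
    swap_apply_of_ne_of_ne (by rw [Ne, Fin.ext_iff]; simp; omega) h2,
    pathEntry, if_neg hac', if_neg (by omega)]
  push_cast
  ring

theorem coordA_surjective (x : b.support → K) : ∃ y, coordA e y = x := by
  obtain ⟨y, hy⟩ := exists_sub_succ_eq (x ∘ e.symm)
  refine ⟨y, funext fun i => (hy (e i)).trans ?_⟩
  rw [Function.comp_apply, e.symm_apply_apply]

theorem sub_eq_of_coordA_eq {y z : Fin (N + 1) → K} (h : coordA e y = coordA e z)
    (a : Fin (N + 1)) : y a - z a = y 0 - z 0 :=
  sub_eq_of_sub_succ_eq (fun a => by simpa [coordA] using congr_fun h (e.symm a)) a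

/-- Two rearrangements of a word that differ by a constant are equal, since their sums are. -/
theorem comp_eq_of_coordA_eq {y : Fin (N + 1) → K} {σ ρ : Perm (Fin (N + 1))}
    (h : coordA e (y ∘ σ) = coordA e (y ∘ ρ)) : y ∘ σ = y ∘ ρ := by
  have h1 := sub_eq_of_coordA_eq h
  have h2 : ∑ a, ((y ∘ σ) a - (y ∘ ρ) a) = 0 := by
    rw [Finset.sum_sub_distrib, sub_eq_zero]
    exact (Equiv.sum_comp σ y).trans (Equiv.sum_comp ρ y).symm
  rw [Finset.sum_congr rfl fun a _ => h1 a, Finset.sum_const, Finset.card_univ, Fintype.card_fin,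
    nsmul_eq_mul, mul_eq_zero] at h2
  funext a
  rw [← sub_eq_zero, h1 a]
  exact h2.resolve_left (Nat.cast_ne_zero.2 N.succ_ne_zero)

variable (he : ∀ i j, b.cartanMatrix i j = CartanMatrix.A N (e i) (e j))
include he

theorem act_simpleReflection_coordA (j : b.support) (y : Fin (N + 1) → K) :
    act b (simpleReflection b j) (coordA e y) =
      coordA e (y ∘ swap (e j).castSucc (e j).succ) := by
  funext i
  rw [act_simpleReflection, he, cartanA_apply]
  exact (sub_succ_comp_swap y (e i) (e j)).symm

theorem exists_act_eq_coordA_comp (σ : Perm (Fin (N + 1))) :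
    ∃ w, ∀ y : Fin (N + 1) → K, act b w (coordA e y) = coordA e (y ∘ σ) := by
  have hσ : σ ∈ Submonoid.closure (Set.range fun i : Fin N => swap i.castSucc i.succ) := by
    rw [Perm.mclosure_swap_castSucc_succ]
    trivial
  induction hσ using Submonoid.closure_induction with
  | mem σ hσ =>
    obtain ⟨i, rfl⟩ := hσ
    refine ⟨simpleReflection b (e.symm i), fun y => ?_⟩
    rw [act_simpleReflection_coordA he, e.apply_symm_apply]
  | one => exact ⟨1, fun y => act_one b _⟩
  | mul σ ρ _ _ hσ hρ =>
    obtain ⟨w, hw⟩ := hσ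
    obtain ⟨u, hu⟩ := hρ
    refine ⟨u * w, fun y => ?_⟩
    rw [act_mul, hw, hu]
    rfl

variable [Finite ι] [Φ.IsReduced]

theorem exists_coordA_comp_eq_act (w : Φ.weylGroup) :
    ∃ σ : Perm (Fin (N + 1)), ∀ y : Fin (N + 1) → K, act b w (coordA e y) = coordA e (y ∘ σ) := by
  obtain ⟨l, rfl⟩ := exists_word b w
  induction l with
  | nil => exact ⟨1, fun y => act_one b _⟩
  | cons j l ih =>
    obtain ⟨σ, hσ⟩ := ih
    refine ⟨σ * swap (e j).castSucc (e j).succ, fun y => ?_⟩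
    rw [List.map_cons, List.prod_cons, act_mul, hσ, act_simpleReflection_coordA he]
    rfl

/-- The longest word reverses the order of the coordinates. -/
theorem act_longestWord_coordA (y : Fin (N + 1) → K) :
    act b (longestWord b) (coordA e y) = coordA e (y ∘ Fin.rev) := by
  obtain ⟨w, hw⟩ := exists_act_eq_coordA_comp he Fin.revPerm
  have : w = longestWord b := by
    refine eq_longestWord_of_act b w (fun i => e.symm (e i).rev) fun x i => ?_
    obtain ⟨y, rfl⟩ := coordA_surjective (e := e) x
    rw [hw]
    simp only [coordA, Function.comp_apply, Fin.revPerm_apply, e.apply_symm_apply,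
      Fin.rev_castSucc, Fin.rev_succ]
    ring
  rw [← this, hw]
  rfl

/-- In type `A`, the number `a_P` counts the palindromic rearrangements of a word. -/
theorem aP_eq_ncard_palindromes {r : ℕ} (J : Set b.support) (c : Fin (N + 1) → Fin r)
    (hc : ∀ i, (c (e i).succ : ℕ) = c (e i).castSucc + chi b J i) :
    aP b J = Set.ncard {z : Fin (N + 1) → Fin r |
      (∃ σ : Perm (Fin (N + 1)), c ∘ σ = z) ∧ ∀ a, z a.rev = z a} := by
  let f (z : Fin (N + 1) → Fin r) : Fin (N + 1) → K := fun a => -((z a : ℕ) : K)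
  have hf : Function.Injective f := by
    intro z z' h
    funext a
    have := congr_fun h a
    simp only [f, neg_inj, Nat.cast_inj] at this
    exact Fin.ext this
  have hchi : chiK b J = coordA e (f c) := by
    funext i
    simp only [coordA, f, hc, chiK]
    push_cast
    ring
  rw [aP_eq_ncard]
  symm
  refine Set.ncard_congr (fun z _ => coordA e (f z)) ?_ ?_ ?_
  · rintro _ ⟨⟨σ, rfl⟩, hz⟩
    refine ⟨?_, ?_⟩
    · obtain ⟨w, hw⟩ := exists_act_eq_coordA_comp (K := K) he σ
      refine ⟨w, ?_⟩
      rw [hchi, hw]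
      rfl
    · rw [act_longestWord_coordA he]
      congr 1
      funext a
      simp only [f, Function.comp_apply] at hz ⊢
      rw [hz]
  · rintro _ _ ⟨⟨σ, rfl⟩, -⟩ ⟨⟨ρ, rfl⟩, -⟩ h
    exact hf (comp_eq_of_coordA_eq (y := f c) (σ := σ) (ρ := ρ) h)
  · rintro _ ⟨⟨w, rfl⟩, hx⟩
    obtain ⟨σ, hσ⟩ := exists_coordA_comp_eq_act he w
    refine ⟨c ∘ σ, ⟨⟨σ, rfl⟩, fun a => ?_⟩, ?_⟩
    · rw [hchi, hσ, act_longestWord_coordA he] at hx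
      have := comp_eq_of_coordA_eq (y := f c) (σ := Fin.revPerm.trans σ) (ρ := σ) hx
      exact congr_fun (hf (a₁ := (c ∘ σ) ∘ Fin.rev) (a₂ := c ∘ σ) this) a
    · rw [hchi, hσ]
      rfl

end TypeA

end WeylCover

/-! ### Disjoint unions of diagrams of type `A` -/

namespace WeylCover

open Finset

section Blocks

/-- The fibres of a monotone map on `Fin n` are consecutive intervals. -/
theorem exists_fibre_start {n r : ℕ} (c : Fin n → Fin r) (hc : Monotone c) :
    ∃ S : Fin r → ℕ, (∀ k, S k + #{a | c a = k} ≤ n) ∧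
      ∀ (a : Fin n) k, c a = k ↔ S k ≤ a ∧ (a : ℕ) < S k + #{a | c a = k} := by
  let T (k : ℕ) : ℕ := #{a : Fin n | (c a : ℕ) < k}
  have hT (a : Fin n) (k : ℕ) : (c a : ℕ) < k ↔ (a : ℕ) < T k := by
    constructor
    · intro h
      have h1 : Finset.Iic a ⊆ ({a : Fin n | (c a : ℕ) < k} : Finset (Fin n)) := fun d hd => by
        have := hc (Finset.mem_Iic.1 hd)
        simp only [mem_filter, mem_univ, true_and]
        exact lt_of_le_of_lt this h
      have := card_le_card h1
      rw [Fin.card_Iic] at this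
      exact this
    · intro h
      by_contra hcon
      have h1 : ({a : Fin n | (c a : ℕ) < k} : Finset (Fin n)) ⊆ Finset.Iio a := fun d hd => by
        rw [mem_filter] at hd
        rw [Finset.mem_Iio]
        by_contra hd'
        have h2 : (c a : ℕ) ≤ c d := hc (not_lt.1 hd')
        omega
      have := card_le_card h1
      rw [Fin.card_Iio] at this
      exact absurd h (not_lt.2 this)
  have hsucc (k : Fin r) : T (k + 1) = T k + #{a | c a = k} := by
    simp only [T]
    rw [← card_union_of_disjoint]
    · congr 1
      ext a
      simp only [mem_filter, mem_univ, true_and, mem_union, Fin.ext_iff]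
      omega
    · rw [disjoint_filter]
      rintro a - h rfl
      exact absurd h (lt_irrefl _)
  refine ⟨fun k => T k, fun k => ?_, fun a k => ?_⟩
  · rw [← hsucc]
    exact (card_le_univ _).trans_eq (Fintype.card_fin n)
  · rw [← hsucc, ← hT, ← not_lt, ← hT, Fin.ext_iff]
    omega

variable {r : ℕ}

/-- The Cartan matrix of a disjoint union of diagrams of type `A`. -/
abbrev cartanBlocks (m : Fin r → ℕ) :
    Matrix (Σ k, Fin (m k - 1)) (Σ k, Fin (m k - 1)) ℤ :=
  Matrix.blockDiagonal' fun k : Fin r => CartanMatrix.A (m k - 1)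

theorem cartanBlocks_apply (m : Fin r → ℕ) (x y : Σ k, Fin (m k - 1)) :
    cartanBlocks m x y = if x.1 = y.1 then pathEntry x.2 y.2 else 0 := by
  obtain ⟨k, i⟩ := x
  obtain ⟨l, j⟩ := y
  by_cases h : k = l
  · subst h
    rw [cartanBlocks, Matrix.blockDiagonal'_apply_eq, cartanA_apply, if_pos rfl]
  · rw [cartanBlocks, Matrix.blockDiagonal'_apply_ne _ _ _ h, if_neg h]

/-- The nodes of `A_N` at which a monotone colouring does not jump form a diagram that is the union
of paths given by the fibres. -/
theorem sameDynkin_cartanBlocks {N : ℕ} (c : Fin (N + 1) → Fin r) (hc : Monotone c) {I : Type*}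
    (g : I → Fin N) (hg : Function.Injective g)
    (hgc : ∀ a, a ∈ Set.range g ↔ c a.castSucc = c a.succ) :
    SameDynkin (Matrix.of fun i j => CartanMatrix.A N (g i) (g j))
      (cartanBlocks fun k => #{a | c a = k}) := by
  obtain ⟨S, hS, hcS⟩ := exists_fibre_start c hc
  have hF (x : Σ k : Fin r, Fin (#{a | c a = k} - 1)) : ∃ i, (g i : ℕ) = S x.1 + x.2 := by
    obtain ⟨k, t⟩ := x
    have h1 := hS k
    have h2 := t.2
    obtain ⟨i, hi⟩ := (hgc ⟨S k + t, by omega⟩).2 (by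
      rw [(hcS _ k).2, eq_comm, (hcS _ k).2]
      · simp
        omega
      · simp
        omega)
    exact ⟨i, by rw [hi]⟩
  choose F hF using hF
  have hcF (x) : c (g (F x)).castSucc = x.1 ∧ c (g (F x)).succ = x.1 := by
    have h2 := x.2.2
    have h3 := hF x
    refine ⟨(hcS _ _).2 ?_, (hcS _ _).2 ?_⟩
    · rw [Fin.val_castSucc]
      omega
    · rw [Fin.val_succ]
      omega
  have hinj : Function.Injective F := by
    intro x y hxy
    obtain ⟨h1, -⟩ := hcF x
    rw [hxy, (hcF y).1] at h1
    have h2 := hF x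
    rw [hxy, hF y] at h2
    obtain ⟨k, s⟩ := x
    obtain ⟨l, t⟩ := y
    dsimp only at h1
    subst h1
    rw [Sigma.mk.injEq]
    exact ⟨rfl, heq_of_eq (Fin.ext (by simpa using h2.symm))⟩
  have hsurj : Function.Surjective F := by
    intro i
    have h1 := (hgc (g i)).1 ⟨i, rfl⟩
    have h2 := (hcS (g i).castSucc _).1 rfl
    have h3 := (hcS (g i).succ _).1 h1.symm
    rw [Fin.val_castSucc] at h2
    rw [Fin.val_succ] at h3
    refine ⟨⟨c (g i).castSucc, ⟨g i - S (c (g i).castSucc), by omega⟩⟩, hg (Fin.ext ?_)⟩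
    rw [hF]
    dsimp only
    omega
  set e := Equiv.ofBijective F ⟨hinj, hsurj⟩
  have he (x) : e.symm (F x) = x := e.symm_apply_apply x
  refine ⟨e.symm, fun i j => ?_⟩
  obtain ⟨x, rfl⟩ := hsurj i
  obtain ⟨y, rfl⟩ := hsurj j
  rw [he, he, cartanBlocks_apply, Matrix.of_apply, cartanA_apply]
  have hx := hF x
  have hy := hF y
  split_ifs with h
  · have hS' : S x.1 = S y.1 := congrArg S h
    rw [hx, hy]
    exact pathEntry_congr (by omega)
  · rw [pathEntry, if_neg, if_neg]
    · rintro (h1 | h1)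
      · apply h
        rw [← (hcF x).2, ← (hcF y).1]
        congr 1
        exact Fin.ext h1
      · apply h
        rw [← (hcF y).2, ← (hcF x).1]
        congr 1
        exact Fin.ext h1.symm
    · intro h1
      apply h
      rw [← (hcF x).1, ← (hcF y).1, Fin.ext h1]

theorem SameDynkin.symm {α β : Type*} {A : Matrix α α ℤ} {B : Matrix β β ℤ}
    (h : SameDynkin A B) : SameDynkin B A := by
  obtain ⟨e, he⟩ := h
  exact ⟨e.symm, fun i j => by rw [he, e.apply_symm_apply, e.apply_symm_apply]⟩

theorem SameDynkin.trans {α β γ : Type*} {A : Matrix α α ℤ} {B : Matrix β β ℤ} {C : Matrix γ γ ℤ}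
    (h : SameDynkin A B) (h' : SameDynkin B C) : SameDynkin A C := by
  obtain ⟨e, he⟩ := h
  obtain ⟨f, hf⟩ := h'
  exact ⟨e.trans f, fun i j => by rw [he, hf]; rfl⟩

/-- An isomorphism of disjoint unions of paths maps components to components. -/
theorem fst_eq_of_cartanBlocks {r' : ℕ} {m : Fin r → ℕ} {m' : Fin r' → ℕ}
    (h : (Σ k, Fin (m k - 1)) ≃ Σ k, Fin (m' k - 1))
    (hh : ∀ x y, cartanBlocks m x y = cartanBlocks m' (h x) (h y)) (k : Fin r)
    (i j : Fin (m k - 1)) : (h ⟨k, i⟩).1 = (h ⟨k, j⟩).1 := by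
  have key (t : ℕ) (ht : t < m k - 1) : (h ⟨k, ⟨t, ht⟩⟩).1 = (h ⟨k, ⟨0, by omega⟩⟩).1 := by
    induction t with
    | zero => rfl
    | succ t ih =>
      rw [← ih (by omega)]
      by_contra hne
      have := hh ⟨k, ⟨t + 1, ht⟩⟩ ⟨k, ⟨t, by omega⟩⟩
      rw [cartanBlocks_apply, cartanBlocks_apply, if_pos rfl, if_neg hne, pathEntry,
        if_neg (by simp), if_pos (Or.inr rfl)] at this
      omega
  rw [key i i.2, key j j.2]

/-- The lengths of the paths in a disjoint union are determined by the diagram; the number of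
trivial paths is determined by the total length. -/
theorem exists_perm_of_sameDynkin {r' : ℕ} {m : Fin r → ℕ} {m' : Fin r' → ℕ}
    (hm : ∀ k, 0 < m k) (hm' : ∀ k, 0 < m' k) (hsum : ∑ k, m k = ∑ k, m' k)
    (h : SameDynkin (cartanBlocks m) (cartanBlocks m')) :
    ∃ σ : Fin r ≃ Fin r', ∀ k, m' (σ k) = m k := by
  obtain ⟨h, hh⟩ := h
  have hr : r = r' := by
    have h1 := Fintype.card_congr h
    simp only [Fintype.card_sigma, Fintype.card_fin] at h1
    have h2 (r : ℕ) (m : Fin r → ℕ) (hm : ∀ k, 0 < m k) : ∑ k, m k = ∑ k, (m k - 1) + r := by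
      have : ∑ k : Fin r, m k = ∑ k, ((m k - 1) + 1) :=
        sum_congr rfl fun k _ => by have := hm k; omega
      rw [this, sum_add_distrib]
      simp
    rw [h2 r m hm, h2 r' m' hm'] at hsum
    omega
  subst hr
  have hh' (x y) : cartanBlocks m' x y = cartanBlocks m (h.symm x) (h.symm y) := by
    rw [hh, h.apply_symm_apply, h.apply_symm_apply]
  let φ (k : {k // 2 ≤ m k}) : Fin r := (h ⟨k, ⟨0, by have := k.2; omega⟩⟩).1
  let ψ (k : {k // 2 ≤ m' k}) : Fin r := (h.symm ⟨k, ⟨0, by have := k.2; omega⟩⟩).1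
  have hφ (k) : 2 ≤ m' (φ k) := by
    have := (h ⟨k, ⟨0, by have := k.2; omega⟩⟩).2.2
    simp only [φ]
    omega
  have hψ (k) : 2 ≤ m (ψ k) := by
    have := (h.symm ⟨k, ⟨0, by have := k.2; omega⟩⟩).2.2
    simp only [ψ]
    omega
  have h1 (k : {k // 2 ≤ m k}) (i : Fin (m k - 1)) : (h ⟨k, i⟩).1 = φ k :=
    fst_eq_of_cartanBlocks h hh _ _ _
  have h2 (k : {k // 2 ≤ m' k}) (i : Fin (m' k - 1)) : (h.symm ⟨k, i⟩).1 = ψ k :=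
    fst_eq_of_cartanBlocks h.symm hh' _ _ _
  have hψφ (k) : ψ ⟨φ k, hφ k⟩ = k := by
    rw [← h2 ⟨φ k, hφ k⟩ (h ⟨k, ⟨0, by have := k.2; omega⟩⟩).2]
    exact congrArg Sigma.fst (h.symm_apply_apply ⟨(k : Fin r), _⟩)
  have hφψ (k) : φ ⟨ψ k, hψ k⟩ = k := by
    rw [← h1 ⟨ψ k, hψ k⟩ (h.symm ⟨k, ⟨0, by have := k.2; omega⟩⟩).2]
    exact congrArg Sigma.fst (h.apply_symm_apply ⟨(k : Fin r), _⟩)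
  have hle (k : {k // 2 ≤ m k}) : m k - 1 ≤ m' (φ k) - 1 := by
    let g (i : Fin (m k - 1)) : Fin (m' (φ k) - 1) :=
      Fin.cast (by rw [h1 k i]) (h ⟨k, i⟩).2
    have hg : Function.Injective g := by
      intro i j hij
      have h3 : h ⟨k, i⟩ = h ⟨k, j⟩ := by
        refine Sigma.ext ((h1 k i).trans (h1 k j).symm) ?_
        rw [Fin.heq_ext_iff (by rw [h1 k i, h1 k j])]
        exact congrArg Fin.val hij
      simpa using h.injective h3
    simpa using Fintype.card_le_of_injective g hg
  have hge (k : {k // 2 ≤ m' k}) : m' k - 1 ≤ m (ψ k) - 1 := by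
    let g (i : Fin (m' k - 1)) : Fin (m (ψ k) - 1) :=
      Fin.cast (by rw [h2 k i]) (h.symm ⟨k, i⟩).2
    have hg : Function.Injective g := by
      intro i j hij
      have h3 : h.symm ⟨k, i⟩ = h.symm ⟨k, j⟩ := by
        refine Sigma.ext ((h2 k i).trans (h2 k j).symm) ?_
        rw [Fin.heq_ext_iff (by rw [h2 k i, h2 k j])]
        exact congrArg Fin.val hij
      simpa using h.symm.injective h3
    simpa using Fintype.card_le_of_injective g hg
  have heq (k : {k // 2 ≤ m k}) : m' (φ k) = m k := by
    have h3 := hle k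
    have h4 := hge ⟨φ k, hφ k⟩
    rw [hψφ] at h4
    have h5 := k.2
    have h6 := hφ k
    dsimp only at h4
    omega
  let E : {k // 2 ≤ m k} ≃ {k // 2 ≤ m' k} :=
    ⟨fun k => ⟨φ k, hφ k⟩, fun k => ⟨ψ k, hψ k⟩, fun k => Subtype.ext (hψφ k),
      fun k => Subtype.ext (hφψ k)⟩
  refine ⟨E.extendSubtype, fun k => ?_⟩
  by_cases hk : 2 ≤ m k
  · rw [E.extendSubtype_apply_of_mem k hk]
    exact heq ⟨k, hk⟩
  · have h3 := E.extendSubtype_not_mem k hk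
    have h4 := hm k
    have h5 := hm' (E.extendSubtype k)
    omega

end Blocks

end WeylCover

/-! ### Type `A`: the value of `a_P` -/

namespace WeylCover

open Finset
open scoped Nat
open RootPairing

section TypeA

variable {ι K V V' : Type*} [Field K] [AddCommGroup V] [Module K V] [AddCommGroup V'] [Module K V']
  {Φ : RootPairing ι K V V'} {b : Φ.Base} {N : ℕ}

/-- The colouring of the coordinates of type `A_N` whose colour goes up by one at the nodes that
are not in `J`. -/
theorem exists_colouring (e : b.support ≃ Fin N) (J : Set b.support) :
    ∃ (r : ℕ) (c : Fin (N + 1) → Fin r), Function.Surjective c ∧ Monotone c ∧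
      ∀ i, (c (e i).succ : ℕ) = c (e i).castSucc + chi b J i := by
  let x (k : ℕ) : ℕ := if h : k < N then chi b J (e.symm ⟨k, h⟩) else 0
  have hx (k : ℕ) : x k ≤ 1 := by
    simp only [x, chi]
    split_ifs <;> omega
  let s (a : ℕ) : ℕ := ∑ k ∈ range a, x k
  have hmono : Monotone s := fun a a' h =>
    sum_le_sum_of_subset (range_subset_range.2 h)
  have hsurj (a k : ℕ) (hk : k ≤ s a) : ∃ a' ≤ a, s a' = k := by
    induction a with
    | zero => exact ⟨0, le_rfl, by simp [s] at hk ⊢; exact hk.symm⟩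
    | succ a ih =>
      have h1 : s (a + 1) = s a + x a := sum_range_succ _ _
      by_cases h2 : k ≤ s a
      · obtain ⟨a', h3, h4⟩ := ih h2
        exact ⟨a', by omega, h4⟩
      · exact ⟨a + 1, le_rfl, by have := hx a; omega⟩
  refine ⟨s N + 1, fun a => ⟨s a, Nat.lt_succ_of_le (hmono (by omega))⟩, fun k => ?_, fun a a' h =>
    hmono h, fun i => ?_⟩
  · obtain ⟨a, ha, hak⟩ := hsurj N k (by omega)
    exact ⟨⟨a, by omega⟩, Fin.ext hak⟩
  · simp [s, sum_range_succ, x]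

variable [CharZero K] [Φ.IsRootSystem] [Φ.IsCrystallographic] {e : b.support ≃ Fin N}
  (he : ∀ i j, b.cartanMatrix i j = CartanMatrix.A N (e i) (e j))
include he

theorem parabolicIsType_cartanBlocks {J : Set b.support} {r : ℕ} {c : Fin (N + 1) → Fin r}
    (hmono : Monotone c) (hc : ∀ i, (c (e i).succ : ℕ) = c (e i).castSucc + chi b J i) :
    ParabolicIsType b J (cartanBlocks fun k => #{a | c a = k}) := by
  have h := sameDynkin_cartanBlocks c hmono (fun j : J => e j)
    (e.injective.comp Subtype.val_injective) (fun a => ?_)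
  · obtain ⟨f, hf⟩ := h
    exact ⟨f, fun i j => by rw [← hf]; exact he _ _⟩
  · obtain ⟨i, rfl⟩ := e.surjective a
    rw [Fin.ext_iff, hc]
    simp [chi]

variable [Finite ι] [Φ.IsReduced] {J : Set b.support}

theorem aP_mul_prod_of_sum_eq {r : ℕ} {m : Fin r → ℕ} (hsum : N + 1 = ∑ k, m k)
    (hJ : ParabolicIsType b J (cartanBlocks m)) (hm : ∀ k, 0 < m k)
    (hodd : {k | Odd (m k)}.ncard ≤ 1) :
    aP b J * ∏ k, (m k / 2)! = ((N + 1) / 2)! := by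
  obtain ⟨r', c, hsurj, hmono, hc⟩ := exists_colouring e J
  obtain ⟨σ, hσ⟩ := exists_perm_of_sameDynkin (m' := m) (m := fun k => #{a | c a = k})
    (fun k => by
      obtain ⟨a, rfl⟩ := hsurj k
      exact card_pos.2 ⟨a, by simp⟩) hm (by
      rw [← hsum, ← card_eq_sum_card_fiberwise (fun a _ => mem_univ (c a)), card_univ,
        Fintype.card_fin]) ((parabolicIsType_cartanBlocks he hmono hc).symm.trans hJ)
  have hodd' : Set.Subsingleton {k | Odd #{a | c a = k}} := by
    intro k hk l hl
    rw [Set.mem_ofPred_eq, ← hσ] at hk hl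
    exact σ.injective ((Set.ncard_le_one_iff (Set.toFinite _)).1 hodd hk hl)
  rw [aP_eq_ncard_palindromes he J c hc, ← ncard_palindromes_mul_prod c hodd', ← σ.prod_comp]
  simp only [hσ]

/-- If `a_P` is not zero, then the sizes of the colour classes have at most one odd member. -/
theorem exists_sizes_of_aP_ne_zero (h0 : aP b J ≠ 0) :
    ∃ (r : ℕ) (m : Fin r → ℕ), ParabolicIsType b J (cartanBlocks m) ∧ (∀ k, 0 < m k) ∧
      N + 1 = ∑ k, m k ∧ {k | Odd (m k)}.ncard ≤ 1 := by
  obtain ⟨r, c, hsurj, hmono, hc⟩ := exists_colouring e J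
  rw [aP_eq_ncard_palindromes he J c hc] at h0
  obtain ⟨z, hσ, hz⟩ := Set.nonempty_of_ncard_ne_zero h0
  refine ⟨r, _, parabolicIsType_cartanBlocks he hmono hc, fun k => ?_, ?_, ?_⟩
  · obtain ⟨a, rfl⟩ := hsurj k
    exact card_pos.2 ⟨a, by simp⟩
  · rw [← card_eq_sum_card_fiberwise (fun a _ => mem_univ (c a)), card_univ, Fintype.card_fin]
  · have h1 := subsingleton_odd_of_palindrome z hz
    simp only [(exists_perm_comp_eq_iff c z).1 hσ] at h1
    exact (Set.ncard_le_one_iff (Set.toFinite _)).2 fun ha hb => h1 ha hb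

end TypeA

section Rows

variable {ι K V V' : Type*} [Field K] [AddCommGroup V] [Module K V] [AddCommGroup V'] [Module K V']
  {Φ : RootPairing ι K V V'} {b : Φ.Base} [CharZero K] [Φ.IsRootSystem] [Φ.IsCrystallographic]
  [Finite ι] [Φ.IsReduced] {J : Set b.support}

theorem nonempty_support [Φ.IsIrreducible] : Nonempty b.support := by
  by_contra h
  rw [not_nonempty_iff] at h
  have := b.toWeightBasis.repr.toEquiv.subsingleton
  have := IsIrreducible.nontrivial Φ
  exact not_subsingleton V ‹_›

theorem aP_of_rowA [Φ.IsIrreducible] {n r : ℕ} {m : Fin r → ℕ} (h : RowA b J n r m) :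
    (aP b J : ℚ) = ((n / 2)! : ℚ) / ∏ i, ((m i / 2)! : ℚ) := by
  obtain ⟨⟨e, he⟩, hJ, hm, hsum, hodd⟩ := h
  obtain ⟨i⟩ := nonempty_support (b := b)
  obtain ⟨N, rfl⟩ : ∃ N, n = N + 1 := ⟨n - 1, by have := (e i).2; omega⟩
  have := aP_mul_prod_of_sum_eq he hsum hJ hm hodd
  rw [eq_div_iff (by positivity)]
  exact_mod_cast this

theorem exists_rowA {N : ℕ} (h : IsType b (CartanMatrix.A N)) (h0 : aP b J ≠ 0) :
    ∃ (n r : ℕ) (m : Fin r → ℕ), RowA b J n r m := by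
  have h' := h
  obtain ⟨e, he⟩ := h
  obtain ⟨r, m, h1, h2, h3, h4⟩ := exists_sizes_of_aP_ne_zero he h0
  exact ⟨N + 1, r, m, h', h1, h2, h3, h4⟩

end Rows

end WeylCover

/-! ### Type `D`: the action on signed words -/

namespace WeylCover

open RootPairing Equiv

section Integral

variable {ι K V V' : Type*} [Field K] [AddCommGroup V] [Module K V] [AddCommGroup V'] [Module K V']
  {Φ : RootPairing ι K V V'} [Φ.IsRootSystem] (b : Φ.Base) [CharZero K] [Φ.IsCrystallographic]
  [Finite ι] [Φ.IsReduced]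

theorem exists_act_eq_intCast (w : Φ.weylGroup) (x : b.support → ℤ) :
    ∃ x' : b.support → ℤ, act b w (fun i => (x i : K)) = fun i => (x' i : K) := by
  obtain ⟨l, rfl⟩ := exists_word b w
  induction l with
  | nil => exact ⟨x, act_one b _⟩
  | cons j l ih =>
    obtain ⟨x', hx'⟩ := ih
    refine ⟨fun i => x' i - b.cartanMatrix i j * x' j, ?_⟩
    rw [List.map_cons, List.prod_cons, act_mul, hx']
    funext i
    rw [act_simpleReflection]
    push_cast
    rfl

/-- The orbit of `chi` consists of integral forms. -/
theorem exists_act_chiK_eq_intCast (J : Set b.support) (w : Φ.weylGroup) :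
    ∃ x' : b.support → ℤ, act b w (chiK b J) = fun i => (x' i : K) := by
  obtain ⟨x', hx'⟩ := exists_act_eq_intCast b w fun i => (chi b J i : ℤ)
  refine ⟨x', ?_⟩
  rw [← hx']
  congr 1
  funext i
  simp [chiK]

end Integral

section TypeD

variable {ι K V V' : Type*} [Field K] [AddCommGroup V] [Module K V] [AddCommGroup V'] [Module K V']
  {Φ : RootPairing ι K V V'} [Φ.IsRootSystem] {b : Φ.Base} [CharZero K] [Φ.IsCrystallographic]
  {r : ℕ}

/-- Change the signs of the coordinates in `S`. -/
def flipSign {n : ℕ} (S : Finset (Fin n)) (y : Fin n → K) : Fin n → K :=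
  fun a => if a ∈ S then -y a else y a

/-- The values on the simple roots of type `D_{r+4}` of the form with coordinates `y`: differences of consecutive coordinates, and the sum of the
last two coordinates. -/
def coordD (e : b.support ≃ Fin (r + 4)) (y : Fin (r + 4) → K) : b.support → K :=
  fun i => Fin.lastCases (motive := fun _ => K)
    (y (Fin.last (r + 2)).castSucc + y (Fin.last (r + 2)).succ)
    (fun a => y a.castSucc - y a.succ) (e i)

variable {e : b.support ≃ Fin (r + 4)}

theorem coordD_last (y : Fin (r + 4) → K) :
    coordD e y (e.symm (Fin.last (r + 3))) =
      y (Fin.last (r + 2)).castSucc + y (Fin.last (r + 2)).succ := by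
  simp [coordD]

theorem coordD_castSucc (y : Fin (r + 4) → K) (a : Fin (r + 3)) :
    coordD e y (e.symm a.castSucc) = y a.castSucc - y a.succ := by
  simp [coordD]

theorem funext_nodes {x y : b.support → K} (e : b.support ≃ Fin (r + 4))
    (hlast : x (e.symm (Fin.last (r + 3))) = y (e.symm (Fin.last (r + 3))))
    (h : ∀ a : Fin (r + 3), x (e.symm a.castSucc) = y (e.symm a.castSucc)) : x = y := by
  funext i
  obtain ⟨a, rfl⟩ := e.symm.surjective i
  exact Fin.lastCases hlast h a

theorem coordD_surjective (x : b.support → K) : ∃ y, coordD e y = x := by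
  obtain ⟨y, hy⟩ := exists_sub_succ_eq fun a : Fin (r + 3) => x (e.symm a.castSucc)
  -- the differences determine the coordinates up to a common shift, which the last node fixes
  set t := (x (e.symm (Fin.last (r + 3))) - y (Fin.last (r + 2)).castSucc -
    y (Fin.last (r + 2)).succ) / 2
  refine ⟨fun a => y a + t, funext_nodes e ?_ fun a => ?_⟩
  · rw [coordD_last]
    simp only [t]
    ring
  · rw [coordD_castSucc, ← hy]
    ring

theorem coordD_injective : Function.Injective (coordD (K := K) e) := by
  intro y z h
  have h1 := sub_eq_of_sub_succ_eq (y := y) (z := z) fun a => by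
    rw [← coordD_castSucc (e := e), h, coordD_castSucc]
  have h2 := congr_fun h (e.symm (Fin.last (r + 3)))
  rw [coordD_last, coordD_last] at h2
  have h3 := h1 (Fin.last (r + 2)).castSucc
  have h4 := h1 (Fin.last (r + 2)).succ
  have h5 : (2 : K) * (y 0 - z 0) = 0 := by linear_combination h2 - h3 - h4
  funext a
  rw [← sub_eq_zero, h1]
  simpa using h5

theorem entryD_eq_pathEntry {a c : ℕ} (ha : a < r + 3) (hc : c < r + 3) :
    entryD r a c = pathEntry a c := by
  simp only [entryD, pathEntry]
  split_ifs <;> first | rfl | omega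

variable (he : ∀ i j, b.cartanMatrix i j = entryD r (e i) (e j))
include he

theorem act_simpleReflection_coordD (c : Fin (r + 3)) (y : Fin (r + 4) → K) :
    act b (simpleReflection b (e.symm c.castSucc)) (coordD e y) =
      coordD e (y ∘ swap c.castSucc c.succ) := by
  refine funext_nodes e ?_ fun a => ?_
  · rw [act_simpleReflection, he, coordD_last, coordD_last, coordD_castSucc, e.apply_symm_apply,
      e.apply_symm_apply, Function.comp_apply, Function.comp_apply, Fin.val_last, Fin.val_castSucc]
    induction c using Fin.lastCases with
    | last =>
      rw [swap_apply_left, swap_apply_right, entryD, if_neg (by simp), if_neg (by simp),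
        if_neg (by simp)]
      push_cast
      ring
    | cast c =>
      have h1 : (Fin.last (r + 2)).succ ≠ c.castSucc.castSucc := by
        rw [Ne, Fin.ext_iff]; simp; omega
      have h2 : (Fin.last (r + 2)).succ ≠ c.castSucc.succ := by
        rw [Ne, Fin.ext_iff]; simp; omega
      rw [swap_apply_of_ne_of_ne h1 h2]
      by_cases hc : (c : ℕ) = r + 1
      · have h3 : (Fin.last (r + 2)).castSucc = c.castSucc.succ := Fin.ext (by simp [hc])
        rw [h3, swap_apply_right, entryD, if_neg (by simp; omega), if_neg (by simp),
          if_pos (by simp [hc])]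
        push_cast
        ring
      · rw [swap_apply_of_ne_of_ne (by rw [Ne, Fin.ext_iff]; simp; omega)
          (by rw [Ne, Fin.ext_iff]; simp; omega), entryD, if_neg (by simp; omega),
          if_neg (by simp), if_neg (by simp; omega)]
        push_cast
        ring
  · rw [act_simpleReflection, he, coordD_castSucc, coordD_castSucc, coordD_castSucc,
      e.apply_symm_apply, e.apply_symm_apply, Fin.val_castSucc, Fin.val_castSucc,
      entryD_eq_pathEntry a.2 c.2]
    exact (sub_succ_comp_swap y a c).symm

theorem act_simpleReflection_last_coordD (y : Fin (r + 4) → K) :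
    act b (simpleReflection b (e.symm (Fin.last (r + 3)))) (coordD e y) =
      coordD e (flipSign {(Fin.last (r + 2)).castSucc, (Fin.last (r + 2)).succ}
        (y ∘ swap (Fin.last (r + 2)).castSucc (Fin.last (r + 2)).succ)) := by
  have hne : (Fin.last (r + 2)).succ ≠ (Fin.last (r + 2)).castSucc := by
    rw [Ne, Fin.ext_iff]; simp
  refine funext_nodes e ?_ fun a => ?_
  · rw [act_simpleReflection, he, coordD_last, coordD_last, entryD, if_pos rfl]
    simp [flipSign]
    ring
  · rw [act_simpleReflection, he, coordD_last, coordD_castSucc, coordD_castSucc,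
      e.apply_symm_apply, e.apply_symm_apply, Fin.val_last, Fin.val_castSucc]
    induction a using Fin.lastCases with
    | last =>
      rw [entryD, if_neg (by simp), if_neg (by simp), if_neg (by simp)]
      simp [flipSign]
      ring
    | cast a =>
      have h1 : a.castSucc.castSucc ≠ (Fin.last (r + 2)).castSucc := by
        rw [Ne, Fin.ext_iff]; simp; omega
      have h2 : a.castSucc.castSucc ≠ (Fin.last (r + 2)).succ := by
        rw [Ne, Fin.ext_iff]; simp; omega
      have h3 : a.castSucc.succ ≠ (Fin.last (r + 2)).succ := by
        rw [Ne, Fin.ext_iff]; simp; omega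
      have h0 : flipSign {(Fin.last (r + 2)).castSucc, (Fin.last (r + 2)).succ}
          (y ∘ swap (Fin.last (r + 2)).castSucc (Fin.last (r + 2)).succ) a.castSucc.castSucc =
          y a.castSucc.castSucc := by
        rw [flipSign, if_neg (by rw [Finset.mem_insert, Finset.mem_singleton]; tauto),
          Function.comp_apply, swap_apply_of_ne_of_ne h1 h2]
      rw [h0]
      by_cases hc : (a : ℕ) = r + 1
      · have h4 : a.castSucc.succ = (Fin.last (r + 2)).castSucc := Fin.ext (by simp [hc])
        rw [h4, flipSign, if_pos (by simp), Function.comp_apply, swap_apply_left, entryD,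
          if_neg (by simp; omega), if_neg (by simp), if_pos (by simp [hc])]
        push_cast
        ring
      · have h4 : a.castSucc.succ ≠ (Fin.last (r + 2)).castSucc := by
          rw [Ne, Fin.ext_iff]; simp; omega
        rw [flipSign, if_neg (by rw [Finset.mem_insert, Finset.mem_singleton]; tauto),
          Function.comp_apply, swap_apply_of_ne_of_ne h4 h3, entryD, if_neg (by simp; omega),
          if_neg (by simp), if_neg (by simp; omega)]
        push_cast
        ring

theorem exists_act_eq_coordD_comp (σ : Perm (Fin (r + 4))) :
    ∃ w, ∀ y : Fin (r + 4) → K, act b w (coordD e y) = coordD e (y ∘ σ) := by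
  have hσ : σ ∈ Submonoid.closure (Set.range fun i : Fin (r + 3) => swap i.castSucc i.succ) := by
    rw [Perm.mclosure_swap_castSucc_succ]
    trivial
  induction hσ using Submonoid.closure_induction with
  | mem σ hσ =>
    obtain ⟨i, rfl⟩ := hσ
    exact ⟨simpleReflection b (e.symm i.castSucc), fun y => act_simpleReflection_coordD he i y⟩
  | one => exact ⟨1, fun y => act_one b _⟩
  | mul σ ρ _ _ hσ hρ =>
    obtain ⟨w, hw⟩ := hσ
    obtain ⟨u, hu⟩ := hρ
    refine ⟨u * w, fun y => ?_⟩
    rw [act_mul, hw, hu]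
    rfl

theorem exists_act_eq_coordD_flipSign_pair {a c : Fin (r + 4)} (hac : a ≠ c) :
    ∃ w, ∀ y : Fin (r + 4) → K, act b w (coordD e y) = coordD e (flipSign {a, c} y) := by
  set p : Fin (r + 4) := (Fin.last (r + 2)).castSucc with hp
  set q : Fin (r + 4) := (Fin.last (r + 2)).succ with hq
  have hpq : p ≠ q := by rw [Ne, Fin.ext_iff]; simp [p, q]
  -- a permutation with `a ↦ p` and `c ↦ q`
  let σ : Perm (Fin (r + 4)) := swap (swap a p c) q * swap a p
  have hσa : σ a = p := by
    simp only [σ, Perm.mul_apply, swap_apply_left]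
    refine swap_apply_of_ne_of_ne (fun h => hac ?_) hpq
    apply (swap a p).injective
    exact (swap_apply_left a p).trans h
  have hσc : σ c = q := by
    simp only [σ, Perm.mul_apply, swap_apply_left]
  obtain ⟨w, hw⟩ := exists_act_eq_coordD_comp (K := K) he σ
  obtain ⟨u, hu⟩ := exists_act_eq_coordD_comp (K := K) he (σ⁻¹ * swap p q)
  refine ⟨w * (simpleReflection b (e.symm (Fin.last (r + 3))) * u), fun y => ?_⟩
  rw [act_mul, act_mul, hu, act_simpleReflection_last_coordD he, hw]
  congr 1
  funext d
  have h1 : σ d = p ↔ d = a := by rw [← hσa]; exact σ.injective.eq_iff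
  have h2 : σ d = q ↔ d = c := by rw [← hσc]; exact σ.injective.eq_iff
  simp only [flipSign, Function.comp_apply, Finset.mem_insert, Finset.mem_singleton, ← hp, ← hq,
    Perm.mul_apply, h1, h2, swap_apply_self, show σ⁻¹ (σ d) = d from σ.symm_apply_apply d]

/-- The Weyl group of type `D` contains all even sign changes. -/
theorem exists_act_eq_coordD_flipSign (S : Finset (Fin (r + 4))) (hS : Even S.card) :
    ∃ w, ∀ y : Fin (r + 4) → K, act b w (coordD e y) = coordD e (flipSign S y) := by
  induction hn : S.card using Nat.strong_induction_on generalizing S with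
  | _ n ih =>
    subst hn
    rcases Finset.eq_empty_or_nonempty S with rfl | ⟨a, ha⟩
    · exact ⟨1, fun y => by
        rw [act_one]
        congr 1⟩
    have h1 : 1 < S.card := by
      have := Finset.card_pos.2 ⟨a, ha⟩
      obtain ⟨k, hk⟩ := hS
      omega
    obtain ⟨c, hc, hca⟩ := Finset.exists_mem_ne h1 a
    have h2 : ((S.erase a).erase c).card + 2 = S.card := by
      rw [Finset.card_erase_of_mem (Finset.mem_erase.2 ⟨hca, hc⟩), Finset.card_erase_of_mem ha]
      omega
    obtain ⟨w, hw⟩ := ih _ (by omega) ((S.erase a).erase c) (by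
      rw [← h2] at hS
      exact (Nat.even_add.1 hS).2 even_two) rfl
    obtain ⟨u, hu⟩ := exists_act_eq_coordD_flipSign_pair (K := K) he hca.symm
    refine ⟨u * w, fun y => ?_⟩
    rw [act_mul, hw, hu]
    congr 1
    funext d
    simp only [flipSign, Finset.mem_insert, Finset.mem_singleton, Finset.mem_erase]
    by_cases h3 : d = a
    · simp [h3, ha, hca.symm]
    by_cases h4 : d = c
    · simp [h4, hc]
    simp [h3, h4]

end TypeD

end WeylCover

/-! ### Type `D`: fixed points of the longest word -/

namespace WeylCover

open RootPairing Equiv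

section TypeD

variable {ι K V V' : Type*} [Field K] [AddCommGroup V] [Module K V] [AddCommGroup V'] [Module K V']
  {Φ : RootPairing ι K V V'} [Φ.IsRootSystem] {b : Φ.Base} [CharZero K] [Φ.IsCrystallographic]
  [Finite ι] [Φ.IsReduced] {r : ℕ} {e : b.support ≃ Fin (r + 4)}
  (he : ∀ i j, b.cartanMatrix i j = entryD r (e i) (e j))
include he

/-- In type `D` of even rank the longest word is `-1`. -/
theorem opposition_eq_of_even (hr : Even r) (i : b.support) : opposition b i = i := by
  classical
  obtain ⟨w, hw⟩ := exists_act_eq_coordD_flipSign (K := K) he Finset.univ (by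
    rw [Finset.card_univ, Fintype.card_fin]
    exact hr.add (by decide))
  have key (x : b.support → K) (i : b.support) : act b w x i = -x i := by
    obtain ⟨y, rfl⟩ := coordD_surjective (e := e) x
    rw [hw]
    have : coordD e (flipSign Finset.univ y) = -coordD e y := by
      refine funext_nodes e ?_ fun a => ?_
      · simp only [Pi.neg_apply, coordD_last, flipSign, Finset.mem_univ, if_true]
        ring
      · simp only [Pi.neg_apply, coordD_castSucc, flipSign, Finset.mem_univ, if_true]
        ring
    rw [this]
    rfl
  have h1 := eq_longestWord_of_act b w id key
  subst h1
  have h2 := act_longestWord b (Pi.single i (1 : K)) i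
  rw [key] at h2
  by_contra hne
  simp [Pi.single_eq_of_ne hne] at h2

/-- In type `D` of odd rank the longest word changes the signs of all but the last coordinate. -/
theorem act_longestWord_coordD (hr : Odd r) (y : Fin (r + 4) → K) :
    act b (longestWord b) (coordD e y) =
      coordD e (flipSign (Finset.univ.erase (Fin.last (r + 3))) y) := by
  obtain ⟨w, hw⟩ := exists_act_eq_coordD_flipSign (K := K) he
    (Finset.univ.erase (Fin.last (r + 3))) (by
      rw [Finset.card_erase_of_mem (Finset.mem_univ _), Finset.card_univ, Fintype.card_fin]
      exact hr.add_odd (by decide))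
  have hflip (y : Fin (r + 4) → K) (a : Fin (r + 3)) :
      flipSign (Finset.univ.erase (Fin.last (r + 3))) y a.castSucc = -y a.castSucc := by
    rw [flipSign, if_pos]
    exact Finset.mem_erase.2 ⟨(Fin.castSucc_lt_last a).ne, Finset.mem_univ _⟩
  have hflip_last (y : Fin (r + 4) → K) :
      flipSign (Finset.univ.erase (Fin.last (r + 3))) y (Fin.last (r + 2)).succ =
        y (Fin.last (r + 2)).succ := by
    rw [flipSign, if_neg]
    simp
  let p : b.support := e.symm (Fin.last (r + 2)).castSucc
  let q : b.support := e.symm (Fin.last (r + 3))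
  have hpq : p ≠ q := e.symm.injective.ne (Fin.castSucc_lt_last _).ne
  have : w = longestWord b := by
    classical
    refine eq_longestWord_of_act b w (swap p q) fun x i => ?_
    obtain ⟨y, rfl⟩ := coordD_surjective (e := e) x
    rw [hw]
    refine congr_fun (funext_nodes e (y := fun i => -coordD e y (swap p q i)) ?_ fun a => ?_) i
    · rw [swap_apply_right, coordD_last, hflip, hflip_last, coordD_castSucc]
      ring
    · induction a using Fin.lastCases with
      | last =>
        rw [swap_apply_left, coordD_castSucc, hflip, hflip_last, coordD_last]
        ring
      | cast a =>
        rw [swap_apply_of_ne_of_ne (e.symm.injective.ne (by rw [Ne, Fin.ext_iff]; simp; omega))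
          (e.symm.injective.ne (by rw [Ne, Fin.ext_iff]; simp; omega)), coordD_castSucc,
          coordD_castSucc, hflip, ← Fin.castSucc_succ, hflip]
        ring
  rw [← this, hw]

theorem act_longestWord_coordD_eq_iff (hr : Odd r) (y : Fin (r + 4) → K) :
    act b (longestWord b) (coordD e y) = coordD e y ↔
      y = Pi.single (Fin.last (r + 3)) (y (Fin.last (r + 3))) := by
  rw [act_longestWord_coordD he hr, coordD_injective.eq_iff]
  constructor
  · intro h
    funext a
    by_cases ha : a = Fin.last (r + 3)
    · subst ha
      simp
    · have := congr_fun h a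
      rw [flipSign, if_pos (Finset.mem_erase.2 ⟨ha, Finset.mem_univ _⟩), neg_eq_self] at this
      rw [Pi.single_eq_of_ne ha, this]
  · intro h
    rw [h]
    funext a
    by_cases ha : a = Fin.last (r + 3)
    · subst ha
      simp [flipSign]
    · simp [flipSign, Pi.single_eq_of_ne ha]

theorem exists_act_coordD_single (a c : Fin (r + 4)) (s : K) :
    ∃ w, act b w (coordD e (Pi.single a s)) = coordD e (Pi.single c s) := by
  obtain ⟨w, hw⟩ := exists_act_eq_coordD_comp (K := K) he (swap a c)
  refine ⟨w, ?_⟩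
  rw [hw]
  congr 1
  funext d
  simp only [Function.comp_apply, Pi.single_apply]
  congr 1
  rw [eq_iff_iff, swap_apply_eq_iff, swap_apply_left]

theorem exists_act_coordD_single_neg (a : Fin (r + 4)) (s : K) :
    ∃ w, act b w (coordD e (Pi.single a s)) = coordD e (Pi.single a (-s)) := by
  obtain ⟨c, hc⟩ := exists_ne a
  obtain ⟨w, hw⟩ := exists_act_eq_coordD_flipSign_pair (K := K) he hc.symm
  refine ⟨w, ?_⟩
  rw [hw]
  congr 1
  funext d
  rcases eq_or_ne d a with rfl | hd
  · simp [flipSign]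
  · simp [flipSign, Pi.single_eq_of_ne hd]

omit he in
theorem coordD_single_zero (s : K) :
    coordD e (Pi.single 0 s) = fun i => if e i = 0 then s else 0 := by
  refine funext_nodes e ?_ fun a => ?_
  · rw [coordD_last, e.apply_symm_apply, if_neg (Fin.last_pos).ne',
      Pi.single_eq_of_ne (by rw [Ne, Fin.ext_iff]; simp),
      Pi.single_eq_of_ne (Fin.succ_ne_zero _), add_zero]
  · rw [coordD_castSucc, e.apply_symm_apply, Pi.single_eq_of_ne (Fin.succ_ne_zero _), sub_zero,
      Pi.single_apply]

omit he in
theorem coordD_single_last (s : K) :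
    coordD e (Pi.single (Fin.last (r + 3)) s) (e.symm (Fin.last (r + 3))) = s := by
  rw [coordD_last, Pi.single_eq_of_ne (Fin.castSucc_lt_last _).ne, zero_add, Fin.succ_last,
    Pi.single_eq_same]

/-- A vector in the orbit of `chi` that is fixed by the longest word is a multiple of the last
coordinate vector; moving it to a dominant vector determines `J`. -/
theorem eq_single_of_fixed (hr : Odd r) {J : Set b.support} (hJ : J ≠ Set.univ) {x : b.support → K}
    (hx : ∃ w, act b w (chiK b J) = x) (hfix : act b (longestWord b) x = x) :
    J = {i | e i ≠ 0} ∧ (x = coordD e (Pi.single (Fin.last (r + 3)) 1) ∨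
      x = coordD e (Pi.single (Fin.last (r + 3)) (-1))) := by
  classical
  obtain ⟨w, hw⟩ := hx
  obtain ⟨x', hx'⟩ := exists_act_chiK_eq_intCast b J w
  rw [hw] at hx'
  obtain ⟨y, rfl⟩ := coordD_surjective (e := e) x
  rw [act_longestWord_coordD_eq_iff he hr] at hfix
  rw [hfix] at hw hx' ⊢
  generalize y (Fin.last (r + 3)) = s at hw hx' ⊢
  obtain ⟨m, rfl⟩ : ∃ m : ℤ, s = m := ⟨x' (e.symm (Fin.last (r + 3))), by
    rw [← coordD_single_last (e := e) s, hx']⟩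
  obtain ⟨u, hu⟩ : ∃ u, act b u (coordD e (Pi.single (Fin.last (r + 3)) (m : K))) =
      coordD e (Pi.single 0 ((m.natAbs : ℕ) : K)) := by
    obtain ⟨u, hu⟩ := exists_act_coordD_single he (Fin.last (r + 3)) 0 (m : K)
    rcases Int.natAbs_eq m with h | h
    · refine ⟨u, ?_⟩
      rw [hu]
      congr 2
      rw [← Int.cast_natCast, ← h]
    · obtain ⟨v, hv⟩ := exists_act_coordD_single_neg he 0 (m : K)
      refine ⟨v * u, ?_⟩
      rw [act_mul, hu, hv]
      congr 2
      rw [← Int.cast_natCast, ← Int.cast_neg]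
      congr 1
      omega
  have hdom := (eq_and_mem_parabolic_of_act_eq b (u * w) (chi b J)
    (fun i => if e i = 0 then m.natAbs else 0) (by
      rw [act_mul]
      change act b u (act b w (chiK b J)) = _
      rw [hw, hu, coordD_single_zero]
      funext i
      split_ifs <;> simp)).1
  have hchi (i : b.support) : (if i ∈ J then 0 else 1) = if e i = 0 then m.natAbs else 0 :=
    congr_fun hdom i
  have h0 : e.symm 0 ∉ J := by
    intro h0
    apply hJ
    have h1 := hchi (e.symm 0)
    rw [if_pos h0, e.apply_symm_apply, if_pos rfl] at h1
    refine Set.eq_univ_of_forall fun i => ?_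
    by_contra hi
    have h2 := hchi i
    rw [if_neg hi, ← h1] at h2
    split_ifs at h2
  have hm : m.natAbs = 1 := by
    have h1 := hchi (e.symm 0)
    rw [if_neg h0, e.apply_symm_apply, if_pos rfl] at h1
    exact h1.symm
  constructor
  · ext i
    have h1 := hchi i
    rw [hm] at h1
    change _ ↔ e i ≠ 0
    by_cases hi : i ∈ J
    · rw [if_pos hi] at h1
      split_ifs at h1 with h2
      exact ⟨fun _ => h2, fun _ => hi⟩
    · rw [if_neg hi] at h1
      split_ifs at h1 with h2
      exact ⟨fun h => absurd h hi, fun h => absurd h2 h⟩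
  · rcases Int.natAbs_eq m with h | h
    · left
      rw [h, hm]
      simp
    · right
      rw [h, hm]
      simp

/-- The two fixed points are the forms with coordinates `(0, …, 0, ±1)`. -/
theorem aP_eq_two (hr : Odd r) : aP b {i | e i ≠ 0} = 2 := by
  have hJ : {i | e i ≠ 0} ≠ (Set.univ : Set b.support) := fun h => by
    have : e.symm 0 ∈ {i | e i ≠ 0} := h ▸ Set.mem_univ _
    simp at this
  have hchi : chiK b {i | e i ≠ 0} = coordD e (Pi.single 0 (1 : K)) := by
    rw [coordD_single_zero]
    funext i
    by_cases hi : e i = 0 <;> simp [chiK, chi, hi]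
  have hfix (s : K) : act b (longestWord b) (coordD e (Pi.single (Fin.last (r + 3)) s)) =
      coordD e (Pi.single (Fin.last (r + 3)) s) := by
    rw [act_longestWord_coordD_eq_iff he hr, Pi.single_eq_same]
  obtain ⟨w, hw⟩ := exists_act_coordD_single he 0 (Fin.last (r + 3)) (1 : K)
  obtain ⟨u, hu⟩ := exists_act_coordD_single_neg he (Fin.last (r + 3)) (1 : K)
  rw [aP_eq_ncard]
  trans Set.ncard {coordD e (Pi.single (Fin.last (r + 3)) (1 : K)),
    coordD e (Pi.single (Fin.last (r + 3)) (-1 : K))}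
  · congr 1
    ext x
    constructor
    · rintro ⟨h1, h2⟩
      exact (eq_single_of_fixed he hr hJ h1 h2).2
    · rintro (rfl | rfl)
      · exact ⟨⟨w, by rw [hchi, hw]⟩, hfix 1⟩
      · exact ⟨⟨u * w, by rw [hchi, act_mul, hw, hu]⟩, hfix (-1)⟩
  · rw [Set.ncard_pair]
    intro h
    have := congr_fun h (e.symm (Fin.last (r + 3)))
    rw [coordD_single_last, coordD_single_last, self_eq_neg] at this
    exact one_ne_zero this

theorem eq_of_aP_ne_zero (hr : Odd r) {J : Set b.support} (hJ : J ≠ Set.univ) (h : aP b J ≠ 0) :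
    J = {i | e i ≠ 0} := by
  rw [aP_eq_ncard] at h
  obtain ⟨x, hx, hfix⟩ := Set.nonempty_of_ncard_ne_zero h
  exact (eq_single_of_fixed he hr hJ hx hfix).1

end TypeD

end WeylCover

/-! ### Type `D`: subdiagrams and the value of `a_P` -/

namespace WeylCover

open RootPairing Equiv

section SubdiagramD

theorem entryD_succ (r i j : ℕ) : entryD (r + 1) (i + 1) (j + 1) = entryD r i j := by
  simp only [entryD]
  split_ifs <;> first | rfl | omega

theorem entryD_eq_neg_one_iff {r i j : ℕ} : entryD r i j = -1 ↔
    (i ≤ r + 2 ∧ j ≤ r + 2 ∧ (i + 1 = j ∨ j + 1 = i)) ∨ (i = r + 1 ∧ j = r + 3) ∨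
      (i = r + 3 ∧ j = r + 1) := by
  simp only [entryD]
  split_ifs <;> constructor <;> intro h <;> first | omega | simp at h

variable {I : Type*} {J : Set I} {r : ℕ} {A : Matrix I I ℤ} {e : I ≃ Fin (r + 5)}
  (he : ∀ i j, A i j = entryD (r + 1) (e i) (e j))
include he

theorem sameDynkin_D_of_eq (hJ : J = {i | e i ≠ 0}) :
    SameDynkin (A.submatrix ((↑) : J → I) ((↑) : J → I)) (CartanMatrix.D (r + 4)) := by
  subst hJ
  let f (a : Fin (r + 4)) : {i | e i ≠ 0} :=
    ⟨e.symm a.succ, by rw [Set.mem_ofPred_eq, e.apply_symm_apply]; exact a.succ_ne_zero⟩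
  have hf : Function.Bijective f := by
    constructor
    · intro a c h
      exact Fin.succ_injective _ (e.symm.injective (congrArg Subtype.val h))
    · rintro ⟨i, hi⟩
      obtain ⟨a, ha⟩ := Fin.exists_succ_eq.2 hi
      exact ⟨a, Subtype.ext (by simp [f, ha])⟩
  refine SameDynkin.symm ⟨Equiv.ofBijective f hf, fun a c => ?_⟩
  change _ = A (e.symm a.succ) (e.symm c.succ)
  rw [he, e.apply_symm_apply, e.apply_symm_apply, Fin.val_succ, Fin.val_succ, entryD_succ,
    cartanD_eq_entryD]

/-- The only subdiagram of type `D_{n-1}` in `D_n` is obtained by removing the end of the long arm: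
it contains the node with three neighbours, and it is connected. -/
theorem eq_of_sameDynkin_D
    (h : SameDynkin (A.submatrix ((↑) : J → I) ((↑) : J → I)) (CartanMatrix.D (r + 4))) :
    J = {i | e i ≠ 0} := by
  obtain ⟨f, hf⟩ := h
  have hcard : J.ncard = r + 4 := by
    rw [← Nat.card_coe_set_eq, Nat.card_congr f, Nat.card_fin]
  have hcardI : Nat.card I = r + 5 := by rw [Nat.card_congr e, Nat.card_fin]
  have : Finite I := Finite.of_equiv _ e.symm
  obtain ⟨i₀, hi₀⟩ : ∃ i, i ∉ J := by
    by_contra! hcon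
    rw [Set.eq_univ_of_forall hcon, Set.ncard_univ] at hcard
    omega
  have hJ : J = {i | i ≠ i₀} := by
    refine Set.eq_of_subset_of_ncard_le (fun i hi => ?_) ?_ (Set.toFinite _)
    · rintro rfl
      exact hi₀ hi
    · have h1 : ({i | i ≠ i₀} : Set I) = {i₀}ᶜ := rfl
      rw [h1, Set.ncard_compl, Set.ncard_singleton]
      omega
  suffices h0 : e i₀ = 0 by
    rw [hJ]
    ext i
    rw [Set.mem_ofPred_eq, Set.mem_ofPred_eq, ← h0, e.injective.ne_iff]
  let g (k : ℕ) : ℕ := if hk : k < r + 4 then e (f.symm ⟨k, hk⟩) else 0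
  have hgA (k l : ℕ) (hk : k < r + 4) (hl : l < r + 4) :
      entryD (r + 1) (g k) (g l) = entryD r k l := by
    simp only [g, dif_pos hk, dif_pos hl]
    rw [← he]
    have := hf (f.symm ⟨k, hk⟩) (f.symm ⟨l, hl⟩)
    rw [f.apply_symm_apply, f.apply_symm_apply, cartanD_eq_entryD] at this
    exact this
  have hg0 (k : ℕ) (hk : k < r + 4) : g k ≠ e i₀ := by
    simp only [g, dif_pos hk]
    intro hcon
    have h1 := e.injective (Fin.ext hcon)
    have h2 := (f.symm ⟨k, hk⟩).2
    rw [h1] at h2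
    exact hi₀ h2
  have hginj (k l : ℕ) (hk : k < r + 4) (hl : l < r + 4) (hkl : k ≠ l) : g k ≠ g l := by
    simp only [g, dif_pos hk, dif_pos hl]
    intro hcon
    have h1 := f.symm.injective (Subtype.ext (e.injective (Fin.ext hcon)))
    exact hkl (congrArg Fin.val h1)
  have hadj (k l : ℕ) (hk : k < r + 4) (hl : l < r + 4) (hkl : entryD r k l = -1) :=
    entryD_eq_neg_one_iff.1 ((hgA k l hk hl).trans hkl)
  -- the node with three neighbours
  have hfork : g (r + 1) = r + 2 ∧ (e i₀ : ℕ) ≤ r := by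
    have h1 := hadj (r + 1) r (by omega) (by omega) (entryD_eq_neg_one_iff.2 (by omega))
    have h2 := hadj (r + 1) (r + 2) (by omega) (by omega) (entryD_eq_neg_one_iff.2 (by omega))
    have h3 := hadj (r + 1) (r + 3) (by omega) (by omega) (entryD_eq_neg_one_iff.2 (by omega))
    have h4 := hginj r (r + 2) (by omega) (by omega) (by omega)
    have h5 := hginj r (r + 3) (by omega) (by omega) (by omega)
    have h6 := hginj (r + 2) (r + 3) (by omega) (by omega) (by omega)
    have h7 := hg0 r (by omega)
    have h8 := hg0 (r + 1) (by omega)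
    have h9 := hg0 (r + 2) (by omega)
    have h10 := hg0 (r + 3) (by omega)
    have h11 := (e i₀).2
    omega
  have hside (k l : ℕ) (hk : k < r + 4) (hl : l < r + 4) (hkl : entryD r k l = -1) :
      g k < e i₀ ↔ g l < e i₀ := by
    have h1 := hadj k l hk hl hkl
    have h2 := hg0 k hk
    have h3 := hg0 l hl
    omega
  have hpath (k : ℕ) (hk : k ≤ r + 2) : g k < e i₀ ↔ g 0 < e i₀ := by
    induction k with
    | zero => rfl
    | succ k ih =>
      rw [← ih (by omega)]
      exact hside _ _ (by omega) (by omega) (entryD_eq_neg_one_iff.2 (by omega))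
  have hall (k : ℕ) (hk : k < r + 4) : g k < e i₀ ↔ g 0 < e i₀ := by
    by_cases hk' : k = r + 3
    · rw [← hpath (r + 1) (by omega), hk']
      exact hside _ _ (by omega) (by omega) (entryD_eq_neg_one_iff.2 (by omega))
    · exact hpath k (by omega)
  by_contra hne
  have hmem : e.symm 0 ∈ J := by
    rw [hJ]
    rintro rfl
    exact hne (e.apply_symm_apply 0)
  have h1 : g (f ⟨_, hmem⟩) = 0 := by
    simp [g]
  have h2 := (hall (f ⟨_, hmem⟩) (f ⟨_, hmem⟩).2).trans (hall (r + 1) (by omega)).symm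
  rw [h1, hfork.1] at h2
  have h3 : (e i₀ : ℕ) ≠ 0 := fun h => hne (Fin.ext h)
  have := hfork.2
  omega

end SubdiagramD

section Rows

variable {ι K V V' : Type*} [Field K] [AddCommGroup V] [Module K V] [AddCommGroup V'] [Module K V']
  {Φ : RootPairing ι K V V'} {b : Φ.Base} [CharZero K] [Φ.IsRootSystem] [Φ.IsCrystallographic]
  [Finite ι] [Φ.IsReduced] {J : Set b.support}

theorem exists_equiv_entryD {r : ℕ} (h : IsType b (CartanMatrix.D (r + 4))) :
    ∃ e : b.support ≃ Fin (r + 4), ∀ i j, b.cartanMatrix i j = entryD r (e i) (e j) := by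
  obtain ⟨e, he⟩ := h
  exact ⟨e, fun i j => by rw [he, cartanD_eq_entryD]⟩

theorem aP_of_rowD {n : ℕ} (h : RowD b J n) : aP b J = 2 := by
  obtain ⟨hn, h1, h2⟩ := h
  obtain ⟨k, rfl⟩ := Nat.exists_eq_add_of_le' hn
  obtain ⟨e, he⟩ := exists_equiv_entryD (r := 2 * k + 1) h1
  have hJ := eq_of_sameDynkin_D (r := 2 * k) he h2
  rw [hJ]
  exact aP_eq_two he ⟨k, rfl⟩

theorem exists_rowD {n : ℕ} (hn : 4 ≤ n) (h : IsType b (CartanMatrix.D n))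
    (hopp : ∃ i, opposition b i ≠ i) (hJ : J ≠ Set.univ) (h0 : aP b J ≠ 0) :
    ∃ n, RowD b J n := by
  obtain ⟨r, rfl⟩ := Nat.exists_eq_add_of_le' hn
  obtain ⟨e, he⟩ := exists_equiv_entryD h
  have hr : Odd r := by
    rw [← Nat.not_even_iff_odd]
    intro hr
    obtain ⟨i, hi⟩ := hopp
    exact hi (opposition_eq_of_even he hr i)
  have hJ' := eq_of_aP_ne_zero he hr hJ h0
  obtain ⟨k, rfl⟩ := hr
  exact ⟨k + 2, by omega, h, sameDynkin_D_of_eq (r := 2 * k) he hJ'⟩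

end Rows

end WeylCover

/-! ### Type `E₆`: fixed points of the longest word -/

namespace WeylCover

open RootPairing Equiv

section TypeE

/-- The entries of the Cartan matrix of type `E₆`. -/
def entryE : Fin 6 → Fin 6 → ℤ :=
  ![![2, 0, -1, 0, 0, 0], ![0, 2, 0, -1, 0, 0], ![-1, 0, 2, -1, 0, 0], ![0, -1, -1, 2, -1, 0],
    ![0, 0, 0, -1, 2, -1], ![0, 0, 0, 0, -1, 2]]

theorem cartanE_eq_entryE (i j : Fin 6) : CartanMatrix.E₆ i j = entryE i j := by
  fin_cases i <;> fin_cases j <;> decide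

variable {ι K V V' : Type*} [Field K] [AddCommGroup V] [Module K V] [AddCommGroup V'] [Module K V']
  {Φ : RootPairing ι K V V'} [Φ.IsRootSystem] {b : Φ.Base} [CharZero K] [Φ.IsCrystallographic]

/-- A simple reflection of type `E₆` in the coordinates given by the values on the simple roots. -/
def reflE (j : Fin 6) (p : Fin 6 → K) : Fin 6 → K := fun i => p i - (entryE i j : K) * p j

theorem vec_ext {a₀ a₁ a₂ a₃ a₄ a₅ c₀ c₁ c₂ c₃ c₄ c₅ : K} (h₀ : a₀ = c₀) (h₁ : a₁ = c₁)
    (h₂ : a₂ = c₂) (h₃ : a₃ = c₃) (h₄ : a₄ = c₄) (h₅ : a₅ = c₅) :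
    ![a₀, a₁, a₂, a₃, a₄, a₅] = ![c₀, c₁, c₂, c₃, c₄, c₅] := by
  rw [h₀, h₁, h₂, h₃, h₄, h₅]

section Reflections

variable (x₀ x₁ x₂ x₃ x₄ x₅ : K)

theorem reflE_zero : reflE 0 ![x₀, x₁, x₂, x₃, x₄, x₅] = ![-x₀, x₁, x₂ + x₀, x₃, x₄, x₅] := by
  funext i; fin_cases i <;> simp [reflE, entryE]; ring

theorem reflE_one : reflE 1 ![x₀, x₁, x₂, x₃, x₄, x₅] = ![x₀, -x₁, x₂, x₃ + x₁, x₄, x₅] := by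
  funext i; fin_cases i <;> simp [reflE, entryE]; ring

theorem reflE_two : reflE 2 ![x₀, x₁, x₂, x₃, x₄, x₅] =
    ![x₀ + x₂, x₁, -x₂, x₃ + x₂, x₄, x₅] := by
  funext i; fin_cases i <;> simp [reflE, entryE]; ring

theorem reflE_three : reflE 3 ![x₀, x₁, x₂, x₃, x₄, x₅] =
    ![x₀, x₁ + x₃, x₂ + x₃, -x₃, x₄ + x₃, x₅] := by
  funext i; fin_cases i <;> simp [reflE, entryE]; ring

theorem reflE_four : reflE 4 ![x₀, x₁, x₂, x₃, x₄, x₅] =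
    ![x₀, x₁, x₂, x₃ + x₄, -x₄, x₅ + x₄] := by
  funext i; fin_cases i <;> simp [reflE, entryE]; ring

theorem reflE_five : reflE 5 ![x₀, x₁, x₂, x₃, x₄, x₅] = ![x₀, x₁, x₂, x₃, x₄ + x₅, -x₅] := by
  funext i; fin_cases i <;> simp [reflE, entryE]; ring

/-- A word for the square of the Coxeter element of type `E₆` that is the product of the simple
reflections of each of the two colours of the diagram. -/
def coxeterSqE : List (Fin 6) := [0, 3, 5, 1, 2, 4, 0, 3, 5, 1, 2, 4]

theorem foldr_coxeterSqE : coxeterSqE.foldr reflE ![x₀, x₁, x₂, x₃, x₄, x₅] =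
    ![-x₁ - x₃ - x₄, x₀ + x₁ + x₂ + x₃ + x₄ + x₅, x₁ + x₂ + 2 * x₃ + 2 * x₄ + x₅,
      -x₀ - x₁ - 2 * x₂ - 2 * x₃ - 2 * x₄ - x₅, x₀ + x₁ + 2 * x₂ + 2 * x₃ + x₄,
      -x₁ - x₂ - x₃] := by
  simp only [coxeterSqE, List.foldr, reflE_zero, reflE_one, reflE_two, reflE_three, reflE_four,
    reflE_five]
  refine vec_ext ?_ ?_ ?_ ?_ ?_ ?_ <;> ring

/-- The sixth power of a Coxeter element of type `E₆` maps simple roots to negatives of simple roots;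
half the Coxeter number is `6`. -/
theorem foldr_coxeterE_pow_six :
    (coxeterSqE ++ coxeterSqE ++ coxeterSqE).foldr reflE ![x₀, x₁, x₂, x₃, x₄, x₅] =
    ![-x₅, -x₁, -x₄, -x₃, -x₂, -x₀] := by
  rw [List.foldr_append, List.foldr_append, foldr_coxeterSqE, foldr_coxeterSqE, foldr_coxeterSqE]
  refine vec_ext ?_ ?_ ?_ ?_ ?_ ?_ <;> ring

/-- This element maps the vectors fixed by the longest word to the span of the two ends of the path
of length five. -/
theorem foldr_reflE_fixed (s t : K) :
    [5, 4, 3, 0, 2, 1, 3, 4, 5, 1, 3, 4].foldr reflE ![t, 0, s, 0, -s, -t] =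
      ![s, 0, 0, 0, 0, t] := by
  simp only [List.foldr, reflE_zero, reflE_one, reflE_two, reflE_three, reflE_four, reflE_five]
  refine vec_ext ?_ ?_ ?_ ?_ ?_ ?_ <;> ring

/-- The next two elements induce on the span of the two ends the simple reflections of type `A₂`. -/
theorem foldr_reflE_left (s t : K) :
    [0, 2, 3, 4, 1, 3, 2, 0].foldr reflE ![s, 0, 0, 0, 0, t] = ![-s, 0, 0, 0, 0, s + t] := by
  simp only [List.foldr, reflE_zero, reflE_one, reflE_two, reflE_three, reflE_four]
  refine vec_ext ?_ ?_ ?_ ?_ ?_ ?_ <;> ring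

theorem foldr_reflE_right (s t : K) :
    [5, 4, 3, 2, 1, 3, 4, 5].foldr reflE ![s, 0, 0, 0, 0, t] = ![s + t, 0, 0, 0, 0, -t] := by
  simp only [List.foldr, reflE_one, reflE_two, reflE_three, reflE_four, reflE_five]
  refine vec_ext ?_ ?_ ?_ ?_ ?_ ?_ <;> ring

end Reflections

/-- The orbit of a weight of type `A₂`, in the coordinates given by the fundamental weights. -/
def orbitA (s t : ℤ) : Finset (ℤ × ℤ) :=
  {(s, t), (-s, s + t), (s + t, -t), (t, -s - t), (-s - t, s), (-t, -s)}

theorem exists_mem_orbitA (s t : ℤ) : ∃ s' t' : ℕ, (s, t) ∈ orbitA s' t' := by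
  simp only [orbitA, Finset.mem_insert, Finset.mem_singleton, Prod.mk.injEq]
  by_cases hs : 0 ≤ s <;> by_cases ht : 0 ≤ t <;> by_cases hst : 0 ≤ s + t
  · exact ⟨s.toNat, t.toNat, by omega⟩
  · exact ⟨s.toNat, t.toNat, by omega⟩
  · exact ⟨(s + t).toNat, (-t).toNat, by omega⟩
  · exact ⟨(-s - t).toNat, s.toNat, by omega⟩
  · exact ⟨(-s).toNat, (s + t).toNat, by omega⟩
  · exact ⟨t.toNat, (-s - t).toNat, by omega⟩
  · omega
  · exact ⟨(-t).toNat, (-s).toNat, by omega⟩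

variable {e : b.support ≃ Fin 6} (he : ∀ i j, b.cartanMatrix i j = entryE (e i) (e j))
include he

theorem exists_act_eq_foldr (l : List (Fin 6)) :
    ∃ w, ∀ p : Fin 6 → K, act b w (p ∘ e) = l.foldr reflE p ∘ e := by
  induction l with
  | nil => exact ⟨1, fun p => act_one b _⟩
  | cons j l ih =>
    obtain ⟨w, hw⟩ := ih
    refine ⟨simpleReflection b (e.symm j) * w, fun p => ?_⟩
    rw [act_mul, hw]
    funext i
    rw [act_simpleReflection, he, e.apply_symm_apply]
    simp [reflE]

theorem exists_act_of_mem_orbitA {s t s' t' : ℤ} (h : (s, t) ∈ orbitA s' t') :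
    ∃ w, act b w (![(s' : K), 0, 0, 0, 0, (t' : K)] ∘ e) = ![(s : K), 0, 0, 0, 0, (t : K)] ∘ e := by
  obtain ⟨u, hu⟩ := exists_act_eq_foldr (K := K) he [0, 2, 3, 4, 1, 3, 2, 0]
  obtain ⟨v, hv⟩ := exists_act_eq_foldr (K := K) he [5, 4, 3, 2, 1, 3, 4, 5]
  have hu' (s t : K) := (hu ![s, 0, 0, 0, 0, t]).trans (by rw [foldr_reflE_left])
  have hv' (s t : K) := (hv ![s, 0, 0, 0, 0, t]).trans (by rw [foldr_reflE_right])
  simp only [orbitA, Finset.mem_insert, Finset.mem_singleton, Prod.mk.injEq] at h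
  rcases h with ⟨rfl, rfl⟩ | ⟨rfl, rfl⟩ | ⟨rfl, rfl⟩ | ⟨rfl, rfl⟩ | ⟨rfl, rfl⟩ | ⟨rfl, rfl⟩
  · exact ⟨1, act_one b _⟩
  · refine ⟨u, ?_⟩
    rw [hu']
    push_cast
    rfl
  · refine ⟨v, ?_⟩
    rw [hv']
    push_cast
    rfl
  · refine ⟨v * u, ?_⟩
    rw [act_mul, hu', hv']
    congr 1
    refine vec_ext ?_ rfl rfl rfl rfl ?_ <;> push_cast <;> ring
  · refine ⟨u * v, ?_⟩
    rw [act_mul, hv', hu']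
    congr 1
    refine vec_ext ?_ rfl rfl rfl rfl ?_ <;> push_cast <;> ring
  · refine ⟨u * (v * u), ?_⟩
    rw [act_mul, act_mul, hu', hv', hu']
    congr 1
    refine vec_ext ?_ rfl rfl rfl rfl ?_ <;> push_cast <;> ring

variable [Finite ι] [Φ.IsReduced]

theorem act_longestWord_vec (x₀ x₁ x₂ x₃ x₄ x₅ : K) :
    act b (longestWord b) (![x₀, x₁, x₂, x₃, x₄, x₅] ∘ e) =
      ![-x₅, -x₁, -x₄, -x₃, -x₂, -x₀] ∘ e := by
  obtain ⟨w, hw⟩ := exists_act_eq_foldr (K := K) he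
    (coxeterSqE ++ coxeterSqE ++ coxeterSqE)
  have hw' (x₀ x₁ x₂ x₃ x₄ x₅ : K) := (hw ![x₀, x₁, x₂, x₃, x₄, x₅]).trans
    (by rw [foldr_coxeterE_pow_six])
  have : w = longestWord b := by
    refine eq_longestWord_of_act b w
      (fun i => e.symm ((![5, 1, 4, 3, 2, 0] : Fin 6 → Fin 6) (e i))) fun x i => ?_
    obtain ⟨p, rfl⟩ : ∃ p : Fin 6 → K, x = p ∘ e := ⟨x ∘ e.symm, by
      funext i; simp⟩
    have hp : p = ![p 0, p 1, p 2, p 3, p 4, p 5] := by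
      funext j; fin_cases j <;> rfl
    rw [hp, hw', Function.comp_apply, Function.comp_apply, e.apply_symm_apply]
    generalize e i = j
    fin_cases j <;> rfl
  rw [← this, hw']

/-- An integral vector fixed by the longest word can be moved to the span of the two ends of the
path, on which the Weyl group induces the Weyl group of type `A₂`. -/
theorem exists_eq_vec_of_fixed {x : b.support → ℤ}
    (hfix : act b (longestWord b) (fun i => (x i : K)) = fun i => (x i : K)) :
    ∃ s t : ℤ, (fun i => (x i : K)) = ![(t : K), 0, (s : K), 0, -(s : K), -(t : K)] ∘ e := by
  have hx : (fun i => (x i : K)) = ![(x (e.symm 0) : K), (x (e.symm 1) : K), (x (e.symm 2) : K),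
      (x (e.symm 3) : K), (x (e.symm 4) : K), (x (e.symm 5) : K)] ∘ e := by
    funext i
    obtain ⟨a, rfl⟩ := e.symm.surjective i
    rw [Function.comp_apply, e.apply_symm_apply]
    fin_cases a <;> rfl
  refine ⟨x (e.symm 2), x (e.symm 0), ?_⟩
  rw [hx, act_longestWord_vec he] at hfix
  have hfix' (a : Fin 6) := congr_fun hfix (e.symm a)
  simp only [Function.comp_apply, e.apply_symm_apply] at hfix'
  have h0 : -(x (e.symm 5) : K) = x (e.symm 0) := hfix' 0
  have h1 : -(x (e.symm 1) : K) = x (e.symm 1) := hfix' 1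
  have h2 : -(x (e.symm 4) : K) = x (e.symm 2) := hfix' 2
  have h3 : -(x (e.symm 3) : K) = x (e.symm 3) := hfix' 3
  rw [neg_eq_self] at h1 h3
  rw [hx]
  congr 1
  refine vec_ext rfl h1 rfl h3 ?_ ?_
  · rw [← h2, neg_neg]
  · rw [← h0, neg_neg]

theorem act_longestWord_fixed (s t : K) :
    act b (longestWord b) (![t, 0, s, 0, -s, -t] ∘ e) = ![t, 0, s, 0, -s, -t] ∘ e := by
  rw [act_longestWord_vec he]
  congr 1
  refine vec_ext ?_ ?_ ?_ ?_ ?_ ?_ <;> ring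

theorem exists_chi_eq_of_fixed {J : Set b.support} {x : b.support → K}
    (hx : ∃ w, act b w (chiK b J) = x) (hfix : act b (longestWord b) x = x) :
    ∃ (s t : ℤ) (s' t' : ℕ), x = ![(t : K), 0, (s : K), 0, -(s : K), -(t : K)] ∘ e ∧
      (s, t) ∈ orbitA s' t' ∧ chi b J = ![s', 0, 0, 0, 0, t'] ∘ e := by
  obtain ⟨w, hw⟩ := hx
  obtain ⟨x', hx'⟩ := exists_act_chiK_eq_intCast b J w
  rw [hw] at hx'
  rw [hx'] at hfix
  obtain ⟨s, t, hst⟩ := exists_eq_vec_of_fixed he hfix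
  obtain ⟨s', t', h⟩ := exists_mem_orbitA s t
  refine ⟨s, t, s', t', hx'.trans hst, h, ?_⟩
  obtain ⟨u, hu⟩ := exists_act_of_mem_orbitA (K := K) he h
  obtain ⟨v, hv⟩ := exists_act_eq_foldr (K := K) he [5, 4, 3, 0, 2, 1, 3, 4, 5, 1, 3, 4]
  refine (eq_and_mem_parabolic_of_act_eq b (u⁻¹ * v * w) (chi b J) (![s', 0, 0, 0, 0, t'] ∘ e) ?_).1
  rw [act_mul, act_mul]
  change act b u⁻¹ (act b v (act b w (chiK b J))) = _
  rw [hw, hx', hst, hv, foldr_reflE_fixed, ← hu, act_inv_act]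
  funext i
  simp only [Function.comp_apply]
  generalize e i = j
  fin_cases j <;> simp

theorem aP_eq_card_orbitA {J : Set b.support} {s' t' : ℕ}
    (hJ : chi b J = ![s', 0, 0, 0, 0, t'] ∘ e) : aP b J = (orbitA s' t').card := by
  let f (x : ℤ × ℤ) : b.support → K :=
    ![(x.2 : K), 0, (x.1 : K), 0, -(x.1 : K), -(x.2 : K)] ∘ e
  have hf : Function.Injective f := by
    intro x y h
    have h0 := congr_fun h (e.symm 0)
    have h2 := congr_fun h (e.symm 2)
    simp only [f, Function.comp_apply, e.apply_symm_apply] at h0 h2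
    exact Prod.ext (Int.cast_injective h2) (Int.cast_injective h0)
  have hchi : chiK b J = ![((s' : ℤ) : K), 0, 0, 0, 0, ((t' : ℤ) : K)] ∘ e := by
    funext i
    simp only [chiK, hJ, Function.comp_apply]
    generalize e i = j
    fin_cases j <;> simp
  rw [aP_eq_ncard, ← Set.ncard_coe_finset, ← Set.ncard_image_of_injective _ hf]
  congr 1
  ext x
  constructor
  · rintro ⟨h1, h2⟩
    obtain ⟨s, t, s'', t'', hx, hst, hJ'⟩ := exists_chi_eq_of_fixed he h1 h2
    rw [hJ] at hJ'
    have h0 := congr_fun hJ' (e.symm 0)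
    have h5 := congr_fun hJ' (e.symm 5)
    simp only [Function.comp_apply, e.apply_symm_apply] at h0 h5
    have h0' : s' = s'' := h0
    have h5' : t' = t'' := h5
    subst h0' h5'
    exact ⟨(s, t), hst, hx.symm⟩
  · rintro ⟨⟨s, t⟩, hst, rfl⟩
    obtain ⟨u, hu⟩ := exists_act_of_mem_orbitA (K := K) he (Finset.mem_coe.1 hst)
    obtain ⟨v, hv⟩ := exists_act_eq_foldr (K := K) he [5, 4, 3, 0, 2, 1, 3, 4, 5, 1, 3, 4]
    refine ⟨⟨v⁻¹ * u, ?_⟩, act_longestWord_fixed he _ _⟩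
    rw [act_mul, hchi, hu, ← foldr_reflE_fixed, ← hv, act_inv_act]

end TypeE

end WeylCover

/-! ### Type `E₆`: subdiagrams and the value of `a_P` -/

namespace WeylCover

open RootPairing Equiv

section SubdiagramE

variable {ι K V V' : Type*} [Field K] [AddCommGroup V] [Module K V] [AddCommGroup V'] [Module K V']
  {Φ : RootPairing ι K V V'} [Φ.IsRootSystem] {b : Φ.Base} [CharZero K] [Φ.IsCrystallographic]
  {J : Set b.support}

theorem mem_iff_chi_eq_zero (i : b.support) : i ∈ J ↔ chi b J i = 0 := by
  by_cases hi : i ∈ J <;> simp [chi, hi]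

theorem chi_le_one (i : b.support) : chi b J i ≤ 1 := by
  rw [chi]
  split_ifs <;> omega

/-- A node of `E₆` with three neighbours, and these neighbours, are all the nodes but the two ends
of the path of length five. -/
theorem entryE_fork : ∀ a p q s : Fin 6, entryE a p = -1 → entryE a q = -1 → entryE a s = -1 →
    p ≠ q → p ≠ s → q ≠ s → ∀ d, d = 0 ∨ d = 5 ∨ d = a ∨ d = p ∨ d = q ∨ d = s := by
  decide

variable {e : b.support ≃ Fin 6} (he : ∀ i j, b.cartanMatrix i j = entryE (e i) (e j))
include he

/-- A subdiagram of type `D₄` or `D₅` of `E₆` contains the branch node and its neighbours. -/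
theorem chi_eq_of_parabolicIsType_D {r : ℕ} (h : ParabolicIsType b J (CartanMatrix.D (r + 4))) :
    ∃ s t : ℕ, s ≤ 1 ∧ t ≤ 1 ∧ s + t + r = 2 ∧ chi b J = ![s, 0, 0, 0, 0, t] ∘ e := by
  classical
  obtain ⟨f, hf⟩ := h
  have : Fintype b.support := Fintype.ofEquiv _ e.symm
  let g (k : Fin (r + 4)) : Fin 6 := e (f.symm k)
  have hg : Function.Injective g := e.injective.comp (Subtype.val_injective.comp f.symm.injective)
  have hgJ (k) : e.symm (g k) ∈ J := by
    simp only [g, e.symm_apply_apply]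
    exact (f.symm k).2
  have hgA (k l : Fin (r + 4)) : entryE (g k) (g l) = entryD r k l := by
    rw [← he]
    have := hf (f.symm k) (f.symm l)
    rw [f.apply_symm_apply, f.apply_symm_apply, cartanD_eq_entryD] at this
    exact this
  let c : Fin (r + 4) := ⟨r + 1, by omega⟩
  let n₁ : Fin (r + 4) := ⟨r, by omega⟩
  let n₂ : Fin (r + 4) := ⟨r + 2, by omega⟩
  let n₃ : Fin (r + 4) := ⟨r + 3, by omega⟩
  have hmem (d : Fin 6) (h0 : d ≠ 0) (h5 : d ≠ 5) : e.symm d ∈ J := by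
    rcases entryE_fork (g c) (g n₁) (g n₂) (g n₃)
      ((hgA _ _).trans (entryD_eq_neg_one_iff.2 (by simp [c, n₁])))
      ((hgA _ _).trans (entryD_eq_neg_one_iff.2 (by simp [c, n₂])))
      ((hgA _ _).trans (entryD_eq_neg_one_iff.2 (by simp [c, n₃])))
      (hg.ne (by simp [n₁, n₂])) (hg.ne (by simp [n₁, n₃])) (hg.ne (by simp [n₂, n₃])) d
      with h | h | h | h | h | h
    · exact absurd h h0
    · exact absurd h h5
    all_goals
      rw [h]
      exact hgJ _
  have hchi : chi b J = ![chi b J (e.symm 0), 0, 0, 0, 0, chi b J (e.symm 5)] ∘ e := by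
    funext i
    obtain ⟨a, rfl⟩ := e.symm.surjective i
    rw [Function.comp_apply, e.apply_symm_apply]
    fin_cases a
    · rfl
    · exact (mem_iff_chi_eq_zero _).1 (hmem 1 (by decide) (by decide))
    · exact (mem_iff_chi_eq_zero _).1 (hmem 2 (by decide) (by decide))
    · exact (mem_iff_chi_eq_zero _).1 (hmem 3 (by decide) (by decide))
    · exact (mem_iff_chi_eq_zero _).1 (hmem 4 (by decide) (by decide))
    · rfl
  refine ⟨_, _, chi_le_one _, chi_le_one _, ?_, hchi⟩
  have hcard : J.ncard = r + 4 := by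
    rw [← Nat.card_coe_set_eq, Nat.card_congr f, Nat.card_fin]
  have hcompl := Set.ncard_add_ncard_compl J (Set.toFinite _) (Set.toFinite _)
  rw [hcard, Nat.card_congr e, Nat.card_fin] at hcompl
  have hsum : ∑ i, chi b J i = Jᶜ.ncard := by
    have (i : b.support) : chi b J i = if i ∈ Jᶜ then 1 else 0 := by
      by_cases hi : i ∈ J <;> simp [chi, hi]
    simp only [this]
    rw [← Finset.card_filter, Set.ncard_eq_toFinset_card']
    congr 1
    ext i
    simp
  rw [hchi] at hsum
  have h2 := e.sum_comp ![chi b J (e.symm 0), 0, 0, 0, 0, chi b J (e.symm 5)]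
  rw [Fin.sum_univ_six] at h2
  simp only [Function.comp_apply] at hsum
  rw [h2] at hsum
  simp at hsum
  omega

theorem parabolicIsType_of_range {n : ℕ} {C : Matrix (Fin n) (Fin n) ℤ} (g : Fin n → Fin 6)
    (hg : Function.Injective g) (hJ : ∀ i, i ∈ J ↔ ∃ k, g k = e i)
    (hC : ∀ k l, C k l = entryE (g k) (g l)) : ParabolicIsType b J C := by
  let f (k : Fin n) : J := ⟨e.symm (g k), (hJ _).2 ⟨k, by simp⟩⟩
  have hf : Function.Bijective f := by
    constructor
    · intro k l h
      exact hg (e.symm.injective (congrArg Subtype.val h))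
    · rintro ⟨i, hi⟩
      obtain ⟨k, hk⟩ := (hJ i).1 hi
      exact ⟨k, Subtype.ext (by simp [f, hk])⟩
  refine SameDynkin.symm ⟨Equiv.ofBijective f hf, fun k l => ?_⟩
  change _ = b.cartanMatrix (e.symm (g k)) (e.symm (g l))
  rw [he, e.apply_symm_apply, e.apply_symm_apply, hC]

end SubdiagramE

section Rows

variable {ι K V V' : Type*} [Field K] [AddCommGroup V] [Module K V] [AddCommGroup V'] [Module K V']
  {Φ : RootPairing ι K V V'} {b : Φ.Base} [CharZero K] [Φ.IsRootSystem] [Φ.IsCrystallographic]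
  [Finite ι] [Φ.IsReduced] {J : Set b.support}

theorem exists_equiv_entryE (h : IsType b CartanMatrix.E₆) :
    ∃ e : b.support ≃ Fin 6, ∀ i j, b.cartanMatrix i j = entryE (e i) (e j) := by
  obtain ⟨e, he⟩ := h
  exact ⟨e, fun i j => by rw [he, cartanE_eq_entryE]⟩

theorem aP_of_rowE6D5 (h : RowE6D5 b J) : aP b J = 3 := by
  obtain ⟨h1, h2⟩ := h
  obtain ⟨e, he⟩ := exists_equiv_entryE h1
  obtain ⟨s, t, hs, ht, hst, hJ⟩ := chi_eq_of_parabolicIsType_D (r := 1) he h2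
  rw [aP_eq_card_orbitA he hJ]
  obtain ⟨rfl, rfl⟩ | ⟨rfl, rfl⟩ : s = 1 ∧ t = 0 ∨ s = 0 ∧ t = 1 := by omega
  all_goals decide

theorem aP_of_rowE6D4 (h : RowE6D4 b J) : aP b J = 6 := by
  obtain ⟨h1, h2⟩ := h
  obtain ⟨e, he⟩ := exists_equiv_entryE h1
  obtain ⟨s, t, hs, ht, hst, hJ⟩ := chi_eq_of_parabolicIsType_D (r := 0) he h2
  rw [aP_eq_card_orbitA he hJ]
  obtain ⟨rfl, rfl⟩ : s = 1 ∧ t = 1 := by omega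
  decide

theorem rowE6_of_aP_ne_zero (h : IsType b CartanMatrix.E₆) (hJ : J ≠ Set.univ)
    (h0 : aP b J ≠ 0) : RowE6D5 b J ∨ RowE6D4 b J := by
  have h' := h
  obtain ⟨e, he⟩ := exists_equiv_entryE h
  rw [aP_eq_ncard] at h0
  obtain ⟨x, hx, hfix⟩ := Set.nonempty_of_ncard_ne_zero h0
  obtain ⟨-, -, s, t, -, -, hchi⟩ := exists_chi_eq_of_fixed he hx hfix
  have hs : s ≤ 1 := by
    have h1 := congr_fun hchi (e.symm 0)
    rw [Function.comp_apply, e.apply_symm_apply] at h1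
    exact h1.symm.trans_le (chi_le_one _)
  have ht : t ≤ 1 := by
    have h1 := congr_fun hchi (e.symm 5)
    rw [Function.comp_apply, e.apply_symm_apply] at h1
    exact h1.symm.trans_le (chi_le_one _)
  have hmem (i : b.support) : i ∈ J ↔ (![s, 0, 0, 0, 0, t] : Fin 6 → ℕ) (e i) = 0 := by
    rw [mem_iff_chi_eq_zero, hchi, Function.comp_apply]
  obtain ⟨rfl, rfl⟩ | ⟨rfl, rfl⟩ | ⟨rfl, rfl⟩ | ⟨rfl, rfl⟩ :
    s = 0 ∧ t = 0 ∨ s = 1 ∧ t = 0 ∨ s = 0 ∧ t = 1 ∨ s = 1 ∧ t = 1 := by omega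
  · refine absurd (Set.eq_univ_of_forall fun i => (hmem i).2 ?_) hJ
    generalize e i = a
    fin_cases a <;> rfl
  · have key : ∀ a : Fin 6, (![1, 0, 0, 0, 0, 0] : Fin 6 → ℕ) a = 0 ↔
        ∃ k, (![5, 4, 3, 2, 1] : Fin 5 → Fin 6) k = a := by decide
    refine Or.inl ⟨h', parabolicIsType_of_range he ![5, 4, 3, 2, 1] (by decide)
      (fun i => (hmem i).trans (key _)) fun k l => ?_⟩
    fin_cases k <;> fin_cases l <;> decide
  · have key : ∀ a : Fin 6, (![0, 0, 0, 0, 0, 1] : Fin 6 → ℕ) a = 0 ↔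
        ∃ k, (![0, 2, 3, 4, 1] : Fin 5 → Fin 6) k = a := by decide
    refine Or.inl ⟨h', parabolicIsType_of_range he ![0, 2, 3, 4, 1] (by decide)
      (fun i => (hmem i).trans (key _)) fun k l => ?_⟩
    fin_cases k <;> fin_cases l <;> decide
  · have key : ∀ a : Fin 6, (![1, 0, 0, 0, 0, 1] : Fin 6 → ℕ) a = 0 ↔
        ∃ k, (![2, 3, 4, 1] : Fin 4 → Fin 6) k = a := by decide
    refine Or.inr ⟨h', parabolicIsType_of_range he ![2, 3, 4, 1] (by decide)
      (fun i => (hmem i).trans (key _)) fun k l => ?_⟩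
    fin_cases k <;> fin_cases l <;> decide

end Rows

end WeylCover

theorem proposition1p3 {ι K V V' : Type*} [Finite ι] [Field K] [CharZero K]
    [AddCommGroup V] [Module K V] [AddCommGroup V'] [Module K V']
    (Φ : RootPairing ι K V V') [Φ.IsRootSystem] [Φ.IsCrystallographic] [Φ.IsReduced]
    [Φ.IsIrreducible] (b : Φ.Base) (J : Set b.support) :
    (∀ (n r : ℕ) (m : Fin r → ℕ), WeylCover.RowA b J n r m →
      (WeylCover.aP b J : ℚ) =
        ((n / 2).factorial : ℚ) / ∏ i, ((m i / 2).factorial : ℚ)) ∧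
    (∀ n : ℕ, WeylCover.RowD b J n → WeylCover.aP b J = 2) ∧
    (WeylCover.RowE6D5 b J → WeylCover.aP b J = 3) ∧
    (WeylCover.RowE6D4 b J → WeylCover.aP b J = 6) ∧
    (J ≠ Set.univ →
      (¬ ∃ (n r : ℕ) (m : Fin r → ℕ), WeylCover.RowA b J n r m) →
      (¬ ∃ n : ℕ, WeylCover.RowD b J n) →
      ¬ WeylCover.RowE6D5 b J →
      ¬ WeylCover.RowE6D4 b J →
      WeylCover.aP b J = 0) := by
  refine ⟨fun n r m h => WeylCover.aP_of_rowA h, fun n h => WeylCover.aP_of_rowD h,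
    WeylCover.aP_of_rowE6D5, WeylCover.aP_of_rowE6D4, fun hJ hA hD h5 h4 => ?_⟩
  by_contra h0
  by_cases hopp : ∀ i, WeylCover.opposition b i = i
  · exact h0 (WeylCover.aP_eq_zero_of_opposition_eq b J hJ hopp)
  push Not at hopp
  rcases WeylCover.isType_of_opposition b hopp with ⟨N, h⟩ | ⟨n, hn, h⟩ | h
  · exact hA (WeylCover.exists_rowA h h0)
  · exact hD (WeylCover.exists_rowD hn h hopp hJ h0)
  · exact (WeylCover.rowE6_of_aP_ne_zero h hJ h0).elim h5 h4
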